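/- **Setting.** Let $t>0$, $R>0$, $B(0,R)\subset\mathbb R^3$ the open ball, and $h_+=\frac{3+\sqrt{9+8t}}{4}$. Let $S_0$ be the space of symmetric traceless real $3\times3$ matrices, with $|\mathbf Q|^2=\mathbf Q_{ij}\mathbf Q_{ij}$ (repeated indices are summed over $1,2,3$, and $_{,k}=\partial/\partial x_k$). The Landau–de Gennes energy is $$I_t[\mathbf Q]=\int_{B(0,R)}\tfrac12|\nabla \mathbf Q|^2-\tfrac12\operatorname{tr}\mathbf Q^2-\tfrac{\sqrt6\,h_+}{t}\operatorname{tr}\mathbf Q^3+\tfrac{h_+^2}{2t}(\operatorname{tr}\mathbf Q^2)^2+\Big(\tfrac12+\tfrac{h_+}{t}-\tfrac{h_+^2}{2t}\Big)\,dV,$$ whose integrand is nonnegative, on the admissible space $$\mathcal A=\Big\{\mathbf Q\in W^{1,2}(B(0,R);S_0):\ \mathbf Q=\sqrt{\tfrac32}\Big(\tfrac{x\otimes x}{|x|^2}-\tfrac13\mathbf I\Big)\text{ on }\partial B(0,R)\Big\}.$$ Let $\mathbf Q$ be (the continuous representative in $B(0,R)$ of) a global minimizer of $I_t$ in $\mathcal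 A$ which is uniaxial, that is, $\mathbf Q(x)=s(x)\big(n(x)\otimes n(x)-\frac13\mathbf I\big)$ on $B(0,R)$ with $s(x)\in\mathbb R$ and $|n(x)|=1$, and which satisfies $\mathbf Q(0)=0$. Let $h:[0,\infty)\to[0,1]$ be a continuous function, twice differentiable on $(0,\infty)$, with $$h''+\tfrac2r h'-\tfrac{6}{r^2}h=h^3-h+\tfrac{3h_+}{t}(h^3-h^2)\quad(r>0),\qquad h(0)=0,\qquad \lim_{r\to\infty}h(r)=1.$$ Put $\mathbf S(x)=\mathbf Q(x)/h(|x|)$ for $0<|x|<R$ and $$\Phi_p=\tfrac12|\nabla\mathbf S|^2\frac{x_p}{|x|}-\frac{\mathbf S_{ij,k}x_k}{|x|}\mathbf S_{ij,p}+\Big(1+\frac{3h_+}{t}\Big)\frac{x_p}{|x|}\frac{h(|x|)^2(1-|\mathbf S|^2)^2}{4}+\frac{3x_p(1-|\mathbf S|^2)}{|x|^3},\qquad p=1,2,3.$$ **Claim.** $\mathbf S$ is continuously differentiable on $0<|x|<R$ (so that $\Phi$ is well defined there), the function $\Phi_p\,x_p/|x|$ is integrable over each sphere $|x|=\delta$,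 $0<\delta<R$, and $$\int_{|x|=\delta}\Phi_p\,\frac{x_p}{|x|}\,dA\ \longrightarrow\ 12\pi\qquad\text{as }\delta\to0^+.$$ -/

import Mathlib

open MeasureTheory Filter Topology Metric
open scoped ContDiff

noncomputable section

namespace LandauDeGennes

/-- Euclidean three-space. -/
abbrev E3 : Type := EuclideanSpace ℝ (Fin 3)

/-- Real `3 × 3` matrices. -/
abbrev Mat3 : Type := Matrix (Fin 3) (Fin 3) ℝ

/-- Symmetric traceless `3 × 3` matrices. -/
def S0 : Set Mat3 := {A | A.IsSymm ∧ A.trace = 0}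

/-- The squared norm `|A|² = A_ij A_ij`. -/
def normSq (A : Mat3) : ℝ := ∑ i, ∑ j, A i j ^ 2

/-- The uniaxial tensor `s (n ⊗ n - I/3)`. -/
def uniaxial (s : ℝ) (n : E3) : Mat3 :=
  s • (Matrix.vecMulVec (fun i => n i) (fun i => n i) - (1 / 3 : ℝ) • (1 : Mat3))

/-- `Q` is purely uniaxial on `Ω`: `Q = s (n ⊗ n - I/3)` for a real function `s` of either sign
and a unit-vector field `n`. -/
def IsUniaxialOn (Q : E3 → Mat3) (Ω : Set E3) : Prop :=
  ∃ (s : E3 → ℝ) (n : E3 → E3), ∀ x ∈ Ω, ‖n x‖ = 1 ∧ Q x = uniaxial (s x) (n x)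

/-- The classical partial derivative `∂f/∂x_k`. -/
def pd (k : Fin 3) (f : E3 → ℝ) (x : E3) : ℝ :=
  fderiv ℝ f x (EuclideanSpace.single k 1)

/-! ### Sobolev spaces on an open set -/

/-- Test functions: smooth functions with compact support contained in `Ω`. -/
def IsTest (Ω : Set E3) (φ : E3 → ℝ) : Prop :=
  ContDiff ℝ ∞ φ ∧ HasCompactSupport φ ∧ tsupport φ ⊆ Ω

/-- `u ∈ W^{1,2}(Ω)`, with weak gradient `g`. -/
structure MemW12 (Ω : Set E3) (u : E3 → ℝ) (g : Fin 3 → E3 → ℝ) : Prop where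
  memLp : MemLp u 2 (volume.restrict Ω)
  memLp_grad : ∀ k, MemLp (g k) 2 (volume.restrict Ω)
  weak : ∀ k φ, IsTest Ω φ → ∫ x in Ω, u x * pd k φ x = -∫ x in Ω, g k x * φ x

/-- `u ∈ W^{1,2}_0(Ω)`, with weak gradient `g`: `u` is a limit of test functions in `W^{1,2}(Ω)`. -/
structure MemW12Zero (Ω : Set E3) (u : E3 → ℝ) (g : Fin 3 → E3 → ℝ) : Prop
    extends MemW12 Ω u g where
  approx : ∃ φ : ℕ → E3 → ℝ, (∀ m, IsTest Ω (φ m)) ∧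
    Tendsto (fun m => eLpNorm (fun x => u x - φ m x) 2 (volume.restrict Ω)) atTop (𝓝 0) ∧
    ∀ k, Tendsto (fun m => eLpNorm (fun x => g k x - pd k (φ m) x) 2 (volume.restrict Ω))
      atTop (𝓝 0)

/-! ### The Landau-de Gennes energy -/

/-- The boundary datum `√(3/2) (x ⊗ x / |x|² - I/3)`, as a function of `x ≠ 0`. -/
def boundaryDatum (x : E3) : Mat3 := uniaxial (√(3 / 2)) (‖x‖⁻¹ • x)

/-- `Q`, with weak gradient `G i j k = Q_ij,k`, is in the admissible space: it is a
`W^{1,2}(B(0,R); S₀)` function that equals the boundary datum on `∂B(0,R)`, that is, its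
difference with the datum is in `W^{1,2}_0`. -/
structure IsAdmissible (R : ℝ) (Q : E3 → Mat3) (G : Fin 3 → Fin 3 → Fin 3 → E3 → ℝ) : Prop where
  mem_S0 : ∀ᵐ x ∂(volume.restrict (ball (0 : E3) R)), Q x ∈ S0
  memW12 : ∀ i j, MemW12 (ball 0 R) (fun x => Q x i j) (G i j)
  boundary : ∀ i j, ∃ D, MemW12Zero (ball 0 R) (fun x => Q x i j - boundaryDatum x i j) D

/-- The constant `h₊ = (3 + √(9 + 8t)) / 4`. -/
def hPlus (t : ℝ) : ℝ := (3 + √(9 + 8 * t)) / 4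

/-- The bulk energy density, with the additive constant that makes its minimum over `S₀` zero. -/
def bulk (t : ℝ) (A : Mat3) : ℝ :=
  -(1 / 2) * (A ^ 2).trace - √6 * hPlus t / t * (A ^ 3).trace
    + hPlus t ^ 2 / (2 * t) * (A ^ 2).trace ^ 2
    + (1 / 2 + hPlus t / t - hPlus t ^ 2 / (2 * t))

/-- The Landau-de Gennes energy on `B(0,R)`, with values in `[0,∞]`. The density is nonnegative
on `S₀` for `t > 0`, so that `ENNReal.ofReal` loses nothing. -/
def energy (t R : ℝ) (Q : E3 → Mat3) (G : Fin 3 → Fin 3 → Fin 3 → E3 → ℝ) : ENNReal :=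
  ∫⁻ x in ball (0 : E3) R,
    ENNReal.ofReal ((1 / 2) * (∑ i, ∑ j, ∑ k, G i j k x ^ 2) + bulk t (Q x))

/-- `Q` is a global minimizer of the energy in the admissible space (weak gradients are unique
up to null sets). -/
def IsGlobalMinimizer (t R : ℝ) (Q : E3 → Mat3) : Prop :=
  ∃ G, IsAdmissible R Q G ∧
    ∀ P H, IsAdmissible R P H → energy t R Q G ≤ energy t R P H

/-! ### The radial-hedgehog profile -/

/-- `h` solves `h'' + 2h'/r - 6h/r² = h³ - h + (3h₊/t)(h³ - h²)` on `(0,∞)` with `h(0) = 0`,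
`h(r) → 1` as `r → ∞` and `0 ≤ h ≤ 1`. -/
structure IsHedgehogProfile (t : ℝ) (h : ℝ → ℝ) : Prop where
  cont : ContinuousOn h (Set.Ici 0)
  diff : ∀ r, 0 < r → DifferentiableAt ℝ h r
  diff' : ∀ r, 0 < r → DifferentiableAt ℝ (deriv h) r
  ode : ∀ r, 0 < r → deriv (deriv h) r + 2 / r * deriv h r - 6 * h r / r ^ 2
      = h r ^ 3 - h r + 3 * hPlus t / t * (h r ^ 3 - h r ^ 2)
  zero : h 0 = 0
  tendsto_one : Tendsto h atTop (𝓝 1)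
  bounds : ∀ r, 0 ≤ r → 0 ≤ h r ∧ h r ≤ 1

/-! ### The quotient field, the vector field `Φ` and its flux -/

/-- `S(x) = Q(x) / h(|x|)`. -/
def quotientField (Q : E3 → Mat3) (h : ℝ → ℝ) (x : E3) : Mat3 :=
  Matrix.of fun i j => Q x i j / h ‖x‖

/-- The vector field
`Φ_p = ½|∇S|² x_p/|x| - (S_ij,k x_k/|x|) S_ij,p + (1 + 3h₊/t) (x_p/|x|) h² (1 - |S|²)²/4
+ 3 x_p (1 - |S|²)/|x|³`. -/
def Phi (t : ℝ) (h : ℝ → ℝ) (S : E3 → Mat3) (p : Fin 3) (x : E3) : ℝ :=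
  (1 / 2) * (∑ i, ∑ j, ∑ k, pd k (fun y => S y i j) x ^ 2) * (x p / ‖x‖)
    - (∑ i, ∑ j, (∑ k, pd k (fun y => S y i j) x * x k / ‖x‖) * pd p (fun y => S y i j) x)
    + (1 + 3 * hPlus t / t) * (x p / ‖x‖) * (h ‖x‖ ^ 2 * (1 - normSq (S x)) ^ 2 / 4)
    + 3 * x p * (1 - normSq (S x)) / ‖x‖ ^ 3

/-- The normal component `Φ_p x_p / |x|`. -/
def normalPhi (t : ℝ) (h : ℝ → ℝ) (S : E3 → Mat3) (x : E3) : ℝ :=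
  ∑ p, Phi t h S p x * (x p / ‖x‖)

/-- The surface integral of `f` over the sphere `|x| = δ`, written as `δ²` times an integral over
the unit sphere with its surface measure (of total mass `4π`). -/
def sphereIntegral (δ : ℝ) (f : E3 → ℝ) : ℝ :=
  δ ^ 2 * ∫ v : sphere (0 : E3) 1, f (δ • (v : E3)) ∂((volume : Measure E3).toSphere)

end LandauDeGennes

end

/-! The flux is computed by blowing up at the origin. Let `H` be the Hessian of Q at 0. If Q is C²
near 0 with Q(0) = 0 and ∇Q(0) = 0, and if h(r) ~ c r² and h'(r) ~ 2cr with c > 0, then at x = δv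
with |v| = 1 the tensor S tends to v·Hv/(2c). This limit is homogeneous of degree 0, so its radial
derivative vanishes. After multiplication by δ² the normal component of Φ tends to 3 + (2|Hv|² -
5(v·Hv)²)/(4c²), summed over the entries ij; the potential term carries a factor δ²h² and
disappears. For a symmetric traceless matrix A, the sphere averages of |Av|² and (v·Av)² are tr A²/3
and 2 tr A²/15, so the quadratic part has mean zero and 3 · 4π = 12π remains. A second-order Taylor
bound supplies the domination needed to pass to the limit (`tendsto_sphereIntegral_normalPhi`).

Four inputs feed this computation.

Regularity (`minimizer_regularity`): the energy along Q + eφE is an exact polynomial in e, so its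
linear coefficient vanishes. This gives ΔQ = a polynomial in Q without constant term, tested against
Δφ. Interior regularity for the Poisson equation, obtained from a localized and regularized
Newtonian kernel, raises Q from C⁰ to C¹ to C². At 0 the right-hand side vanishes, so each entry of
Q has a traceless Hessian there.

Sign (`trace_cube_nonneg_of_minimizer`): where tr Q³ < 0, replacing Q by -Q leaves the gradient
energy unchanged and lowers the bulk energy. Such a Q stays far from the boundary datum, relative to
its size, so the region should not reach the boundary. As the boundary condition holds only in the
W^{1,2}₀ sense, the flip is cut off by a function of |Q|²|ψ|²/(|Q|⁴ + ε), with ψ a test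
approximation of Q minus the datum. The cost of the cutoff tends to zero, while the gain on a fixed
ball does not.

Gradient (`pd_eq_zero_of_trace_cube_nonneg`): the linear blow-up L of Q at 0 satisfies tr L(v)³ ≥ 0.
As this is odd in v, it is zero, and the uniaxial identity 6 (tr Q³)² = |Q|⁶ forces L = 0.

Profile (`exists_asymptotics`): the equation for h is (r⁶(h/r²)')' = r⁴ times its right-hand side.
Boundedness of h excludes the singular behaviour r⁻³, and a two-step bootstrap gives the limit of
h/r². -/

namespace LandauDeGennes

/-! ### Compactly supported functions, partial derivatives and integration by parts -/

/-- `C¹` functions with compact support contained in `Ω`. -/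
structure IsC1Test (Ω : Set E3) (p : E3 → ℝ) : Prop where
  contDiff : ContDiff ℝ 1 p
  compact : HasCompactSupport p
  subset : tsupport p ⊆ Ω

theorem IsTest.isC1Test {Ω : Set E3} {φ : E3 → ℝ} (h : IsTest Ω φ) : IsC1Test Ω φ :=
  ⟨h.1.of_le (by exact_mod_cast le_top), h.2.1, h.2.2⟩

/-- A point outside Ω is off the closed support of g, so the product vanishes near it. This
globalizes functions that are regular only on Ω. -/
theorem contDiff_mul_of_tsupport_subset {Ω : Set E3} (hΩ : IsOpen Ω) {n : WithTop ℕ∞}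
    {f g : E3 → ℝ} (hf : ContDiffOn ℝ n f Ω) (hg : ContDiff ℝ n g) (hs : tsupport g ⊆ Ω) :
    ContDiff ℝ n (fun x => f x * g x) := by
  rw [contDiff_iff_contDiffAt]
  intro x
  by_cases hx : x ∈ Ω
  · exact (hf.contDiffAt (hΩ.mem_nhds hx)).mul hg.contDiffAt
  · have h0 : (fun x => f x * g x) =ᶠ[𝓝 x] fun _ => 0 := by
      have := notMem_tsupport_iff_eventuallyEq.1 (fun h => hx (hs h))
      filter_upwards [this] with y hy
      simp [hy]
    exact contDiffAt_const.congr_of_eventuallyEq h0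

theorem continuous_mul_of_tsupport_subset {Ω : Set E3} (hΩ : IsOpen Ω)
    {f g : E3 → ℝ} (hf : ContinuousOn f Ω) (hg : Continuous g) (hs : tsupport g ⊆ Ω) :
    Continuous (fun x => f x * g x) := by
  have := contDiff_mul_of_tsupport_subset (n := 0) hΩ (contDiffOn_zero.2 hf) (contDiff_zero.2 hg) hs
  exact contDiff_zero.1 this

theorem integrable_mul_of_tsupport_subset {Ω : Set E3} (hΩ : IsOpen Ω)
    {f g : E3 → ℝ} (hf : ContinuousOn f Ω) (hg : Continuous g) (hc : HasCompactSupport g)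
    (hs : tsupport g ⊆ Ω) : Integrable (fun x => f x * g x) :=
  (continuous_mul_of_tsupport_subset hΩ hf hg hs).integrable_of_hasCompactSupport
    (hc.mul_left (f := f))

theorem setIntegral_eq_integral_of_tsupport_subset {Ω : Set E3} {f g : E3 → ℝ}
    (hs : tsupport g ⊆ Ω) : ∫ x in Ω, f x * g x = ∫ x, f x * g x := by
  apply setIntegral_eq_integral_of_forall_compl_eq_zero
  intro x hx
  rw [image_eq_zero_of_notMem_tsupport (fun h => hx (hs h)), mul_zero]

theorem tsupport_pd_subset (k : Fin 3) (f : E3 → ℝ) : tsupport (pd k f) ⊆ tsupport f := by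
  refine (closure_mono ?_).trans (tsupport_fderiv_subset ℝ (f := f))
  intro x hx
  simp only [Function.mem_support, pd] at hx ⊢
  intro h
  simp [h] at hx

theorem HasCompactSupport.pd {f : E3 → ℝ} (hf : HasCompactSupport f) (k : Fin 3) :
    HasCompactSupport (pd k f) :=
  hf.of_isClosed_subset (isClosed_tsupport _) (tsupport_pd_subset k f)

theorem contDiff_pd {n m : WithTop ℕ∞} {f : E3 → ℝ} (hf : ContDiff ℝ n f) (h : m + 1 ≤ n)
    (k : Fin 3) : ContDiff ℝ m (pd k f) :=
  (hf.fderiv_right h).clm_apply contDiff_const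

theorem contDiffOn_pd {n m : WithTop ℕ∞} {f : E3 → ℝ} {Ω : Set E3} (hΩ : IsOpen Ω)
    (hf : ContDiffOn ℝ n f Ω) (h : m + 1 ≤ n) (k : Fin 3) : ContDiffOn ℝ m (pd k f) Ω :=
  (hf.fderiv_of_isOpen hΩ h).clm_apply contDiffOn_const

theorem IsTest.pd {Ω : Set E3} {φ : E3 → ℝ} (h : IsTest Ω φ) (k : Fin 3) : IsTest Ω (pd k φ) :=
  ⟨contDiff_pd h.1 (by exact_mod_cast le_top) k, HasCompactSupport.pd h.2.1 k,
    (tsupport_pd_subset k φ).trans h.2.2⟩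

theorem IsC1Test.continuous_pd {Ω : Set E3} {p : E3 → ℝ} (h : IsC1Test Ω p) (k : Fin 3) :
    Continuous (LandauDeGennes.pd k p) :=
  contDiff_zero.1 (contDiff_pd h.contDiff (by norm_num) k)

theorem IsC1Test.const_mul {Ω : Set E3} {p : E3 → ℝ} (h : IsC1Test Ω p) (c : ℝ) :
    IsC1Test Ω (fun x => c * p x) :=
  ⟨contDiff_const.mul h.contDiff, h.compact.mul_left (f := fun _ => c),
    (tsupport_mul_subset_right (f := fun _ => c)).trans h.subset⟩

theorem pd_add {f g : E3 → ℝ} {x : E3} (hf : DifferentiableAt ℝ f x) (hg : DifferentiableAt ℝ g x)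
    (k : Fin 3) : pd k (fun y => f y + g y) x = pd k f x + pd k g x := by
  simp only [pd]; rw [fderiv_fun_add hf hg]; rfl

theorem pd_mul {f g : E3 → ℝ} {x : E3} (hf : DifferentiableAt ℝ f x) (hg : DifferentiableAt ℝ g x)
    (k : Fin 3) : pd k (fun y => f y * g y) x = f x * pd k g x + pd k f x * g x := by
  simp only [pd]; rw [fderiv_fun_mul hf hg]; simp [mul_comm]

theorem pd_const_mul {f : E3 → ℝ} {x : E3} (c : ℝ) (hf : DifferentiableAt ℝ f x)
    (k : Fin 3) : pd k (fun y => c * f y) x = c * pd k f x := by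
  simp only [pd]; rw [fderiv_const_mul hf]; rfl

theorem pd_comp {g : ℝ → ℝ} {f : E3 → ℝ} {x : E3} (hg : DifferentiableAt ℝ g (f x))
    (hf : DifferentiableAt ℝ f x) (k : Fin 3) :
    pd k (fun y => g (f y)) x = deriv g (f x) * pd k f x := by
  have := (hg.hasDerivAt.comp_hasFDerivAt x hf.hasFDerivAt).fderiv
  simp only [pd]
  rw [show (fun y => g (f y)) = g ∘ f from rfl, this]
  simp

/-- Integration by parts against a compactly supported `C¹` function. -/
theorem setIntegral_mul_pd {Ω : Set E3} (hΩ : IsOpen Ω) {f φ : E3 → ℝ} (hf : ContDiffOn ℝ 1 f Ω)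
    (hφ : IsC1Test Ω φ) (k : Fin 3) :
    ∫ x in Ω, f x * pd k φ x = -∫ x in Ω, pd k f x * φ x := by
  have hs := (tsupport_pd_subset k φ).trans hφ.subset
  rw [setIntegral_eq_integral_of_tsupport_subset hs,
    setIntegral_eq_integral_of_tsupport_subset hφ.subset]
  have hpd : ContinuousOn (pd k f) Ω :=
    contDiffOn_zero.1 (contDiffOn_pd hΩ hf (by norm_num) k)
  refine integral_mul_fderiv_eq_neg_fderiv_mul_of_integrable
    (integrable_mul_of_tsupport_subset hΩ hpd hφ.contDiff.continuous hφ.compact hφ.subset)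
    (integrable_mul_of_tsupport_subset hΩ hf.continuousOn (hφ.continuous_pd k)
      (HasCompactSupport.pd hφ.compact k) hs)
    (integrable_mul_of_tsupport_subset hΩ hf.continuousOn hφ.contDiff.continuous
      hφ.compact hφ.subset) ?_ ?_
  · intro x hx
    exact (hf.contDiffAt (hΩ.mem_nhds (hφ.subset hx))).differentiableAt (by norm_num)
  · intro x _
    exact hφ.contDiff.differentiable (by norm_num) x

/-- Approximation of compactly supported `C¹` functions by test functions, uniformly together with
the first derivatives. -/
theorem IsC1Test.exists_isTest_approx {Ω : Set E3} (hΩ : IsOpen Ω) {p : E3 → ℝ}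
    (hp : IsC1Test Ω p) {ε : ℝ} (hε : 0 < ε) :
    ∃ ψ, IsTest Ω ψ ∧ (∀ x, |p x - ψ x| ≤ ε) ∧ ∀ k x, |pd k p x - pd k ψ x| ≤ ε := by
  obtain ⟨δ₀, hδ₀, hsub⟩ := hp.compact.isCompact.exists_cthickening_subset_open hΩ hp.subset
  have huc : UniformContinuous p := hp.compact.uniformContinuous_of_continuous
    hp.contDiff.continuous
  have hucd : UniformContinuous (fderiv ℝ p) :=
    (hp.compact.fderiv ℝ).uniformContinuous_of_continuous
      (hp.contDiff.continuous_fderiv (by norm_num))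
  obtain ⟨δ₁, hδ₁, h1⟩ := Metric.uniformContinuous_iff.1 huc ε hε
  obtain ⟨δ₂, hδ₂, h2⟩ := Metric.uniformContinuous_iff.1 hucd ε hε
  -- Mollification radius: δ₀ keeps the support inside Ω, while δ₁ and δ₂ come from the uniform
  -- continuity of p and of its derivative for tolerance ε.
  set δ := min δ₀ (min δ₁ δ₂)
  have hδ : 0 < δ := by positivity
  set φ : ContDiffBump (0 : E3) := ⟨δ / 2, δ, half_pos hδ, half_lt_self hδ⟩
  set L := ContinuousLinearMap.lsmul ℝ ℝ (E := ℝ)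
  set ψ : E3 → ℝ := convolution (φ.normed volume) p L volume
  have hloc : LocallyIntegrable (φ.normed (volume : Measure E3)) :=
    φ.continuous_normed.locallyIntegrable
  have hpd : ∀ k x, pd k ψ x = convolution (φ.normed volume) (pd k p) L volume x := by
    intro k x
    have := hp.compact.hasFDerivAt_convolution_right L hloc hp.contDiff x
    simp only [pd]
    rw [this.fderiv]
    exact convolution_precompR_apply L hloc (hp.compact.fderiv ℝ)
      (hp.contDiff.continuous_fderiv (by norm_num)) x _
  have hsupp : tsupport ψ ⊆ cthickening δ₀ (tsupport p) := by
    refine closure_minimal ?_ isClosed_cthickening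
    refine (support_convolution_subset L).trans ?_
    rintro _ ⟨a, ha, b, hb, rfl⟩
    rw [φ.support_normed_eq] at ha
    refine mem_cthickening_of_dist_le _ b _ _ (subset_tsupport _ hb) ?_
    have : ‖a‖ < δ := by simpa using ha
    simpa [dist_eq_norm] using this.le.trans (min_le_left _ _)
  refine ⟨ψ, ⟨?_, ?_, hsupp.trans hsub⟩, ?_, ?_⟩
  · exact φ.hasCompactSupport_normed.contDiff_convolution_left L φ.contDiff_normed
      hp.contDiff.continuous.locallyIntegrable
  · exact HasCompactSupport.convolution L φ.hasCompactSupport_normed hp.compact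
  · intro x
    rw [abs_sub_comm, ← Real.dist_eq]
    refine φ.dist_normed_convolution_le hp.contDiff.continuous.aestronglyMeasurable ?_
    intro y hy
    exact (h1 (lt_of_lt_of_le hy ((min_le_right _ _).trans (min_le_left _ _)))).le
  · intro k x
    rw [hpd, abs_sub_comm, ← Real.dist_eq]
    refine φ.dist_normed_convolution_le (hp.continuous_pd k).aestronglyMeasurable ?_
    intro y hy
    have h3 := (h2 (lt_of_lt_of_le hy ((min_le_right _ _).trans (min_le_right _ _)))).le
    rw [dist_eq_norm] at h3 ⊢
    have := (fderiv ℝ p y - fderiv ℝ p x).le_opNorm (EuclideanSpace.single k 1)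
    simp only [sub_apply, PiLp.norm_single, norm_one, mul_one] at this
    exact this.trans h3

/-! ### Operations on `W^{1,2}` and `W^{1,2}₀` -/

theorem memLp_of_continuous_compact {Ω : Set E3} {f : E3 → ℝ} (hf : Continuous f)
    (hc : HasCompactSupport f) (p : ENNReal) : MemLp f p (volume.restrict Ω) :=
  (hf.memLp_of_hasCompactSupport hc).restrict Ω

theorem tendsto_eLpNorm_of_uniform {Ω : Set E3} (hfin : volume Ω ≠ ⊤) {f : ℕ → E3 → ℝ}
    (hf : ∀ m x, |f m x| ≤ 1 / ((m : ℝ) + 1)) :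
    Tendsto (fun m => eLpNorm (f m) 2 (volume.restrict Ω)) atTop (𝓝 0) := by
  have hb : ∀ m, eLpNorm (f m) 2 (volume.restrict Ω) ≤
      (volume.restrict Ω) Set.univ ^ (2 : ENNReal).toReal⁻¹ *
        ENNReal.ofReal (1 / ((m : ℝ) + 1)) := by
    intro m
    exact eLpNorm_le_of_ae_bound (Eventually.of_forall fun x => by simpa using hf m x)
  refine tendsto_of_tendsto_of_tendsto_of_le_of_le tendsto_const_nhds ?_ (fun _ => zero_le) hb
  have h0 : Tendsto (fun m : ℕ => ENNReal.ofReal (1 / ((m : ℝ) + 1))) atTop (𝓝 0) := by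
    have := ENNReal.tendsto_ofReal (tendsto_one_div_add_atTop_nhds_zero_nat (𝕜 := ℝ))
    simpa using this
  have h1 : (volume.restrict Ω) Set.univ ^ (2 : ENNReal).toReal⁻¹ ≠ ⊤ := by
    refine ENNReal.rpow_ne_top_of_nonneg (by positivity) ?_
    simpa using hfin
  simpa using ENNReal.Tendsto.const_mul h0 (Or.inr h1)

/-- The competitors used later are C¹ but not smooth perturbations of Q, and this makes them
admissible. Mollification with tolerance 1/(m+1) supplies the approximating sequence; uniform
closeness gives L² closeness because Ω has finite measure. -/
theorem IsC1Test.memW12Zero {Ω : Set E3} (hΩ : IsOpen Ω) (hfin : volume Ω ≠ ⊤) {p : E3 → ℝ}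
    (hp : IsC1Test Ω p) : MemW12Zero Ω p (fun k => LandauDeGennes.pd k p) where
  memLp := memLp_of_continuous_compact hp.contDiff.continuous hp.compact 2
  memLp_grad k := memLp_of_continuous_compact (hp.continuous_pd k)
    (HasCompactSupport.pd hp.compact k) 2
  weak k φ hφ := setIntegral_mul_pd hΩ hp.contDiff.contDiffOn hφ.isC1Test k
  approx := by
    choose ψ hψ h0 h1 using fun m : ℕ =>
      hp.exists_isTest_approx hΩ (ε := 1 / ((m : ℝ) + 1)) (by positivity)
    exact ⟨ψ, hψ, tendsto_eLpNorm_of_uniform hfin h0,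
      fun k => tendsto_eLpNorm_of_uniform hfin (fun m x => h1 m k x)⟩

theorem IsTest.integrable_mul {Ω : Set E3} {φ u : E3 → ℝ} (hφ : IsTest Ω φ)
    (hu : MemLp u 2 (volume.restrict Ω)) :
    Integrable (fun x => u x * φ x) (volume.restrict Ω) :=
  hu.integrable_mul (memLp_of_continuous_compact hφ.1.continuous hφ.2.1 2)

theorem MemW12.add {Ω : Set E3} {u v : E3 → ℝ} {g w : Fin 3 → E3 → ℝ} (hu : MemW12 Ω u g)
    (hv : MemW12 Ω v w) : MemW12 Ω (fun x => u x + v x) (fun k x => g k x + w k x) where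
  memLp := hu.memLp.add hv.memLp
  memLp_grad k := (hu.memLp_grad k).add (hv.memLp_grad k)
  weak k φ hφ := by
    simp only [add_mul]
    rw [integral_add ((hφ.pd k).integrable_mul hu.memLp) ((hφ.pd k).integrable_mul hv.memLp),
      integral_add (hφ.integrable_mul (hu.memLp_grad k)) (hφ.integrable_mul (hv.memLp_grad k)),
      hu.weak k φ hφ, hv.weak k φ hφ]
    ring

theorem MemW12.sub {Ω : Set E3} {u v : E3 → ℝ} {g w : Fin 3 → E3 → ℝ} (hu : MemW12 Ω u g)
    (hv : MemW12 Ω v w) : MemW12 Ω (fun x => u x - v x) (fun k x => g k x - w k x) where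
  memLp := hu.memLp.sub hv.memLp
  memLp_grad k := (hu.memLp_grad k).sub (hv.memLp_grad k)
  weak k φ hφ := by
    simp only [sub_mul]
    rw [integral_sub ((hφ.pd k).integrable_mul hu.memLp) ((hφ.pd k).integrable_mul hv.memLp),
      integral_sub (hφ.integrable_mul (hu.memLp_grad k)) (hφ.integrable_mul (hv.memLp_grad k)),
      hu.weak k φ hφ, hv.weak k φ hφ]
    ring

theorem MemW12Zero.congr {Ω : Set E3} {u v : E3 → ℝ} {g : Fin 3 → E3 → ℝ}
    (h : MemW12Zero Ω u g) (huv : ∀ x, u x = v x) : MemW12Zero Ω v g := by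
  obtain rfl : u = v := funext huv
  exact h

theorem tendsto_eLpNorm_add {Ω : Set E3} {f g : ℕ → E3 → ℝ}
    (hfm : ∀ m, AEStronglyMeasurable (f m) (volume.restrict Ω))
    (hgm : ∀ m, AEStronglyMeasurable (g m) (volume.restrict Ω))
    (hf : Tendsto (fun m => eLpNorm (f m) 2 (volume.restrict Ω)) atTop (𝓝 0))
    (hg : Tendsto (fun m => eLpNorm (g m) 2 (volume.restrict Ω)) atTop (𝓝 0)) :
    Tendsto (fun m => eLpNorm (fun x => f m x + g m x) 2 (volume.restrict Ω)) atTop (𝓝 0) := by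
  refine tendsto_of_tendsto_of_tendsto_of_le_of_le tendsto_const_nhds
    (by simpa using hf.add hg) (fun _ => zero_le)
    (fun m => eLpNorm_add_le (hfm m) (hgm m) (by norm_num))

theorem MemW12Zero.add {Ω : Set E3} {u v : E3 → ℝ} {g w : Fin 3 → E3 → ℝ}
    (hu : MemW12Zero Ω u g) (hv : MemW12Zero Ω v w) :
    MemW12Zero Ω (fun x => u x + v x) (fun k x => g k x + w k x) where
  toMemW12 := hu.toMemW12.add hv.toMemW12
  approx := by
    obtain ⟨φ, hφ, hφ0, hφ1⟩ := hu.approx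
    obtain ⟨ψ, hψ, hψ0, hψ1⟩ := hv.approx
    have hd : ∀ m x, DifferentiableAt ℝ (φ m) x := fun m x =>
      (hφ m).1.differentiable (by norm_num) x
    have hd' : ∀ m x, DifferentiableAt ℝ (ψ m) x := fun m x =>
      (hψ m).1.differentiable (by norm_num) x
    refine ⟨fun m x => φ m x + ψ m x, fun m => ⟨(hφ m).1.add (hψ m).1,
      (hφ m).2.1.add (hψ m).2.1, ?_⟩, ?_, ?_⟩
    · exact (tsupport_add (φ m) (ψ m)).trans (Set.union_subset (hφ m).2.2 (hψ m).2.2)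
    · convert tendsto_eLpNorm_add
        (fun m => (hu.memLp.aestronglyMeasurable.sub (hφ m).1.continuous.aestronglyMeasurable))
        (fun m => (hv.memLp.aestronglyMeasurable.sub (hψ m).1.continuous.aestronglyMeasurable))
        hφ0 hψ0 using 4 with m x
      simp only [Pi.sub_apply]; ring
    · intro k
      convert tendsto_eLpNorm_add
        (fun m => ((hu.memLp_grad k).aestronglyMeasurable.sub
          ((hφ m).pd k).1.continuous.aestronglyMeasurable))
        (fun m => ((hv.memLp_grad k).aestronglyMeasurable.sub
          ((hψ m).pd k).1.continuous.aestronglyMeasurable))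
        (hφ1 k) (hψ1 k) using 4 with m x
      simp only [Pi.sub_apply]
      rw [pd_add (hd m x) (hd' m x)]; ring

theorem isC1Test_zero (Ω : Set E3) : IsC1Test Ω (fun _ => 0) where
  contDiff := contDiff_const
  compact := HasCompactSupport.zero
  subset := by
    have : tsupport (fun _ : E3 => (0 : ℝ)) = ∅ := tsupport_eq_empty_iff.2 rfl
    rw [this]; exact Set.empty_subset _

/-- The weak gradient of a `C¹` function is its classical gradient. -/
theorem MemW12.ae_eq_pd {Ω : Set E3} (hΩ : IsOpen Ω) {u : E3 → ℝ} {g : Fin 3 → E3 → ℝ}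
    (hu : MemW12 Ω u g) (hC : ContDiffOn ℝ 1 u Ω) (k : Fin 3) :
    ∀ᵐ x ∂(volume.restrict Ω), g k x = pd k u x := by
  have hpd : ContinuousOn (pd k u) Ω := contDiffOn_zero.1 (contDiffOn_pd hΩ hC (by norm_num) k)
  have hloc : LocallyIntegrableOn (fun x => g k x - pd k u x) Ω := by
    refine LocallyIntegrableOn.sub ?_ (hpd.locallyIntegrableOn hΩ.measurableSet)
    exact locallyIntegrableOn_of_locallyIntegrable_restrict
      ((hu.memLp_grad k).locallyIntegrable (by norm_num))
  have := hΩ.ae_eq_zero_of_integral_contDiff_smul_eq_zero hloc ?_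
  · rw [ae_restrict_iff' hΩ.measurableSet]
    filter_upwards [this] with x hx hxΩ
    linarith [hx hxΩ]
  · intro φ h1 h2 h3
    have hφ : IsTest Ω φ := ⟨h1, h2, h3⟩
    have e1 := hu.weak k φ hφ
    have e2 := setIntegral_mul_pd hΩ hC hφ.isC1Test k
    have e3 : ∫ x, φ x • (g k x - pd k u x) = ∫ x in Ω, (g k x - pd k u x) * φ x := by
      rw [setIntegral_eq_integral_of_tsupport_subset h3]
      simp only [smul_eq_mul, mul_comm]
    rw [e3]
    simp only [sub_mul]
    rw [integral_sub (hφ.integrable_mul (hu.memLp_grad k))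
      ((integrable_mul_of_tsupport_subset hΩ hpd h1.continuous h2 h3).integrableOn)]
    linarith

/-! ### The regularized Newtonian kernel -/

/-- The regularized Newtonian kernel `(|z|² + ε²)^{-1/2}`. -/
noncomputable def newt (ε : ℝ) (z : E3) : ℝ := (√(‖z‖ ^ 2 + ε ^ 2))⁻¹

theorem newt_nonneg (ε : ℝ) (z : E3) : 0 ≤ newt ε z := by unfold newt; positivity

theorem newt_sq (ε : ℝ) (z : E3) : newt ε z ^ 2 = (‖z‖ ^ 2 + ε ^ 2)⁻¹ := by
  rw [newt, inv_pow, Real.sq_sqrt (by positivity)]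

theorem newt_le (ε : ℝ) {z : E3} (hz : z ≠ 0) : newt ε z ≤ ‖z‖⁻¹ :=
  inv_anti₀ (norm_pos_iff.2 hz) (Real.le_sqrt_of_sq_le (by nlinarith [sq_nonneg ε]))

theorem hasFDerivAt_newt {ε : ℝ} {z : E3} (h : 0 < ‖z‖ ^ 2 + ε ^ 2) :
    HasFDerivAt (newt ε) (-(newt ε z ^ 3) • innerSL ℝ z) z := by
  have h1 : HasFDerivAt (fun y : E3 => ‖y‖ ^ 2 + ε ^ 2) (2 • innerSL ℝ z) z :=
    (hasStrictFDerivAt_norm_sq z).hasFDerivAt.add_const _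
  have h2 : HasDerivAt (fun s : ℝ => (√s)⁻¹)
      (-(1 / (2 * √(‖z‖ ^ 2 + ε ^ 2))) / √(‖z‖ ^ 2 + ε ^ 2) ^ 2) (‖z‖ ^ 2 + ε ^ 2) :=
    (Real.hasDerivAt_sqrt h.ne').inv (Real.sqrt_pos.2 h).ne'
  refine (h2.comp_hasFDerivAt z h1).congr_fderiv ?_
  ext v
  have : √(‖z‖ ^ 2 + ε ^ 2) ≠ 0 := (Real.sqrt_pos.2 h).ne'
  simp only [newt, smul_apply, smul_eq_mul, nsmul_eq_mul, Nat.cast_ofNat]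
  field_simp

theorem contDiffAt_newt {ε : ℝ} {z : E3} (h : 0 < ‖z‖ ^ 2 + ε ^ 2) {n : WithTop ℕ∞} :
    ContDiffAt ℝ n (newt ε) z := by
  unfold newt
  refine ContDiffAt.inv ?_ (Real.sqrt_pos.2 h).ne'
  exact ((contDiff_norm_sq ℝ).contDiffAt.add contDiffAt_const).sqrt h.ne'

theorem contDiff_newt {ε : ℝ} (h : 0 < ε) {n : WithTop ℕ∞} : ContDiff ℝ n (newt ε) :=
  contDiff_iff_contDiffAt.2 fun _ => contDiffAt_newt (by positivity)

theorem pd_newt {ε : ℝ} {z : E3} (h : 0 < ‖z‖ ^ 2 + ε ^ 2) (k : Fin 3) :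
    pd k (newt ε) z = -(newt ε z ^ 3) * z k := by
  simp [pd, (hasFDerivAt_newt h).fderiv, EuclideanSpace.inner_single_right]

theorem hasFDerivAt_coord (k : Fin 3) (z : E3) :
    HasFDerivAt (fun y : E3 => y k) (EuclideanSpace.proj (𝕜 := ℝ) k) z :=
  (EuclideanSpace.proj (𝕜 := ℝ) k).hasFDerivAt

theorem pd_coord (k l : Fin 3) (z : E3) : pd k (fun y : E3 => y l) z = if l = k then 1 else 0 := by
  rw [pd, (hasFDerivAt_coord l z).fderiv]
  exact PiLp.single_apply 2 ..

theorem norm_sq_eq_sum (z : E3) : ‖z‖ ^ 2 = z 0 ^ 2 + z 1 ^ 2 + z 2 ^ 2 := by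
  simp [EuclideanSpace.norm_sq_eq, Fin.sum_univ_three]

theorem abs_coord_le_norm (z : E3) (k : Fin 3) : |z k| ≤ ‖z‖ := by
  simpa using PiLp.norm_apply_le z k

theorem pd_pd_newt {ε : ℝ} (hε : 0 < ε) (z : E3) (k : Fin 3) :
    pd k (pd k (newt ε)) z = -(newt ε z ^ 3) + 3 * z k ^ 2 * newt ε z ^ 5 := by
  have hp : ∀ z : E3, 0 < ‖z‖ ^ 2 + ε ^ 2 := fun z => by positivity
  have h1 : pd k (newt ε) = fun z => (fun z => -(newt ε z ^ 3)) z * z k := by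
    funext z; exact pd_newt (hp z) k
  have hd : DifferentiableAt ℝ (newt ε) z := (hasFDerivAt_newt (hp z)).differentiableAt
  have hd3 : DifferentiableAt ℝ (fun z => -(newt ε z ^ 3)) z := (hd.pow 3).neg
  rw [h1, pd_mul hd3 (hasFDerivAt_coord k z).differentiableAt, pd_coord]
  have h2 := pd_comp (g := fun s => -(s ^ 3)) (f := newt ε) (x := z) (by fun_prop) hd k
  rw [h2, pd_newt (hp z)]
  have h3 : deriv (fun s : ℝ => -(s ^ 3)) (newt ε z) = -(3 * newt ε z ^ 2) := by simp
  rw [h3]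
  simp
  ring

/-- The Laplacian of the regularized kernel is minus an approximate identity, since 3ε²N⁵ is a
mass-preserving rescaling of its value at ε = 1. This replaces the distributional identity for
1/|z|. -/
theorem laplacian_newt {ε : ℝ} (hε : 0 < ε) (z : E3) :
    ∑ k, pd k (pd k (newt ε)) z = -(3 * ε ^ 2 * newt ε z ^ 5) := by
  simp only [pd_pd_newt hε, Fin.sum_univ_three]
  have h1 : newt ε z ^ 2 * (‖z‖ ^ 2 + ε ^ 2) = 1 := by
    rw [newt_sq, inv_mul_cancel₀ (by positivity)]
  rw [norm_sq_eq_sum] at h1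
  linear_combination (3 * newt ε z ^ 3) * h1

theorem tendsto_newt {ε : ℕ → ℝ} (hε : Tendsto ε atTop (𝓝 0)) {z : E3} (hz : z ≠ 0) :
    Tendsto (fun n => newt (ε n) z) atTop (𝓝 (newt 0 z)) := by
  unfold newt
  have : Tendsto (fun n => ‖z‖ ^ 2 + ε n ^ 2) atTop (𝓝 (‖z‖ ^ 2 + 0 ^ 2)) :=
    tendsto_const_nhds.add (hε.pow 2)
  refine (this.sqrt).inv₀ ?_
  have := norm_pos_iff.2 hz
  positivity

/-- An integrable majorant for the kernel and its gradient. -/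
theorem integrable_indicator_norm_inv_sq (r : ℝ) :
    Integrable ((ball (0 : E3) r).indicator fun z => (‖z‖ ^ 2)⁻¹) := by
  rw [integrable_indicator_iff measurableSet_ball]
  refine (integrableOn_fun_norm_addHaar (E := E3) volume (f := fun s => (s ^ 2)⁻¹)).2 ?_
  have : Module.finrank ℝ E3 = 3 := by simp
  rw [this]
  refine (integrableOn_const (C := (1 : ℝ)) (by simp)).congr_fun ?_ measurableSet_Ioo
  intro s hs
  have : s ≠ 0 := hs.1.ne'
  simp [this]

/-! ### Convolution with converging kernels -/

/-- The difference of the convolutions is at most ‖L‖ · sup|f| · ‖κₙ - κ₀‖₁, uniformly in x, and the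
L¹ norm tends to zero by dominated convergence. The kernels are vector-valued so that the statement
also covers derivatives of kernels; the singular point z = 0 is a null set. -/
theorem tendstoUniformly_convolution {V V' : Type*} [NormedAddCommGroup V] [NormedSpace ℝ V]
    [NormedAddCommGroup V'] [NormedSpace ℝ V']
    (L : ℝ →L[ℝ] V →L[ℝ] V') {f : E3 → ℝ} (hf : Continuous f) (hfc : HasCompactSupport f)
    {κ : ℕ → E3 → V} {κ₀ : E3 → V} {G : E3 → ℝ} (hκ : ∀ n, Continuous (κ n)) (hG : Integrable G)
    (hb : ∀ n z, z ≠ 0 → ‖κ n z‖ ≤ G z) (hlim : ∀ z, z ≠ 0 → Tendsto (fun n => κ n z) atTop (𝓝 (κ₀ z))) :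
    Integrable κ₀ ∧
    TendstoUniformly (fun n => convolution f (κ n) L volume) (convolution f κ₀ L volume) atTop := by
  have hae : ∀ᵐ z : E3, z ≠ 0 := by
    simp [ae_iff, measure_singleton]
  have hm : AEStronglyMeasurable κ₀ volume :=
    aestronglyMeasurable_of_tendsto_ae atTop (fun n => (hκ n).aestronglyMeasurable)
      (hae.mono fun z hz => hlim z hz)
  have hb0 : ∀ z, z ≠ 0 → ‖κ₀ z‖ ≤ G z := fun z hz =>
    le_of_tendsto ((hlim z hz).norm) (Eventually.of_forall fun n => hb n z hz)
  have hi0 : Integrable κ₀ := hG.mono' hm (hae.mono hb0)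
  have hi : ∀ n, Integrable (κ n) := fun n =>
    hG.mono' (hκ n).aestronglyMeasurable (hae.mono (hb n))
  refine ⟨hi0, ?_⟩
  obtain ⟨M, hM⟩ := hfc.exists_bound_of_continuous hf
  have hM0 : 0 ≤ M := (norm_nonneg _).trans (hM 0)
  have hI : Tendsto (fun n => ∫ z, ‖κ n z - κ₀ z‖) atTop (𝓝 0) := by
    have := tendsto_integral_of_dominated_convergence (F := fun n z => ‖κ n z - κ₀ z‖)
      (f := fun _ => (0 : ℝ)) (μ := (volume : Measure E3)) (fun z => 2 * G z)
      (fun n => ((hκ n).aestronglyMeasurable.sub hm).norm) (hG.const_mul 2)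
      (fun n => hae.mono fun z hz => by
        rw [norm_norm]
        exact (norm_sub_le _ _).trans (by linarith [hb n z hz, hb0 z hz]))
      (hae.mono fun z hz => by
        have := ((hlim z hz).sub_const (κ₀ z)).norm
        simpa using this)
    simpa using this
  have hI2 : Tendsto (fun n => ‖L‖ * M * ∫ z, ‖κ n z - κ₀ z‖) atTop (𝓝 0) := by
    simpa using hI.const_mul (‖L‖ * M)
  rw [Metric.tendstoUniformly_iff]
  intro e he
  filter_upwards [(tendsto_order.1 hI2).2 e he] with n hn x
  refine lt_of_le_of_lt ?_ hn
  have c1 := (hfc.convolutionExists_left L hf hi0.locallyIntegrable x).integrable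
  have c2 := (hfc.convolutionExists_left L hf (hi n).locallyIntegrable x).integrable
  rw [dist_eq_norm, ← integral_const_mul, ← norm_neg, neg_sub, convolution_def, convolution_def,
    ← integral_sub c2 c1]
  have htr : ∫ z, ‖L‖ * M * ‖κ n z - κ₀ z‖ = ∫ t, ‖L‖ * M * ‖κ n (x - t) - κ₀ (x - t)‖ :=
    (integral_sub_left_eq_self (fun z => ‖L‖ * M * ‖κ n z - κ₀ z‖) volume x).symm
  rw [htr]
  refine norm_integral_le_of_norm_le ?_ (Eventually.of_forall fun t => ?_)
  · exact (((hi n).sub hi0).norm.const_mul (‖L‖ * M)).comp_sub_left x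
  · rw [← map_sub]
    refine (L.le_opNorm₂ _ _).trans ?_
    gcongr
    exact hM t

/-- The total mass of `3 (|z|² + 1)^{-5/2}`. -/
noncomputable def newtMass : ℝ := ∫ z : E3, 3 * newt 1 z ^ 5

/-- Decay like |z|⁻⁵ makes the profile integrable in dimension three. Positivity suffices later,
where one divides by this mass; its exact value plays no role. -/
theorem newtMass_pos : 0 < newtMass := by
  have hc : Continuous (fun z : E3 => 3 * newt 1 z ^ 5) :=
    continuous_const.mul ((contDiff_newt one_pos (n := 0)).continuous.pow 5)
  have hint : Integrable (fun z : E3 => 3 * newt 1 z ^ 5) := by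
    have := integrable_rpow_neg_one_add_norm_sq (E := E3) (μ := volume) (r := 5) (by simp; norm_num)
    refine (this.const_mul 3).congr (Eventually.of_forall fun z => ?_)
    have h0 : (0 : ℝ) ≤ 1 + ‖z‖ ^ 2 := by positivity
    simp only [newt, Real.sqrt_eq_rpow]
    rw [← Real.rpow_neg (by positivity), ← Real.rpow_mul_natCast (by positivity)]
    norm_num [add_comm]
  refine (integral_pos_iff_support_of_nonneg (fun z => ?_) hint).2 ?_
  · have := newt_nonneg 1 z
    simp only [Pi.zero_apply]; positivity
  · have : Function.support (fun z : E3 => 3 * newt 1 z ^ 5) = Set.univ := by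
      ext z
      have : newt 1 z ≠ 0 := by
        unfold newt
        have : 0 < ‖z‖ ^ 2 + (1 : ℝ) ^ 2 := by positivity
        positivity
      simp [this]
    rw [this]
    simp

theorem newt_inv {c : ℝ} (hc : 0 < c) (z : E3) : newt c⁻¹ z = c * newt 1 (c • z) := by
  unfold newt
  have h1 : ‖c • z‖ ^ 2 + 1 ^ 2 = c ^ 2 * (‖z‖ ^ 2 + c⁻¹ ^ 2) := by
    rw [norm_smul, Real.norm_of_nonneg hc.le]
    field_simp
  rw [h1, Real.sqrt_mul (by positivity), Real.sqrt_sq hc.le, mul_inv, ← mul_assoc,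
    mul_inv_cancel₀ hc.ne', one_mul]

/-- With ε = 1/c the kernel 3ε²N⁵ equals c³ times the profile `3 * newt 1 z ^ 5` evaluated at cz, so
after normalization it is an approximate identity. -/
theorem tendsto_integral_newt {g : E3 → ℝ} (hg : Integrable g) {x : E3} (hx : ContinuousAt g x) :
    Tendsto (fun c : ℝ => ∫ y, 3 * c⁻¹ ^ 2 * newt c⁻¹ (x - y) ^ 5 * g y) atTop
      (𝓝 (newtMass * g x)) := by
  have hκ := newtMass_pos
  have h0 : ∀ z : E3, 0 ≤ newtMass⁻¹ * (3 * newt 1 z ^ 5) := fun z => by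
    have := newt_nonneg 1 z
    positivity
  have hfr : Module.finrank ℝ E3 = 3 := by simp
  have := tendsto_integral_comp_smul_smul_of_integrable' (μ := (volume : Measure E3)) h0
    (by rw [integral_const_mul]; exact inv_mul_cancel₀ hκ.ne') ?_ hg hx
  · have h2 := this.const_mul newtMass
    refine h2.congr' ?_
    filter_upwards [eventually_gt_atTop 0] with c hc
    rw [← integral_const_mul]
    congr 1 with y
    rw [hfr, newt_inv hc, smul_eq_mul]
    field_simp
  -- The remaining decay condition is |z|³ · profile → 0 at infinity; it follows from N ≤ 1/|z|.
  · rw [hfr]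
    have hlim : Tendsto (fun z : E3 => newtMass⁻¹ * (3 * (‖z‖ ^ 2)⁻¹)) (Bornology.cobounded E3)
        (𝓝 (newtMass⁻¹ * (3 * 0))) := by
      refine Tendsto.const_mul _ (Tendsto.const_mul _ ?_)
      exact ((tendsto_pow_atTop (by norm_num)).comp tendsto_norm_cobounded_atTop).inv_tendsto_atTop
    simp only [mul_zero] at hlim
    refine tendsto_of_tendsto_of_tendsto_of_le_of_le' tendsto_const_nhds hlim
      (Eventually.of_forall fun z => mul_nonneg (by positivity) (h0 z)) ?_
    filter_upwards [tendsto_norm_cobounded_atTop.eventually_gt_atTop (0 : ℝ)] with z hz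
    have h1 := pow_le_pow_left₀ (newt_nonneg 1 z) (newt_le 1 (norm_pos_iff.1 hz)) 5
    calc ‖z‖ ^ 3 * (newtMass⁻¹ * (3 * newt 1 z ^ 5))
        ≤ ‖z‖ ^ 3 * (newtMass⁻¹ * (3 * ‖z‖⁻¹ ^ 5)) := by gcongr
      _ = newtMass⁻¹ * (3 * (‖z‖ ^ 2)⁻¹) := by field_simp

/-! ### The localized kernels -/

/-- The kernel `β N_ε`. -/
noncomputable def kernE (β : E3 → ℝ) (ε : ℝ) (z : E3) : ℝ := β z * newt ε z

/-- The derivative of `β N_ε`. -/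
noncomputable def kernDE (β : E3 → ℝ) (ε : ℝ) (z : E3) : E3 →L[ℝ] ℝ :=
  β z • (-(newt ε z ^ 3) • innerSL ℝ z) + newt ε z • fderiv ℝ β z

/-- The commutator `Δ(β N_ε) - β Δ N_ε`. -/
noncomputable def kernK (β : E3 → ℝ) (ε : ℝ) (z : E3) : ℝ :=
  ∑ k, (2 * (-(newt ε z ^ 3) * z k) * pd k β z + newt ε z * pd k (pd k β) z)

theorem pd_const_sub {g : E3 → ℝ} (x : E3) (hg : Differentiable ℝ g) (k : Fin 3) (y : E3) :
    pd k (fun y => g (x - y)) y = -pd k g (x - y) := by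
  have h1 : HasFDerivAt (fun y : E3 => x - y) (-(ContinuousLinearMap.id ℝ E3)) y :=
    (hasFDerivAt_id y).const_sub x
  have := ((hg (x - y)).hasFDerivAt.comp y h1).fderiv
  simp only [pd]
  rw [show (fun y => g (x - y)) = g ∘ fun y => x - y from rfl, this]
  simp

theorem laplacian_mul {f g : E3 → ℝ} (hf : ContDiff ℝ ∞ f) (hg : ContDiff ℝ ∞ g) (z : E3) :
    ∑ k, pd k (pd k (fun y => f y * g y)) z = f z * ∑ k, pd k (pd k g) z +
      ∑ k, (2 * pd k g z * pd k f z + g z * pd k (pd k f) z) := by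
  have hd : ∀ {f : E3 → ℝ}, ContDiff ℝ ∞ f → Differentiable ℝ f := fun h =>
    h.differentiable (by norm_num)
  have hp : ∀ {f : E3 → ℝ} (k : Fin 3), ContDiff ℝ ∞ f → ContDiff ℝ ∞ (pd k f) := fun k h =>
    contDiff_pd h (by exact_mod_cast le_top) k
  have h1 : ∀ k, pd k (fun y => f y * g y) = fun y => f y * pd k g y + pd k f y * g y := fun k => by
    funext y; exact pd_mul (hd hf y) (hd hg y) k
  rw [Finset.mul_sum, ← Finset.sum_add_distrib]
  refine Finset.sum_congr rfl fun k _ => ?_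
  have d1 : DifferentiableAt ℝ (fun y => f y * pd k g y) z := (hd hf z).mul (hd (hp k hg) z)
  have d2 : DifferentiableAt ℝ (fun y => pd k f y * g y) z := (hd (hp k hf) z).mul (hd hg z)
  rw [h1, pd_add d1 d2,
    pd_mul (hd hf z) (hd (hp k hg) z), pd_mul (hd (hp k hf) z) (hd hg z)]
  ring

theorem laplacian_kernE {β : E3 → ℝ} (hβ : ContDiff ℝ ∞ β) {ε : ℝ} (hε : 0 < ε) (z : E3) :
    ∑ k, pd k (pd k (kernE β ε)) z = -(3 * ε ^ 2 * newt ε z ^ 5 * β z) + kernK β ε z := by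
  have := laplacian_mul hβ (contDiff_newt hε (n := ∞)) z
  unfold kernE
  rw [this, laplacian_newt hε, kernK]
  simp only [pd_newt (ε := ε) (z := z) (by positivity)]
  ring

theorem kernE_isTest (β : ContDiffBump (0 : E3)) {ε : ℝ} (hε : 0 < ε) {x : E3} {ρ : ℝ}
    (hx : ‖x‖ + β.rOut < ρ) : IsTest (ball 0 ρ) (fun y => kernE β ε (x - y)) := by
  have hsub : tsupport (fun y => kernE β ε (x - y)) ⊆ closedBall x β.rOut := by
    refine closure_minimal ?_ isClosed_closedBall
    intro y hy
    have : x - y ∈ Function.support β := by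
      intro h
      apply hy
      simp [kernE, h]
    rw [β.support_eq] at this
    simp only [mem_ball, dist_zero_right] at this
    rw [mem_closedBall, dist_comm, dist_eq_norm]
    exact this.le
  refine ⟨?_, ?_, ?_⟩
  · exact (β.contDiff.mul (contDiff_newt hε)).comp (contDiff_const.sub contDiff_id)
  · exact (isCompact_closedBall x β.rOut).of_isClosed_subset (isClosed_tsupport _) hsub
  · intro y hy
    have h1 := hsub hy
    rw [mem_closedBall, dist_eq_norm] at h1
    rw [mem_ball, dist_zero_right]
    have := norm_add_le (y - x) x
    rw [sub_add_cancel] at this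
    linarith

theorem kernE_contDiff (β : ContDiffBump (0 : E3)) {ε : ℝ} (hε : 0 < ε) {n : ℕ∞} :
    ContDiff ℝ n (kernE β ε) := β.contDiff.mul (contDiff_newt hε)

theorem kernE_fderiv (β : ContDiffBump (0 : E3)) {ε : ℝ} (hε : 0 < ε) :
    fderiv ℝ (kernE β ε) = kernDE β ε := by
  funext z
  have h1 : DifferentiableAt ℝ β z := (β.contDiff (n := 1)).differentiable (by norm_num) z
  exact (h1.hasFDerivAt.mul (hasFDerivAt_newt (by positivity))).fderiv

theorem kernK_continuous (β : ContDiffBump (0 : E3)) {ε : ℝ} (hε : 0 < ε) :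
    Continuous (kernK β ε) := by
  have h1 := (contDiff_newt hε (n := 0)).continuous
  have h2 : ∀ k, ContDiff ℝ 1 (pd k β) := fun k =>
    contDiff_pd (β.contDiff (n := 2)) (by norm_num) k
  have h3 : ∀ k, Continuous (pd k (pd k β)) := fun k =>
    contDiff_zero.1 (contDiff_pd (h2 k) (by norm_num) k)
  have h4 : ∀ k, Continuous (pd k β) := fun k => (h2 k).continuous
  unfold kernK
  fun_prop

/-- A common integrable majorant of the localized kernels. -/
theorem exists_kern_bound (β : ContDiffBump (0 : E3)) : ∃ G : E3 → ℝ, Integrable G ∧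
    ∀ ε z, z ≠ 0 → ‖kernE β ε z‖ ≤ G z ∧ ‖kernDE β ε z‖ ≤ G z ∧ ‖kernK β ε z‖ ≤ G z := by
  set r := β.rOut
  have hr : 0 < r := β.rOut_pos
  obtain ⟨C₁, hC₁⟩ := (β.hasCompactSupport.fderiv ℝ).exists_bound_of_continuous
    ((β.contDiff (n := 1)).continuous_fderiv (by norm_num))
  have hcd : ∀ k, Continuous (pd k (pd k β)) := fun k =>
    contDiff_zero.1 (contDiff_pd (m := 0) (contDiff_pd (m := 1) (β.contDiff (n := 2))
      (by norm_num) k) (by norm_num) k)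
  choose C₂ hC₂ using fun k => (HasCompactSupport.pd (HasCompactSupport.pd β.hasCompactSupport k)
    k).exists_bound_of_continuous (hcd k)
  have hC₁0 : 0 ≤ C₁ := (norm_nonneg _).trans (hC₁ 0)
  have hC₂0 : ∀ k, 0 ≤ C₂ k := fun k => (norm_nonneg _).trans (hC₂ k 0)
  have hpdb : ∀ k z, |pd k β z| ≤ C₁ := fun k z => by
    have := (fderiv ℝ β z).le_opNorm (EuclideanSpace.single k 1)
    simp only [PiLp.norm_single, norm_one, mul_one] at this
    exact this.trans (hC₁ z)
  -- C dominates the three coefficients of |z|⁻² found below: 2r for the kernel, 1 + 2rC₁ for its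
  -- derivative, and the sum over k for the commutator. The radius 2r makes the open ball contain
  -- the closed support of β.
  set C := (1 + 2 * r) * (1 + C₁) + ∑ k, (2 * C₁ + 2 * r * C₂ k)
  refine ⟨fun z => C * (ball (0 : E3) (2 * r)).indicator (fun z => (‖z‖ ^ 2)⁻¹) z,
    (integrable_indicator_norm_inv_sq _).const_mul _, fun ε z hz => ?_⟩
  by_cases hzb : z ∈ ball (0 : E3) (2 * r)
  · beta_reduce
    rw [Set.indicator_of_mem hzb]
    have hzp : 0 < ‖z‖ := norm_pos_iff.2 hz
    have hzr : ‖z‖ < 2 * r := by simpa using hzb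
    have hN0 := newt_nonneg ε z
    set N := newt ε z
    set I := (‖z‖ ^ 2)⁻¹
    have hI : 0 < I := by positivity
    have hNle : N ≤ ‖z‖⁻¹ := newt_le ε hz
    have hN1 : N ≤ 2 * r * I := by
      refine hNle.trans ?_
      have : ‖z‖⁻¹ = ‖z‖ * I := by simp only [I]; field_simp
      rw [this]
      gcongr
    have hN3 : N ^ 3 * ‖z‖ ≤ I := by
      have := pow_le_pow_left₀ hN0 hNle 3
      calc N ^ 3 * ‖z‖ ≤ ‖z‖⁻¹ ^ 3 * ‖z‖ := by gcongr
        _ = I := by simp only [I]; field_simp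
    have hβ1 : |β z| ≤ 1 := by rw [abs_of_nonneg β.nonneg]; exact β.le_one
    have hS : 0 ≤ ∑ k, (2 * C₁ + 2 * r * C₂ k) :=
      Finset.sum_nonneg fun k _ => by have := hC₂0 k; positivity
    refine ⟨?_, ?_, ?_⟩
    · calc ‖kernE β ε z‖ = |β z| * N := by
            rw [kernE, norm_mul, Real.norm_eq_abs, Real.norm_of_nonneg hN0]
        _ ≤ 1 * (2 * r * I) := by gcongr
        _ ≤ C * I := by
            rw [one_mul]
            gcongr
            simp only [C]
            nlinarith [mul_nonneg hr.le hC₁0]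
    · calc ‖kernDE β ε z‖ ≤ |β z| * (N ^ 3 * ‖z‖) + N * ‖fderiv ℝ β z‖ := by
            refine (norm_add_le _ _).trans_eq ?_
            rw [norm_smul, norm_smul, norm_smul, innerSL_apply_norm, norm_neg, norm_pow,
              Real.norm_of_nonneg hN0, Real.norm_eq_abs]
        _ ≤ 1 * I + (2 * r * I) * C₁ := by
            gcongr
            exact hC₁ z
        _ ≤ C * I := by
            have : 1 * I + (2 * r * I) * C₁ = (1 + 2 * r * C₁) * I := by ring
            rw [this]
            gcongr
            simp only [C]
            nlinarith [mul_nonneg hr.le hC₁0]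
    · calc ‖kernK β ε z‖ ≤ ∑ k, (2 * C₁ + 2 * r * C₂ k) * I := by
            refine (norm_sum_le _ _).trans (Finset.sum_le_sum fun k _ => ?_)
            refine (norm_add_le _ _).trans ?_
            rw [norm_mul, norm_mul, norm_mul, norm_mul, norm_neg, norm_pow,
              Real.norm_of_nonneg hN0]
            have h1 : N ^ 3 * ‖z k‖ ≤ I := by
              refine le_trans ?_ hN3
              gcongr
              exact abs_coord_le_norm z k
            have h2 : ‖pd k β z‖ ≤ C₁ := hpdb k z
            have h3 := hC₂ k z
            have h4 := hC₂0 k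
            calc ‖(2 : ℝ)‖ * (N ^ 3 * ‖z k‖) * ‖pd k β z‖ + N * ‖pd k (pd k β) z‖
                ≤ ‖(2 : ℝ)‖ * I * C₁ + (2 * r * I) * C₂ k := by gcongr
              _ = (2 * C₁ + 2 * r * C₂ k) * I := by norm_num; ring
        _ = (∑ k, (2 * C₁ + 2 * r * C₂ k)) * I := by rw [Finset.sum_mul]
        _ ≤ C * I := by
            gcongr
            simp only [C]
            have : 0 ≤ (1 + 2 * r) * (1 + C₁) := by positivity
            linarith
  · beta_reduce
    rw [Set.indicator_of_notMem hzb]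
    have hz2 : 2 * r ≤ ‖z‖ := by simpa using hzb
    have hnt : z ∉ tsupport β := by
      rw [β.tsupport_eq]
      simp only [mem_closedBall, dist_zero_right, not_le]
      linarith
    have hb : β z = 0 := image_eq_zero_of_notMem_tsupport hnt
    have hdb : fderiv ℝ β z = 0 :=
      image_eq_zero_of_notMem_tsupport fun h => hnt (tsupport_fderiv_subset ℝ h)
    have hpb : ∀ k, pd k β z = 0 := fun k =>
      image_eq_zero_of_notMem_tsupport fun h => hnt (tsupport_pd_subset k _ h)
    have hppb : ∀ k, pd k (pd k β) z = 0 := fun k => image_eq_zero_of_notMem_tsupport fun h =>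
      hnt (tsupport_pd_subset k _ (tsupport_pd_subset k _ h))
    simp [kernE, kernDE, kernK, hb, hdb, hpb, hppb]

theorem tendsto_kern (β : E3 → ℝ) {ε : ℕ → ℝ} (hε : Tendsto ε atTop (𝓝 0)) {z : E3} (hz : z ≠ 0) :
    Tendsto (fun n => kernE β (ε n) z) atTop (𝓝 (kernE β 0 z)) ∧
    Tendsto (fun n => kernDE β (ε n) z) atTop (𝓝 (kernDE β 0 z)) ∧
    Tendsto (fun n => kernK β (ε n) z) atTop (𝓝 (kernK β 0 z)) := by
  have h := tendsto_newt hε hz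
  refine ⟨h.const_mul _, ?_, ?_⟩
  · unfold kernDE
    exact (((h.pow 3).neg.smul_const _).const_smul _).add (h.smul_const _)
  · unfold kernK
    refine tendsto_finsetSum _ fun k _ => ?_
    exact ((((h.pow 3).neg.mul_const _).const_mul 2).mul_const _).add (h.mul_const _)

/-- Every term of the commutator contains a derivative of β, and β is constant near 0. The
singularity of the Newtonian kernel is therefore never met. -/
theorem contDiff_kernK (β : ContDiffBump (0 : E3)) :
    ContDiff ℝ ∞ (kernK β 0) ∧ HasCompactSupport (kernK β 0) := by
  have hβ : ContDiff ℝ ∞ β := β.contDiff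
  have hp : ∀ {f : E3 → ℝ} (k : Fin 3), ContDiff ℝ ∞ f → ContDiff ℝ ∞ (pd k f) := fun k h =>
    contDiff_pd h (by exact_mod_cast le_top) k
  have hopen : IsOpen ({0}ᶜ : Set E3) := isOpen_compl_singleton
  have hN : ContDiffOn ℝ ∞ (newt 0) ({0}ᶜ : Set E3) := fun z hz =>
    (contDiffAt_newt (by have := norm_pos_iff.2 hz; positivity)).contDiffWithinAt
  have hco : ∀ k : Fin 3, ContDiffOn ℝ ∞ (fun z : E3 => z k) ({0}ᶜ : Set E3) := fun k =>
    (EuclideanSpace.proj (𝕜 := ℝ) k : E3 →L[ℝ] ℝ).contDiff.contDiffOn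
  have h0 : ∀ k, tsupport (pd k β) ⊆ ({0}ᶜ : Set E3) := by
    intro k z hz hz0
    obtain rfl : z = 0 := hz0
    refine (notMem_tsupport_iff_eventuallyEq.2 ?_) hz
    have h1 : ∀ᶠ y in 𝓝 (0 : E3), (β : E3 → ℝ) =ᶠ[𝓝 y] fun _ => 1 :=
      β.eventuallyEq_one.eventually_nhds
    filter_upwards [h1] with y hy
    simp [pd, hy.fderiv_eq]
  have e1 : kernK β 0 = fun z => ∑ k, ((2 * (-(newt 0 z ^ 3) * z k)) * pd k β z +
      newt 0 z * pd k (pd k β) z) := rfl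
  constructor
  · rw [e1]
    refine ContDiff.sum fun k _ => ContDiff.add ?_ ?_
    · exact contDiff_mul_of_tsupport_subset hopen
        (contDiffOn_const.mul ((hN.pow 3).neg.mul (hco k))) (hp k hβ) (h0 k)
    · exact contDiff_mul_of_tsupport_subset hopen hN (hp k (hp k hβ))
        ((tsupport_pd_subset k _).trans (h0 k))
  · refine β.hasCompactSupport.of_isClosed_subset (isClosed_tsupport _) ?_
    refine closure_minimal ?_ (isClosed_tsupport _)
    intro z hz
    by_contra hnt
    have hpb : ∀ k, pd k β z = 0 := fun k =>
      image_eq_zero_of_notMem_tsupport fun h => hnt (tsupport_pd_subset k _ h)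
    have hppb : ∀ k, pd k (pd k β) z = 0 := fun k => image_eq_zero_of_notMem_tsupport fun h =>
      hnt (tsupport_pd_subset k _ (tsupport_pd_subset k _ h))
    apply hz
    simp [kernK, hpb, hppb]

/-! ### Representation by the Newtonian potential and Poisson regularity -/

theorem tendsto_one_div_succ : Tendsto (fun n : ℕ => ((n : ℝ) + 1)⁻¹) atTop (𝓝 0) := by
  simpa using tendsto_one_div_add_atTop_nhds_zero_nat (𝕜 := ℝ)

/-- Convolution with the localized Newtonian kernel gains one derivative. -/
theorem contDiff_convolution_kernE (β : ContDiffBump (0 : E3)) {F : E3 → ℝ} {n : ℕ}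
    (hF : ContDiff ℝ n F) (hFc : HasCompactSupport F) :
    ContDiff ℝ (n + 1) (convolution F (kernE β 0) (ContinuousLinearMap.lsmul ℝ ℝ) volume) := by
  obtain ⟨G, hG, hGb⟩ := exists_kern_bound β
  have hpos : ∀ n : ℕ, (0 : ℝ) < ((n : ℝ) + 1)⁻¹ := fun n => by positivity
  set L := ContinuousLinearMap.lsmul ℝ ℝ (E := ℝ)
  have hsm : ∀ n : ℕ, ContDiff ℝ 1 (kernE β ((n : ℝ) + 1)⁻¹) := fun n =>
    kernE_contDiff β (hpos n) (n := 1)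
  have hDc : ∀ n : ℕ, Continuous (kernDE β ((n : ℝ) + 1)⁻¹) := fun n => by
    rw [← kernE_fderiv β (hpos n)]
    exact (hsm n).continuous_fderiv (by norm_num)
  obtain ⟨hi1, hu1⟩ := tendstoUniformly_convolution L hF.continuous hFc
    (κ := fun n => kernE β ((n : ℝ) + 1)⁻¹)
    (fun n => (hsm n).continuous) hG (fun n z hz => (hGb _ z hz).1)
    (fun z hz => (tendsto_kern β tendsto_one_div_succ hz).1)
  obtain ⟨hi2, hu2⟩ := tendstoUniformly_convolution (L.precompR E3) hF.continuous hFc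
    (κ := fun n => kernDE β ((n : ℝ) + 1)⁻¹)
    hDc hG (fun n z hz => (hGb _ z hz).2.1)
    (fun z hz => (tendsto_kern β tendsto_one_div_succ hz).2.1)
  -- The derivative is the convolution of F with the derivative of the singular kernel: the
  -- regularized derivatives converge to it uniformly. It is Cⁿ because F is Cⁿ with compact support
  -- and the kernel is integrable.
  refine contDiff_succ_iff_hasFDerivAt.2
    ⟨convolution F (kernDE β 0) (L.precompR E3) volume, ?_, ?_⟩
  · exact hFc.contDiff_convolution_left (n := n) _ hF hi2.locallyIntegrable
  · refine hasFDerivAt_of_tendstoUniformly hu2 (fun n x => ?_)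
      (fun x => hu1.tendsto_at x)
    have hc : HasCompactSupport (kernE β ((n : ℝ) + 1)⁻¹) :=
      β.hasCompactSupport.mul_right
    have := hc.hasFDerivAt_convolution_right L hF.continuous.locallyIntegrable (hsm n) x
      (μ := volume)
    rwa [kernE_fderiv β (hpos n)] at this

/-- The equation is tested with y ↦ (βN_ε)(x - y), whose Laplacian is minus the approximate identity
times β plus the commutator kernel. As ε → 0 the first part produces u(x), because β(0) = 1. The
condition on ‖x‖ keeps the support of the test function in the ball. -/
theorem newton_representation {u F : E3 → ℝ} (hu : Continuous u) (huc : HasCompactSupport u)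
    (hF : Continuous F) (hFc : HasCompactSupport F) {ρ : ℝ}
    (hw : ∀ φ, IsTest (ball 0 ρ) φ → ∫ x, u x * ∑ k, pd k (pd k φ) x = ∫ x, F x * φ x)
    (β : ContDiffBump (0 : E3)) {x : E3} (hx : ‖x‖ + β.rOut < ρ) :
    newtMass * u x = convolution u (kernK β 0) (ContinuousLinearMap.lsmul ℝ ℝ) volume x -
      convolution F (kernE β 0) (ContinuousLinearMap.lsmul ℝ ℝ) volume x := by
  obtain ⟨G, hG, hGb⟩ := exists_kern_bound β
  have hpos : ∀ n : ℕ, (0 : ℝ) < ((n : ℝ) + 1)⁻¹ := fun n => by positivity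
  set L := ContinuousLinearMap.lsmul ℝ ℝ (E := ℝ)
  have hu1 := (tendstoUniformly_convolution L hF hFc
    (κ := fun n => kernE β ((n : ℝ) + 1)⁻¹)
    (fun n => (kernE_contDiff β (hpos n) (n := 0)).continuous) hG (fun n z hz => (hGb _ z hz).1)
    (fun z hz => (tendsto_kern β tendsto_one_div_succ hz).1)).2.tendsto_at x
  have hu2 := (tendstoUniformly_convolution L hu huc
    (κ := fun n => kernK β ((n : ℝ) + 1)⁻¹)
    (fun n => kernK_continuous β (hpos n)) hG (fun n z hz => (hGb _ z hz).2.2)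
    (fun z hz => (tendsto_kern β tendsto_one_div_succ hz).2.2)).2.tendsto_at x
  have hβx : Continuous fun y => β (x - y) :=
    (β.contDiff (n := 0)).continuous.comp (continuous_const.sub continuous_id)
  have hgc : Continuous fun y => u y * β (x - y) := hu.mul hβx
  have hgi : Integrable fun y => u y * β (x - y) :=
    hgc.integrable_of_hasCompactSupport (huc.mul_right)
  have hat : Tendsto (fun n : ℕ => (n : ℝ) + 1) atTop atTop :=
    tendsto_atTop_add_const_right _ _ tendsto_natCast_atTop_atTop
  have hu3 := (tendsto_integral_newt hgi (x := x) hgc.continuousAt).comp hat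
  have hβ0 : β (x - x) = 1 := by
    rw [sub_self]; exact β.one_of_mem_closedBall (by simp [β.rIn_pos.le])
  rw [hβ0, mul_one] at hu3
  refine tendsto_nhds_unique hu3 ((hu2.sub hu1).congr fun n => ?_)
  set ε := ((n : ℝ) + 1)⁻¹
  have hε : 0 < ε := hpos n
  have ht := kernE_isTest β hε hx
  have hs : Differentiable ℝ (kernE β ε) :=
    (kernE_contDiff β hε (n := 1)).differentiable (by norm_num)
  have hs1 : ∀ k, Differentiable ℝ (pd k (kernE β ε)) := fun k =>
    (contDiff_pd (m := 1) (kernE_contDiff β hε (n := 2)) (by norm_num) k).differentiable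
      (by norm_num)
  have hlap : ∀ y, ∑ k, pd k (pd k fun y => kernE β ε (x - y)) y =
      -(3 * ε ^ 2 * newt ε (x - y) ^ 5 * β (x - y)) + kernK β ε (x - y) := by
    intro y
    rw [← laplacian_kernE β.contDiff hε]
    refine Finset.sum_congr rfl fun k _ => ?_
    have : pd k (fun y => kernE β ε (x - y)) = fun y => (-1) * pd k (kernE β ε) (x - y) := by
      funext y; rw [pd_const_sub x hs]; ring
    have hd : DifferentiableAt ℝ (fun y => pd k (kernE β ε) (x - y)) y :=
      (hs1 k).differentiableAt.comp y ((differentiableAt_const x).sub differentiableAt_id)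
    rw [this, pd_const_mul _ hd, pd_const_sub x (hs1 k)]
    ring
  have hmain := hw _ ht
  simp only [hlap] at hmain
  have c1 : Continuous fun y => newt ε (x - y) :=
    (contDiff_newt hε (n := 0)).continuous.comp (continuous_const.sub continuous_id)
  have c2 : Continuous fun y => kernK β ε (x - y) :=
    (kernK_continuous β hε).comp (continuous_const.sub continuous_id)
  have i1 : Integrable fun y => u y * (-(3 * ε ^ 2 * newt ε (x - y) ^ 5 * β (x - y))) :=
    (hu.mul (((continuous_const.mul (c1.pow 5)).mul hβx).neg)).integrable_of_hasCompactSupport huc.mul_right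
  have i2 : Integrable fun y => u y * kernK β ε (x - y) :=
    (hu.mul c2).integrable_of_hasCompactSupport huc.mul_right
  have e1 : ∫ y, u y * (-(3 * ε ^ 2 * newt ε (x - y) ^ 5 * β (x - y)) + kernK β ε (x - y)) =
      (∫ y, u y * (-(3 * ε ^ 2 * newt ε (x - y) ^ 5 * β (x - y)))) +
        ∫ y, u y * kernK β ε (x - y) := by
    rw [← integral_add i1 i2]
    simp only [mul_add]
  have e2 : ∫ y, u y * (-(3 * ε ^ 2 * newt ε (x - y) ^ 5 * β (x - y))) =
      -∫ y, 3 * ε ^ 2 * newt ε (x - y) ^ 5 * (u y * β (x - y)) := by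
    rw [← integral_neg]
    congr 1 with y
    ring
  rw [e1, e2] at hmain
  simp only [convolution_def, Function.comp_apply, L, ContinuousLinearMap.lsmul_apply, smul_eq_mul]
  linarith

/-- Interior regularity for the Poisson equation: a weak solution of `Δu = F` is one derivative
better than `F`. -/
theorem contDiffOn_of_weak_poisson {u F : E3 → ℝ} (hu : Continuous u) (huc : HasCompactSupport u)
    {n : ℕ} (hF : ContDiff ℝ n F) (hFc : HasCompactSupport F) {ρ : ℝ}
    (hw : ∀ φ, IsTest (ball 0 ρ) φ → ∫ x, u x * ∑ k, pd k (pd k φ) x = ∫ x, F x * φ x) :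
    ContDiffOn ℝ (n + 1) u (ball 0 ρ) := by
  intro x hx
  rw [mem_ball, dist_zero_right] at hx
  refine ContDiffAt.contDiffWithinAt ?_
  -- Half the distance to the sphere, so that the representation holds with the same β at all points
  -- near x.
  set d := (ρ - ‖x‖) / 2
  have hd : 0 < d := by simp only [d]; linarith
  set β : ContDiffBump (0 : E3) := ⟨d / 2, d, half_pos hd, half_lt_self hd⟩
  have hcK := contDiff_kernK β
  have h1 : ContDiff ℝ (n + 1) (convolution u (kernK β 0) (ContinuousLinearMap.lsmul ℝ ℝ) volume) :=
    hcK.2.contDiff_convolution_right (n := (n + 1 : ℕ)) _ hu.locallyIntegrable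
      (hcK.1.of_le (by exact_mod_cast le_top))
  have h2 := contDiff_convolution_kernE β hF hFc
  have h3 : ContDiffAt ℝ (n + 1) (fun y => newtMass⁻¹ *
      (convolution u (kernK β 0) (ContinuousLinearMap.lsmul ℝ ℝ) volume y -
        convolution F (kernE β 0) (ContinuousLinearMap.lsmul ℝ ℝ) volume y)) x :=
    (contDiff_const.mul (h1.sub h2)).contDiffAt
  refine h3.congr_of_eventuallyEq ?_
  have hnhds : ∀ᶠ y in 𝓝 x, ‖y‖ < ρ - d :=
    (continuous_norm.tendsto x).eventually_lt_const (by simp only [d]; linarith)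
  filter_upwards [hnhds] with y hy
  rw [← newton_representation hu huc hF.continuous hFc hw β (x := y)
    (by change ‖y‖ + d < ρ; linarith), ← mul_assoc, inv_mul_cancel₀ newtMass_pos.ne', one_mul]

/-! ### The hedgehog profile near the origin -/

theorem hPlus_pos {t : ℝ} (_ht : 0 < t) : 0 < hPlus t := by
  have := Real.sqrt_nonneg (9 + 8 * t)
  unfold hPlus; positivity

/-- The flux `r⁴ h' - 2 r³ h = r⁶ (h / r²)'`. -/
noncomputable def profileFlux (h : ℝ → ℝ) (r : ℝ) : ℝ := r ^ 4 * deriv h r - 2 * r ^ 3 * h r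

/-- Multiply by r⁵ and let r → 0. This excludes the singular solution: a flux that stays away from
zero near the origin would make h/r² of size r⁻⁵. -/
theorem le_zero_of_forall_mul_inv_pow_le {κ C r₁ : ℝ} (hr : 0 < r₁)
    (h : ∀ r ∈ Set.Ioo 0 r₁, κ * (r ^ 5)⁻¹ ≤ (r ^ 2)⁻¹ + C) : κ ≤ 0 := by
  have h1 : Tendsto (fun r : ℝ => r ^ 3 + C * r ^ 5) (𝓝[>] 0) (𝓝 0) := by
    have : Continuous fun r : ℝ => r ^ 3 + C * r ^ 5 := by fun_prop
    have := this.tendsto 0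
    simp only [ne_eq, OfNat.ofNat_ne_zero, not_false_eq_true, zero_pow, mul_zero, add_zero] at this
    exact this.mono_left nhdsWithin_le_nhds
  refine ge_of_tendsto h1 ?_
  filter_upwards [Ioo_mem_nhdsGT hr] with r hrr
  have h2 := h r hrr
  have hr0 : 0 < r := hrr.1
  calc κ = κ * (r ^ 5)⁻¹ * r ^ 5 := by field_simp
    _ ≤ ((r ^ 2)⁻¹ + C) * r ^ 5 := by gcongr
    _ = r ^ 3 + C * r ^ 5 := by field_simp

namespace IsHedgehogProfile

variable {t : ℝ} {h : ℝ → ℝ}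

/-- Since r² solves the homogeneous linear equation, reduction of order puts the profile equation in
divergence form, without lower-order terms. -/
theorem hasDerivAt_flux (hh : IsHedgehogProfile t h) {r : ℝ} (hr : 0 < r) :
    HasDerivAt (profileFlux h)
      (r ^ 4 * (h r ^ 3 - h r + 3 * hPlus t / t * (h r ^ 3 - h r ^ 2))) r := by
  have h1 := (hh.diff r hr).hasDerivAt
  have h2 := (hh.diff' r hr).hasDerivAt
  have h3 := ((hasDerivAt_pow 4 r).mul h2).sub (((hasDerivAt_pow 3 r).const_mul 2).mul h1)
  refine h3.congr_deriv ?_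
  rw [← hh.ode r hr]
  field_simp
  ring

theorem hasDerivAt_ratio (hh : IsHedgehogProfile t h) {r : ℝ} (hr : 0 < r) :
    HasDerivAt (fun r => h r / r ^ 2) (profileFlux h r * (r ^ 6)⁻¹) r := by
  have h1 := (hh.diff r hr).hasDerivAt
  refine (h1.div (hasDerivAt_pow 2 r) (by positivity)).congr_deriv ?_
  unfold profileFlux
  field_simp
  push_cast
  ring

theorem hasDerivAt_inv_pow_five {r : ℝ} (hr : 0 < r) (κ : ℝ) :
    HasDerivAt (fun r : ℝ => κ / 5 * (r ^ 5)⁻¹) (-κ * (r ^ 6)⁻¹) r := by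
  refine (((hasDerivAt_pow 5 r).inv (by positivity)).const_mul (κ / 5)).congr_deriv ?_
  field_simp
  push_cast
  ring

theorem monotoneOn_of_hasDerivAt {f f' : ℝ → ℝ} {a b : ℝ}
    (hf : ∀ r ∈ Set.Ioo a b, HasDerivAt f (f' r) r) (h0 : ∀ r ∈ Set.Ioo a b, 0 ≤ f' r) :
    MonotoneOn f (Set.Ioo a b) := by
  refine monotoneOn_of_deriv_nonneg (convex_Ioo a b)
    (fun r hr => (hf r hr).continuousAt.continuousWithinAt) ?_ ?_
  · rw [interior_Ioo]
    exact fun r hr => (hf r hr).differentiableAt.differentiableWithinAt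
  · rw [interior_Ioo]
    intro r hr
    rw [(hf r hr).deriv]
    exact h0 r hr

theorem antitoneOn_of_hasDerivAt {f f' : ℝ → ℝ} {a b : ℝ}
    (hf : ∀ r ∈ Set.Ioo a b, HasDerivAt f (f' r) r) (h0 : ∀ r ∈ Set.Ioo a b, f' r ≤ 0) :
    AntitoneOn f (Set.Ioo a b) := by
  have := monotoneOn_of_hasDerivAt (f := fun r => -f r) (f' := fun r => -f' r)
    (fun r hr => (hf r hr).neg) (fun r hr => by linarith [h0 r hr])
  intro x hx y hy hxy
  have := this hx hy hxy
  simpa using this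

theorem nonlinearity_bounds (ht : 0 < t) (hh : IsHedgehogProfile t h) {r : ℝ} (hr : 0 < r) :
    h r ^ 3 - h r + 3 * hPlus t / t * (h r ^ 3 - h r ^ 2) ≤ 0 ∧
    -((1 + 3 * hPlus t / t) * h r) ≤
      h r ^ 3 - h r + 3 * hPlus t / t * (h r ^ 3 - h r ^ 2) := by
  have hk : 0 ≤ 3 * hPlus t / t := by have := hPlus_pos ht; positivity
  obtain ⟨h0, h1⟩ := hh.bounds r hr.le
  set k := 3 * hPlus t / t
  have e1 : 0 ≤ h r ^ 2 * (1 - h r) := mul_nonneg (sq_nonneg _) (by linarith)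
  have e2 : 0 ≤ h r * (1 - h r) := mul_nonneg h0 (by linarith)
  have e3 : 0 ≤ h r ^ 3 := by positivity
  have e4 : 0 ≤ k * (h r ^ 2 * (1 - h r)) := mul_nonneg hk e1
  have e5 : 0 ≤ k * h r ^ 3 := by positivity
  have e6 : 0 ≤ k * (h r * (1 - h r)) := mul_nonneg hk e2
  constructor <;> nlinarith

/-- The flux is nonincreasing. If it were κ > 0 at r, it would be at least κ on (0, r), and h/s² +
(κ/5)s⁻⁵ would be nondecreasing there; as h ≥ 0, this bounds κs⁻⁵ near 0, which is impossible. -/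
theorem flux_nonpos (ht : 0 < t) (hh : IsHedgehogProfile t h) {r : ℝ} (hr : 0 < r) :
    profileFlux h r ≤ 0 := by
  set κ := profileFlux h r
  have hanti : AntitoneOn (profileFlux h) (Set.Ioo 0 (r + 1)) :=
    antitoneOn_of_hasDerivAt (fun s hs => hh.hasDerivAt_flux hs.1)
      (fun s hs => mul_nonpos_of_nonneg_of_nonpos (by have := hs.1; positivity)
        (nonlinearity_bounds ht hh hs.1).1)
  have hge : ∀ s ∈ Set.Ioo 0 r, κ ≤ profileFlux h s := fun s hs =>
    hanti ⟨hs.1, by linarith [hs.2]⟩ ⟨hr, by linarith⟩ hs.2.le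
  have hmono : MonotoneOn (fun s => h s / s ^ 2 + κ / 5 * (s ^ 5)⁻¹) (Set.Ioo 0 r) :=
    monotoneOn_of_hasDerivAt
      (fun s hs => (hh.hasDerivAt_ratio hs.1).add (hasDerivAt_inv_pow_five hs.1 κ))
      (fun s hs => by
        have h1 := hge s hs
        have h2 : 0 < (s ^ 6)⁻¹ := by have := hs.1; positivity
        nlinarith)
  have hm : r / 2 ∈ Set.Ioo 0 r := ⟨by linarith, by linarith⟩
  have := le_zero_of_forall_mul_inv_pow_le (κ := κ / 5) (r₁ := r / 2) (by linarith)
    (C := h (r / 2) / (r / 2) ^ 2 + κ / 5 * ((r / 2) ^ 5)⁻¹) ?_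
  · linarith
  · intro s hs
    have h1 := hmono ⟨hs.1, by linarith [hs.2]⟩ hm hs.2.le
    have h2 : 0 ≤ h s / s ^ 2 := div_nonneg (hh.bounds s hs.1.le).1 (by positivity)
    have h3 : 0 ≤ (s ^ 2)⁻¹ := by positivity
    simp only at h1
    linarith

/-- The mirror image of `flux_nonpos`, now against the upper bound h ≤ 1: a flux below -κ < 0 on (0,
r) would make h/s² grow like s⁻⁵, but it is at most s⁻². -/
theorem neg_le_flux (hh : IsHedgehogProfile t h) {A r₀ : ℝ} {m : ℕ} (hA : 0 ≤ A)
    (hmono : MonotoneOn (fun r => profileFlux h r + A * r ^ m) (Set.Ioo 0 r₀)) {r : ℝ}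
    (hr : r ∈ Set.Ioo 0 r₀) : -(A * r ^ m) ≤ profileFlux h r := by
  set κ := -(profileFlux h r + A * r ^ m)
  suffices hκ : κ / 5 ≤ 0 by simp only [κ] at hκ; linarith
  have hr0 := hr.1
  have hle : ∀ s ∈ Set.Ioo 0 r, profileFlux h s ≤ -κ := fun s hs => by
    have h1 := hmono ⟨hs.1, hs.2.trans hr.2⟩ hr hs.2.le
    have h2 : 0 ≤ A * s ^ m := mul_nonneg hA (pow_nonneg hs.1.le m)
    simp only at h1
    simp only [κ]
    linarith
  have hanti : MonotoneOn (fun s => -(h s / s ^ 2) + κ / 5 * (s ^ 5)⁻¹) (Set.Ioo 0 r) :=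
    monotoneOn_of_hasDerivAt
      (fun s hs => (hh.hasDerivAt_ratio hs.1).neg.add (hasDerivAt_inv_pow_five hs.1 κ))
      (fun s hs => by
        have h1 := hle s hs
        have h2 : 0 < (s ^ 6)⁻¹ := by have := hs.1; positivity
        nlinarith)
  have hm : r / 2 ∈ Set.Ioo 0 r := ⟨by linarith, by linarith⟩
  refine le_zero_of_forall_mul_inv_pow_le (κ := κ / 5) (r₁ := r / 2) (by linarith)
    (C := -(h (r / 2) / (r / 2) ^ 2) + κ / 5 * ((r / 2) ^ 5)⁻¹) ?_
  intro s hs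
  have h1 := hanti ⟨hs.1, by linarith [hs.2]⟩ hm hs.2.le
  have h2 : h s / s ^ 2 ≤ (s ^ 2)⁻¹ := by
    rw [div_eq_mul_inv]
    exact mul_le_of_le_one_left (by positivity) (hh.bounds s hs.1.le).2
  simp only at h1
  linarith

/-- The flux is `O(r⁶)` at the origin. -/
theorem exists_flux_bound (ht : 0 < t) (hh : IsHedgehogProfile t h) :
    ∃ B, 0 ≤ B ∧ ∀ r ∈ Set.Ioo (0 : ℝ) 1, -(B * r ^ 6) ≤ profileFlux h r := by
  set k := 3 * hPlus t / t
  have hk : 0 ≤ k := by have := hPlus_pos ht; positivity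
  set A := (1 + k) / 5
  have hA : 0 ≤ A := by positivity
  -- First pass, with only h ≤ 1: the derivative of the flux is at least -(1 + k)r⁴, whence the
  -- constant A. Integrating the resulting bound on (h/r²)' costs a logarithm and yields a linear
  -- bound for h.
  have h5 : ∀ r ∈ Set.Ioo (0 : ℝ) 2, -(A * r ^ 5) ≤ profileFlux h r := by
    intro r hr
    refine neg_le_flux hh hA (monotoneOn_of_hasDerivAt (fun s hs => (hh.hasDerivAt_flux hs.1).add
      ((hasDerivAt_pow 5 s).const_mul A)) fun s hs => ?_) hr
    have h1 := (nonlinearity_bounds ht hh hs.1).2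
    have h2 := hh.bounds s hs.1.le
    have h3 : 0 < s ^ 4 := by have := hs.1; positivity
    have h4 : -(1 + k) ≤ h s ^ 3 - h s + k * (h s ^ 3 - h s ^ 2) := by
      have : (1 + k) * h s ≤ (1 + k) * 1 := by gcongr; exact h2.2
      linarith
    have h6 := mul_le_mul_of_nonneg_left h4 h3.le
    simp only [A]
    norm_num
    linarith
  have hg : MonotoneOn (fun r => h r / r ^ 2 + A * Real.log r) (Set.Ioo 0 2) := by
    refine monotoneOn_of_hasDerivAt (fun s hs => (hh.hasDerivAt_ratio hs.1).add
      ((Real.hasDerivAt_log hs.1.ne').const_mul A)) fun s hs => ?_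
    have h1 := h5 s hs
    have hs0 := hs.1
    have h2 : 0 ≤ (s ^ 6)⁻¹ := by positivity
    have h3 := mul_le_mul_of_nonneg_right h1 h2
    have h4 : -(A * s ^ 5) * (s ^ 6)⁻¹ = -(A * s⁻¹) := by field_simp
    linarith
  have hh1 : ∀ r ∈ Set.Ioo (0 : ℝ) 1, h r ≤ (1 + A) * r := by
    intro r hr
    have hr0 := hr.1
    have h1 := hg ⟨hr.1, by linarith [hr.2]⟩ (⟨by norm_num, by norm_num⟩ : (1 : ℝ) ∈ Set.Ioo 0 2)
      hr.2.le
    simp only [one_pow, div_one, Real.log_one, mul_zero, add_zero] at h1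
    have h2 : -Real.log r ≤ r⁻¹ := by
      rw [← Real.log_inv]
      exact (Real.log_le_sub_one_of_pos (by positivity)).trans (by linarith)
    have h3 : h r / r ^ 2 ≤ 1 + A * r⁻¹ := by
      have := mul_le_mul_of_nonneg_left h2 hA
      linarith [(hh.bounds 1 (by norm_num)).2]
    have h4 : h r = h r / r ^ 2 * r ^ 2 := by field_simp
    rw [h4]
    calc h r / r ^ 2 * r ^ 2 ≤ (1 + A * r⁻¹) * r ^ 2 := by gcongr
      _ = r * r + A * r := by field_simp
      _ ≤ 1 * r + A * r := by gcongr; exact hr.2.le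
      _ = (1 + A) * r := by ring
  -- Second pass: the linear bound on h gains one power of r in the derivative of the flux, and 1/6
  -- comes from integrating r⁵.
  set B := (1 + k) * (1 + A) / 6
  have hB : 0 ≤ B := by positivity
  refine ⟨B, hB, fun r hr => ?_⟩
  refine neg_le_flux hh hB (monotoneOn_of_hasDerivAt (fun s hs => (hh.hasDerivAt_flux hs.1).add
    ((hasDerivAt_pow 6 s).const_mul B)) fun s hs => ?_) hr
  have h1 := (nonlinearity_bounds ht hh hs.1).2
  have h2 := hh1 s hs
  have h3 : 0 < s ^ 4 := by have := hs.1; positivity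
  have h4 : -((1 + k) * ((1 + A) * s)) ≤ h s ^ 3 - h s + k * (h s ^ 3 - h s ^ 2) := by
    have : (1 + k) * h s ≤ (1 + k) * ((1 + A) * s) := by gcongr
    linarith
  have h6 := mul_le_mul_of_nonneg_left h4 h3.le
  simp only [B]
  norm_num
  linarith

theorem ratio_antitone (ht : 0 < t) (hh : IsHedgehogProfile t h) {r s : ℝ} (hr : 0 < r)
    (hrs : r ≤ s) : h s / s ^ 2 ≤ h r / r ^ 2 := by
  have hanti : AntitoneOn (fun r => h r / r ^ 2) (Set.Ioo 0 (s + 1)) :=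
    antitoneOn_of_hasDerivAt (fun s hs => hh.hasDerivAt_ratio hs.1)
      (fun s hs => mul_nonpos_of_nonpos_of_nonneg (flux_nonpos ht hh hs.1)
        (by have := hs.1; positivity))
  exact hanti ⟨hr, by linarith⟩ ⟨hr.trans_le hrs, by linarith⟩ hrs

/-- As h/r² is nonincreasing and h ≥ 0, a zero of h would persist for all larger radii, against h →
1. -/
theorem pos (ht : 0 < t) (hh : IsHedgehogProfile t h) {r : ℝ} (hr : 0 < r) : 0 < h r := by
  by_contra hneg
  have h0 : h r = 0 := le_antisymm (not_lt.1 hneg) (hh.bounds r hr.le).1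
  have h1 : ∀ᶠ s in atTop, h s ≤ 0 := by
    filter_upwards [eventually_ge_atTop r] with s hs
    have h2 := ratio_antitone ht hh hr hs
    have hs0 := hr.trans_le hs
    rw [h0, zero_div] at h2
    have h3 : h s = h s / s ^ 2 * s ^ 2 := by field_simp
    rw [h3]
    exact mul_nonpos_of_nonpos_of_nonneg h2 (by positivity)
  have := le_of_tendsto hh.tendsto_one h1
  linarith

/-- `h ~ c r²` and `h' ~ 2 c r` at the origin, with `c > 0`. -/
theorem exists_asymptotics (ht : 0 < t) (hh : IsHedgehogProfile t h) : ∃ c, 0 < c ∧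
    Tendsto (fun r => h r / r ^ 2) (𝓝[>] 0) (𝓝 c) ∧
    Tendsto (fun r => deriv h r / r) (𝓝[>] 0) (𝓝 (2 * c)) := by
  obtain ⟨B, hB, hb⟩ := exists_flux_bound ht hh
  -- The flux bound says that (h/r²)' ≥ -B. The corrected ratio is monotone and bounded below, hence
  -- has a limit at 0.
  have hmono : MonotoneOn (fun r => h r / r ^ 2 + B * r) (Set.Ioo 0 1) := by
    refine monotoneOn_of_hasDerivAt (fun s hs => (hh.hasDerivAt_ratio hs.1).add
      ((hasDerivAt_id s).const_mul B)) fun s hs => ?_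
    have h1 := hb s hs
    have hs0 := hs.1
    have h3 := mul_le_mul_of_nonneg_right h1 (show 0 ≤ (s ^ 6)⁻¹ by positivity)
    have h4 : -(B * s ^ 6) * (s ^ 6)⁻¹ = -B := by field_simp
    linarith
  have hbdd : BddBelow ((fun r => h r / r ^ 2 + B * r) '' Set.Ioo 0 1) := by
    refine ⟨0, ?_⟩
    rintro _ ⟨r, hr, rfl⟩
    have h1 := (hh.bounds r hr.1.le).1
    have := hr.1
    positivity
  have hlim := hmono.tendsto_nhdsWithin_Ioo_right (by simp) hbdd
  set c := sInf ((fun r => h r / r ^ 2 + B * r) '' Set.Ioo 0 1)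
  have hBr : Tendsto (fun r : ℝ => B * r) (𝓝[>] 0) (𝓝 0) := by
    have : Continuous fun r : ℝ => B * r := by fun_prop
    have := this.tendsto 0
    rw [mul_zero] at this
    exact this.mono_left nhdsWithin_le_nhds
  have hg : Tendsto (fun r => h r / r ^ 2) (𝓝[>] 0) (𝓝 c) := by
    have := hlim.sub hBr
    simpa using this
  have hc : 0 < c := by
    have h1 : 0 < h 1 / 1 ^ 2 := by have := pos ht hh one_pos; positivity
    refine h1.trans_le (ge_of_tendsto hg ?_)
    filter_upwards [Ioo_mem_nhdsGT one_pos] with r hr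
    exact ratio_antitone ht hh hr.1 hr.2.le
  refine ⟨c, hc, hg, ?_⟩
  -- By the definition of the flux, h'/r = 2h/r² + flux/r⁵, and the last term is O(r).
  have hfl : Tendsto (fun r => profileFlux h r / r ^ 5) (𝓝[>] 0) (𝓝 0) := by
    refine tendsto_of_tendsto_of_tendsto_of_le_of_le' (by simpa using hBr.neg)
      tendsto_const_nhds ?_ ?_
    · filter_upwards [Ioo_mem_nhdsGT one_pos] with r hr
      have hr0 := hr.1
      rw [le_div_iff₀ (by positivity)]
      have := hb r hr
      linarith
    · filter_upwards [self_mem_nhdsWithin] with r hr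
      exact div_nonpos_of_nonpos_of_nonneg (flux_nonpos ht hh hr) (pow_nonneg (le_of_lt hr) 5)
  have := (hg.const_mul 2).add hfl
  rw [add_zero] at this
  refine this.congr' ?_
  filter_upwards [self_mem_nhdsWithin] with r hr
  have hr0 : 0 < r := hr
  unfold profileFlux
  field_simp
  ring

theorem contDiffOn_one (hh : IsHedgehogProfile t h) : ContDiffOn ℝ 1 h (Set.Ioi 0) := by
  refine (contDiffOn_one_iff_derivWithin (uniqueDiffOn_Ioi 0)).2 ⟨fun r hr =>
    (hh.diff r hr).differentiableWithinAt, ?_⟩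
  have : ContinuousOn (deriv h) (Set.Ioi 0) := fun r hr =>
    (hh.diff' r hr).continuousAt.continuousWithinAt
  exact this.congr fun r hr => derivWithin_of_isOpen isOpen_Ioi hr

end IsHedgehogProfile

/-! ### The bulk energy density -/

theorem trace_add_smul_sq (A E : Mat3) (e : ℝ) :
    ((A + e • E) ^ 2).trace = (A ^ 2).trace + 2 * e * (A * E).trace + e ^ 2 * (E ^ 2).trace := by
  simp [Matrix.trace, pow_succ, Matrix.mul_apply, Fin.sum_univ_three]
  ring

theorem trace_add_smul_cube (A E : Mat3) (e : ℝ) :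
    ((A + e • E) ^ 3).trace = (A ^ 3).trace + 3 * e * (A ^ 2 * E).trace +
      3 * e ^ 2 * (A * E ^ 2).trace + e ^ 3 * (E ^ 3).trace := by
  simp [Matrix.trace, pow_succ, Matrix.mul_apply, Fin.sum_univ_three]
  ring

/-- For eigenvalues with sum zero, the difference of the two sides is twice the discriminant of the
characteristic polynomial. Equality holds when two eigenvalues coincide, that is, for uniaxial
tensors. -/
theorem trace_cube_sq_le {A : Mat3} (hA : A ∈ S0) :
    6 * (A ^ 3).trace ^ 2 ≤ (A ^ 2).trace ^ 3 := by
  have hH : A.IsHermitian := by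
    rw [Matrix.IsHermitian, Matrix.conjTranspose_eq_transpose_of_trivial]; exact hA.1
  have h := hH.spectral_theorem
  set U := hH.eigenvectorUnitary
  set e := hH.eigenvalues
  have hp : ∀ n : ℕ, (A ^ n).trace = ∑ i, e i ^ n := by
    intro n
    rw [h, ← map_pow, Unitary.conjStarAlgAut_apply, Matrix.trace_mul_comm, ← mul_assoc]
    simp [Matrix.diagonal_pow, Matrix.trace_diagonal]
  have h1 : A.trace = ∑ i, e i := by simpa using hp 1
  rw [hA.2] at h1
  rw [hp, hp]
  simp only [Fin.sum_univ_three] at *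
  have : e 2 = -e 0 - e 1 := by linarith
  rw [this]
  nlinarith [sq_nonneg ((e 0 - e 1) * (2 * e 0 + e 1) * (e 0 + 2 * e 1))]

theorem trace_uniaxial_sq (s : ℝ) {n : E3} (hn : ‖n‖ = 1) :
    ((uniaxial s n) ^ 2).trace = 2 / 3 * s ^ 2 := by
  have h := norm_sq_eq_sum n
  rw [hn] at h
  have h2 : n 0 ^ 2 = 1 - n 1 ^ 2 - n 2 ^ 2 := by linarith
  simp [uniaxial, Matrix.trace, pow_succ, Matrix.mul_apply, Fin.sum_univ_three, Matrix.vecMulVec_apply]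
  ring_nf
  rw [show n 0 ^ 4 = (n 0 ^ 2) ^ 2 by ring, h2]
  ring

theorem trace_uniaxial_cube (s : ℝ) {n : E3} (hn : ‖n‖ = 1) :
    ((uniaxial s n) ^ 3).trace = 2 / 9 * s ^ 3 := by
  have h := norm_sq_eq_sum n
  rw [hn] at h
  have h2 : n 0 ^ 2 = 1 - n 1 ^ 2 - n 2 ^ 2 := by linarith
  simp [uniaxial, Matrix.trace, pow_succ, Matrix.mul_apply, Fin.sum_univ_three, Matrix.vecMulVec_apply]
  ring_nf
  rw [show n 0 ^ 4 = (n 0 ^ 2) ^ 2 by ring, show n 0 ^ 6 = (n 0 ^ 2) ^ 3 by ring, h2]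
  ring

theorem uniaxial_mem_S0 (s : ℝ) {n : E3} (hn : ‖n‖ = 1) : uniaxial s n ∈ S0 := by
  have h := norm_sq_eq_sum n
  rw [hn] at h
  constructor
  · unfold uniaxial Matrix.IsSymm
    ext i j
    simp [Matrix.vecMulVec_apply, Matrix.one_apply, mul_comm, eq_comm]
  · simp [uniaxial, Matrix.trace, Fin.sum_univ_three, Matrix.vecMulVec_apply]
    linear_combination (-s) * h

theorem trace_sq_eq_normSq {A : Mat3} (hA : A ∈ S0) : (A ^ 2).trace = normSq A := by
  have h : ∀ i j, A j i = A i j := fun i j => hA.1.apply i j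
  simp only [normSq, Matrix.trace, pow_two, Matrix.mul_apply, Matrix.diag_apply]
  refine Finset.sum_congr rfl fun i _ => Finset.sum_congr rfl fun j _ => ?_
  rw [h i j]

theorem normSq_nonneg (A : Mat3) : 0 ≤ normSq A :=
  Finset.sum_nonneg fun _ _ => Finset.sum_nonneg fun _ _ => sq_nonneg _

theorem two_mul_hPlus_sq {t : ℝ} (ht : 0 < t) : 2 * hPlus t ^ 2 = 3 * hPlus t + t := by
  unfold hPlus
  have : √(9 + 8 * t) ^ 2 = 9 + 8 * t := Real.sq_sqrt (by positivity)
  linear_combination (1 / 8) * this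

/-- Put r = |A| and m = h₊/t. Since √6 tr A³ ≤ r³, and since 2h₊² = 3h₊ + t, the density is at least
(1 - r²)²/4 + (m/4)(r - 1)²(3r² + 2r + 1). -/
theorem bulk_nonneg {t : ℝ} (ht : 0 < t) {A : Mat3} (hA : A ∈ S0) : 0 ≤ bulk t A := by
  have h1 := trace_cube_sq_le hA
  have h2 := two_mul_hPlus_sq ht
  have h3 := hPlus_pos ht
  have ha : 0 ≤ (A ^ 2).trace := by rw [trace_sq_eq_normSq hA]; exact normSq_nonneg A
  unfold bulk
  set a := (A ^ 2).trace
  set b := (A ^ 3).trace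
  clear_value a b
  obtain ⟨r, hr, rfl⟩ : ∃ r : ℝ, 0 ≤ r ∧ a = r ^ 2 := ⟨√a, Real.sqrt_nonneg _, (Real.sq_sqrt ha).symm⟩
  have h6 : √6 * b ≤ r ^ 3 := by
    refine abs_le_of_sq_le_sq' ?_ (by positivity) |>.2
    rw [mul_pow, Real.sq_sqrt (by norm_num)]
    linarith [h1, show (r ^ 2) ^ 3 = (r ^ 3) ^ 2 by ring]
  set m := hPlus t / t
  have hm : 0 ≤ m := by positivity
  have h7 : hPlus t ^ 2 / (2 * t) = (3 * m + 1) / 4 := by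
    simp only [m]
    field_simp
    linarith
  have h8 : √6 * hPlus t / t * b = m * (√6 * b) := by simp only [m]; ring
  rw [h7, h8]
  have h9 : m * (√6 * b) ≤ m * r ^ 3 := by gcongr
  have h10 : 0 ≤ m * ((r - 1) ^ 2 * (3 * r ^ 2 + 2 * r + 1)) := by positivity
  nlinarith [sq_nonneg (1 - r ^ 2)]

theorem bulk_continuous (t : ℝ) : Continuous (bulk t) := by unfold bulk; fun_prop

theorem bulk_boundaryDatum {t : ℝ} {x : E3} (hx : x ≠ 0) : bulk t (boundaryDatum x) = 0 := by
  have hn : ‖‖x‖⁻¹ • x‖ = 1 := by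
    rw [norm_smul, norm_inv, norm_norm, inv_mul_cancel₀ (norm_ne_zero_iff.2 hx)]
  unfold bulk boundaryDatum
  rw [trace_uniaxial_sq _ hn, trace_uniaxial_cube _ hn]
  have h1 : √(3 / 2) ^ 2 = (3 / 2 : ℝ) := Real.sq_sqrt (by norm_num)
  have h2 : √6 * √(3 / 2) = 3 := by
    rw [← Real.sqrt_mul (by norm_num), show (6 * (3 / 2) : ℝ) = 3 ^ 2 by norm_num]
    exact Real.sqrt_sq (by norm_num)
  have h3 : √6 * hPlus t / t * (2 / 9 * √(3 / 2) ^ 3) = hPlus t / t := by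
    have : √6 * hPlus t / t * (2 / 9 * √(3 / 2) ^ 3) =
      hPlus t / t * (2 / 9) * (√6 * √(3 / 2)) * √(3 / 2) ^ 2 := by ring
    rw [this, h1, h2]; ring
  rw [h3, h1]
  ring

/-! ### Finite energy and variations -/

/-- The energy density. -/
noncomputable def density (t : ℝ) (Q : E3 → Mat3) (G : Fin 3 → Fin 3 → Fin 3 → E3 → ℝ) (x : E3) : ℝ :=
  (1 / 2) * (∑ i, ∑ j, ∑ k, G i j k x ^ 2) + bulk t (Q x)

theorem density_nonneg {t : ℝ} (ht : 0 < t) {Q : E3 → Mat3} {G : Fin 3 → Fin 3 → Fin 3 → E3 → ℝ}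
    {x : E3} (hx : Q x ∈ S0) : 0 ≤ density t Q G x := by
  have h1 := bulk_nonneg ht hx
  have h2 : 0 ≤ ∑ i, ∑ j, ∑ k, G i j k x ^ 2 :=
    Finset.sum_nonneg fun _ _ => Finset.sum_nonneg fun _ _ => Finset.sum_nonneg fun _ _ => sq_nonneg _
  unfold density; linarith

theorem boundaryDatum_mem_S0 {x : E3} (hx : x ≠ 0) : boundaryDatum x ∈ S0 := by
  refine uniaxial_mem_S0 _ ?_
  rw [norm_smul, norm_inv, norm_norm, inv_mul_cancel₀ (norm_ne_zero_iff.2 hx)]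

theorem ae_ne_zero (Ω : Set E3) : ∀ᵐ x ∂(volume.restrict Ω), x ≠ 0 := by
  refine ae_restrict_of_ae ?_
  simp [ae_iff, measure_singleton]

theorem integrable_sum_sq {Ω : Set E3} {G : Fin 3 → Fin 3 → Fin 3 → E3 → ℝ}
    (hG : ∀ i j k, MemLp (G i j k) 2 (volume.restrict Ω)) :
    Integrable (fun x => ∑ i, ∑ j, ∑ k, G i j k x ^ 2) (volume.restrict Ω) :=
  integrable_finsetSum _ fun i _ => integrable_finsetSum _ fun j _ =>
    integrable_finsetSum _ fun k _ => (hG i j k).integrable_sq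

/-- The competitor is the boundary datum itself, whose bulk energy vanishes off the origin. Its weak
gradient is the gradient of Q minus that of Q - datum, so it need not be computed. -/
theorem IsAdmissible.exists_finite_energy {R t : ℝ} {Q : E3 → Mat3}
    {G : Fin 3 → Fin 3 → Fin 3 → E3 → ℝ} (hQ : IsAdmissible R Q G) :
    ∃ P H, IsAdmissible R P H ∧ energy t R P H ≠ ⊤ := by
  choose D hD using hQ.boundary
  have hdat : ∀ i j, MemW12 (ball 0 R) (fun x => boundaryDatum x i j)
      (fun k x => G i j k x - D i j k x) := by
    intro i j
    have := (hQ.memW12 i j).sub (hD i j).toMemW12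
    simpa using this
  refine ⟨boundaryDatum, fun i j k x => G i j k x - D i j k x, ⟨?_, hdat, fun i j =>
    ⟨_, ((isC1Test_zero _).memW12Zero isOpen_ball measure_ball_lt_top.ne).congr
      (fun x => (sub_self _).symm)⟩⟩, ?_⟩
  · filter_upwards [ae_ne_zero (ball 0 R)] with x hx using boundaryDatum_mem_S0 hx
  · have hint := (integrable_sum_sq (fun i j k => (hdat i j).memLp_grad k)).const_mul (1 / 2)
    have h0 := (lintegral_ofReal_ne_top_iff_integrable hint.aestronglyMeasurable
      (Eventually.of_forall fun x => by
        simp only [Pi.zero_apply]; positivity)).2 hint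
    unfold energy
    rwa [lintegral_congr_ae (g := fun x => ENNReal.ofReal ((1 / 2) *
      (∑ i, ∑ j, ∑ k, (G i j k x - D i j k x) ^ 2)))]
    filter_upwards [ae_ne_zero (ball 0 R)] with x hx
    rw [bulk_boundaryDatum hx, add_zero]

theorem integrableOn_of_continuousOn_of_compact {Ω K : Set E3} (hΩ : IsOpen Ω) (hK : IsCompact K)
    (hsub : K ⊆ Ω) {f : E3 → ℝ} (hf : ContinuousOn f Ω) (h0 : ∀ x ∉ K, f x = 0) :
    IntegrableOn f Ω :=
  ((hf.mono hsub).integrableOn_compact hK).of_forall_sdiff_eq_zero hΩ.measurableSet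
    (fun x hx => h0 x hx.2)

/-- The change of the energy density under the variation `Q ↦ Q + P`. -/
noncomputable def variation (t : ℝ) (Q : E3 → Mat3) (G : Fin 3 → Fin 3 → Fin 3 → E3 → ℝ) (P : E3 → Mat3)
    (x : E3) : ℝ :=
  (∑ i, ∑ j, ∑ k, (G i j k x * pd k (fun y => P y i j) x +
    (1 / 2) * pd k (fun y => P y i j) x ^ 2)) + (bulk t (Q x + P x) - bulk t (Q x))

theorem S0_add {A B : Mat3} (hA : A ∈ S0) (hB : B ∈ S0) : A + B ∈ S0 :=
  ⟨hA.1.add hB.1, by rw [Matrix.trace_add, hA.2, hB.2, add_zero]⟩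

theorem S0_smul {A : Mat3} (c : ℝ) (hA : A ∈ S0) : c • A ∈ S0 :=
  ⟨hA.1.smul c, by rw [Matrix.trace_smul, hA.2, smul_zero]⟩

/-- Minimality compares values in [0,∞], so energies may be subtracted only after finiteness is
known; the datum as competitor provides it. Differences of bulk terms vanish off the compact support
of P and are integrable there by continuity. -/
theorem variation_integral_nonneg {t R : ℝ} (ht : 0 < t) {Q P : E3 → Mat3}
    {G : Fin 3 → Fin 3 → Fin 3 → E3 → ℝ} (hQ : IsAdmissible R Q G)
    (hmin : ∀ P H, IsAdmissible R P H → energy t R Q G ≤ energy t R P H)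
    (hcont : ContinuousOn Q (ball 0 R))
    (hP : ∀ i j, IsC1Test (ball 0 R) (fun x => P x i j)) (hPS : ∀ x, P x ∈ S0) :
    IntegrableOn (variation t Q G P) (ball 0 R) ∧
    0 ≤ ∫ x in ball 0 R, variation t Q G P x := by
  set Ω := ball (0 : E3) R
  have hΩ : IsOpen Ω := isOpen_ball
  have hPc : Continuous P := continuous_matrix fun i j => (hP i j).contDiff.continuous
  set K := ⋃ i, ⋃ j, tsupport (fun x => P x i j)
  have hK : IsCompact K := isCompact_iUnion fun i => isCompact_iUnion fun j =>
    (hP i j).compact.isCompact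
  have hKs : K ⊆ Ω := Set.iUnion_subset fun i => Set.iUnion_subset fun j => (hP i j).subset
  have hP0 : ∀ x ∉ K, P x = 0 := by
    intro x hx
    ext i j
    by_contra hne
    exact hx (Set.mem_iUnion₂.2 ⟨i, j, subset_tsupport _ hne⟩)
  have hbd : IntegrableOn (fun x => bulk t (Q x + P x) - bulk t (Q x)) Ω := by
    refine integrableOn_of_continuousOn_of_compact hΩ hK hKs ?_ (fun x hx => ?_)
    · exact ((bulk_continuous t).comp_continuousOn (hcont.add hPc.continuousOn)).sub
        ((bulk_continuous t).comp_continuousOn hcont)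
    · simp [hP0 x hx]
  have hpd2 : ∀ i j k, MemLp (pd k (fun y => P y i j)) 2 (volume.restrict Ω) := fun i j k =>
    memLp_of_continuous_compact ((hP i j).continuous_pd k)
      (HasCompactSupport.pd (hP i j).compact k) 2
  have hvar : IntegrableOn (variation t Q G P) Ω := by
    refine Integrable.add ?_ hbd
    refine integrable_finsetSum _ fun i _ => integrable_finsetSum _ fun j _ =>
      integrable_finsetSum _ fun k _ => Integrable.add ?_ ?_
    · exact ((hQ.memW12 i j).memLp_grad k).integrable_mul (hpd2 i j k)
    · exact (hpd2 i j k).integrable_sq.const_mul _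
  refine ⟨hvar, ?_⟩
  obtain ⟨P₀, H₀, hadm₀, hfin₀⟩ := hQ.exists_finite_energy (t := t)
  have hfin : energy t R Q G ≠ ⊤ := ne_top_of_le_ne_top hfin₀ (hmin _ _ hadm₀)
  have hn0 : 0 ≤ᵐ[volume.restrict Ω] density t Q G := by
    filter_upwards [hQ.mem_S0] with x hx using density_nonneg ht hx
  have hm0 : AEStronglyMeasurable (density t Q G) (volume.restrict Ω) := by
    refine AEStronglyMeasurable.add ?_ ?_
    · exact (integrable_sum_sq (fun i j k =>
        (hQ.memW12 i j).memLp_grad k)).aestronglyMeasurable.const_mul _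
    · exact ((bulk_continuous t).comp_continuousOn hcont).aestronglyMeasurable hΩ.measurableSet
  have hi0 : Integrable (density t Q G) (volume.restrict Ω) :=
    (lintegral_ofReal_ne_top_iff_integrable hm0 hn0).1 hfin
  set H : Fin 3 → Fin 3 → Fin 3 → E3 → ℝ := fun i j k x => G i j k x + pd k (fun y => P y i j) x
  have hadm : IsAdmissible R (fun x => Q x + P x) H := by
    refine ⟨?_, fun i j => ?_, fun i j => ?_⟩
    · filter_upwards [hQ.mem_S0] with x hx using S0_add hx (hPS x)
    · exact (hQ.memW12 i j).add
        ((hP i j).memW12Zero hΩ measure_ball_lt_top.ne).toMemW12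
    · obtain ⟨D, hD⟩ := hQ.boundary i j
      refine ⟨_, (hD.add ((hP i j).memW12Zero hΩ measure_ball_lt_top.ne)).congr fun x => ?_⟩
      simp only [Matrix.add_apply]; ring
  have hdens : ∀ x, density t (fun x => Q x + P x) H x = density t Q G x + variation t Q G P x := by
    intro x
    have e : ∑ i, ∑ j, ∑ k, (G i j k x * pd k (fun y => P y i j) x +
        (1 / 2) * pd k (fun y => P y i j) x ^ 2) =
        (1 / 2) * (∑ i, ∑ j, ∑ k, H i j k x ^ 2) - (1 / 2) * (∑ i, ∑ j, ∑ k, G i j k x ^ 2) := by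
      simp only [Finset.mul_sum, ← Finset.sum_sub_distrib]
      refine Finset.sum_congr rfl fun i _ => Finset.sum_congr rfl fun j _ =>
        Finset.sum_congr rfl fun k _ => ?_
      simp only [H]
      ring
    unfold variation density
    rw [e]
    ring
  have hi1 : Integrable (density t (fun x => Q x + P x) H) (volume.restrict Ω) :=
    (hi0.add hvar).congr (Eventually.of_forall fun x => (hdens x).symm)
  have hn1 : 0 ≤ᵐ[volume.restrict Ω] density t (fun x => Q x + P x) H := by
    filter_upwards [hadm.mem_S0] with x hx using density_nonneg ht hx
  have hle := hmin _ _ hadm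
  have e0 : energy t R Q G = ENNReal.ofReal (∫ x in Ω, density t Q G x) :=
    (ofReal_integral_eq_lintegral_ofReal hi0 hn0).symm
  have e1 : energy t R (fun x => Q x + P x) H =
      ENNReal.ofReal (∫ x in Ω, density t (fun x => Q x + P x) H x) :=
    (ofReal_integral_eq_lintegral_ofReal hi1 hn1).symm
  rw [e0, e1, ENNReal.ofReal_le_ofReal_iff (integral_nonneg_of_ae hn1)] at hle
  have e2 : ∫ x in Ω, density t (fun x => Q x + P x) H x =
      (∫ x in Ω, density t Q G x) + ∫ x in Ω, variation t Q G P x := by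
    rw [← integral_add hi0 hvar]
    exact integral_congr_ae (Eventually.of_forall hdens)
  linarith

/-! ### The Euler-Lagrange equation -/

/-- The derivative of the bulk energy density at `A` in the direction `E`. -/
noncomputable def bulkDeriv (t : ℝ) (A E : Mat3) : ℝ :=
  -(A * E).trace - 3 * (√6 * hPlus t / t) * (A ^ 2 * E).trace
    + 4 * (hPlus t ^ 2 / (2 * t)) * (A ^ 2).trace * (A * E).trace

theorem bulk_add_smul (t : ℝ) (A E : Mat3) (e : ℝ) :
    bulk t (A + e • E) - bulk t A = e * bulkDeriv t A E +
      e ^ 2 * (-(1 / 2) * (E ^ 2).trace - 3 * (√6 * hPlus t / t) * (A * E ^ 2).trace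
        + hPlus t ^ 2 / (2 * t) * (2 * (A ^ 2).trace * (E ^ 2).trace + 4 * (A * E).trace ^ 2)) +
      e ^ 3 * (-(√6 * hPlus t / t) * (E ^ 3).trace
        + 4 * (hPlus t ^ 2 / (2 * t)) * (A * E).trace * (E ^ 2).trace) +
      e ^ 4 * (hPlus t ^ 2 / (2 * t) * (E ^ 2).trace ^ 2) := by
  unfold bulk bulkDeriv
  rw [trace_add_smul_sq, trace_add_smul_cube]
  ring

theorem eq_zero_of_quartic_nonneg {a b c d : ℝ}
    (h : ∀ e : ℝ, 0 ≤ e * a + e ^ 2 * b + e ^ 3 * c + e ^ 4 * d) : a = 0 := by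
  have hlim : Tendsto (fun e : ℝ => a + e * b + e ^ 2 * c + e ^ 3 * d) (𝓝 0) (𝓝 a) := by
    have : Continuous fun e : ℝ => a + e * b + e ^ 2 * c + e ^ 3 * d := by fun_prop
    simpa using this.tendsto 0
  apply le_antisymm
  · refine le_of_tendsto (hlim.mono_left (nhdsWithin_le_nhds (s := Set.Iio 0))) ?_
    filter_upwards [self_mem_nhdsWithin] with e he
    have he0 : e < 0 := he
    have := h e
    by_contra hcon
    push Not at hcon
    nlinarith [mul_neg_of_neg_of_pos he0 hcon]
  · refine ge_of_tendsto (hlim.mono_left (nhdsWithin_le_nhds (s := Set.Ioi 0))) ?_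
    filter_upwards [self_mem_nhdsWithin] with e he
    have he0 : 0 < e := he
    have := h e
    by_contra hcon
    push Not at hcon
    nlinarith [mul_neg_of_pos_of_neg he0 hcon]

/-- The variation is eφE with E constant. The density is quartic in Q, so the energy change is
exactly a quartic polynomial in e without constant term; it is nonnegative for every e, so its
linear coefficient vanishes. Both derivatives are placed on φ, the form in which the Poisson
regularity applies to a merely continuous Q. -/
theorem euler_lagrange {t R : ℝ} (ht : 0 < t) {Q : E3 → Mat3}
    {G : Fin 3 → Fin 3 → Fin 3 → E3 → ℝ} (hQ : IsAdmissible R Q G)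
    (hmin : ∀ P H, IsAdmissible R P H → energy t R Q G ≤ energy t R P H)
    (hcont : ContinuousOn Q (ball 0 R)) {E : Mat3} (hE : E ∈ S0) {φ : E3 → ℝ}
    (hφ : IsTest (ball 0 R) φ) :
    ∑ i, ∑ j, E i j * ∫ x in ball 0 R, Q x i j * ∑ k, pd k (pd k φ) x =
      ∫ x in ball 0 R, bulkDeriv t (Q x) E * φ x := by
  set Ω := ball (0 : E3) R
  have hΩ : IsOpen Ω := isOpen_ball
  have hC := hφ.isC1Test
  have hd : Differentiable ℝ φ := hφ.1.differentiable (by norm_num)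
  set c₂ : E3 → ℝ := fun x => -(1 / 2) * (E ^ 2).trace - 3 * (√6 * hPlus t / t) * (Q x * E ^ 2).trace
        + hPlus t ^ 2 / (2 * t) * (2 * (Q x ^ 2).trace * (E ^ 2).trace + 4 * (Q x * E).trace ^ 2)
  set c₃ : E3 → ℝ := fun x => -(√6 * hPlus t / t) * (E ^ 3).trace
        + 4 * (hPlus t ^ 2 / (2 * t)) * (Q x * E).trace * (E ^ 2).trace
  set c₄ : E3 → ℝ := fun _ => hPlus t ^ 2 / (2 * t) * (E ^ 2).trace ^ 2
  have hc1 : ContinuousOn (fun x => bulkDeriv t (Q x) E) Ω := by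
    have : Continuous fun A : Mat3 => bulkDeriv t A E := by unfold bulkDeriv; fun_prop
    exact this.comp_continuousOn hcont
  have hc2 : ContinuousOn c₂ Ω := by
    have : Continuous fun A : Mat3 => -(1 / 2) * (E ^ 2).trace -
        3 * (√6 * hPlus t / t) * (A * E ^ 2).trace + hPlus t ^ 2 / (2 * t) *
          (2 * (A ^ 2).trace * (E ^ 2).trace + 4 * (A * E).trace ^ 2) := by fun_prop
    exact this.comp_continuousOn hcont
  have hc3 : ContinuousOn c₃ Ω := by
    have : Continuous fun A : Mat3 => -(√6 * hPlus t / t) * (E ^ 3).trace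
        + 4 * (hPlus t ^ 2 / (2 * t)) * (A * E).trace * (E ^ 2).trace := by fun_prop
    exact this.comp_continuousOn hcont
  have hpow : ∀ n : ℕ, n ≠ 0 → Continuous (fun x => φ x ^ n) ∧ HasCompactSupport (fun x => φ x ^ n) ∧
      tsupport (fun x => φ x ^ n) ⊆ Ω := by
    intro n hn
    have hs : tsupport (fun x => φ x ^ n) ⊆ tsupport φ := by
      refine closure_mono fun x hx => ?_
      intro h0
      apply hx
      simp [h0, hn]
    exact ⟨hφ.1.continuous.pow n, hφ.2.1.of_isClosed_subset (isClosed_tsupport _) hs,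
      hs.trans hφ.2.2⟩
  have hint : ∀ {c : E3 → ℝ} (n : ℕ), n ≠ 0 → ContinuousOn c Ω →
      IntegrableOn (fun x => c x * φ x ^ n) Ω := fun n hn hc =>
    (integrable_mul_of_tsupport_subset hΩ hc (hpow n hn).1 (hpow n hn).2.1
      (hpow n hn).2.2).integrableOn
  have hg1 : ∀ i j k, IntegrableOn (fun x => G i j k x * pd k φ x) Ω := fun i j k =>
    (hφ.pd k).integrable_mul ((hQ.memW12 i j).memLp_grad k)
  have hg2 : ∀ k, IntegrableOn (fun x => pd k φ x ^ 2) Ω := fun k =>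
    (memLp_of_continuous_compact (hC.continuous_pd k)
      (HasCompactSupport.pd hC.compact k) 2).integrable_sq
  set I₁ : E3 → ℝ := fun x => (∑ i, ∑ j, ∑ k, E i j * (G i j k x * pd k φ x)) +
    bulkDeriv t (Q x) E * φ x ^ 1
  set I₂ : E3 → ℝ := fun x => (∑ i, ∑ j, ∑ k, (1 / 2) * E i j ^ 2 * pd k φ x ^ 2) + c₂ x * φ x ^ 2
  have hI₁' : IntegrableOn (fun x => ∑ i, ∑ j, ∑ k, E i j * (G i j k x * pd k φ x)) Ω :=
    integrable_finsetSum _ fun i _ => integrable_finsetSum _ fun j _ =>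
      integrable_finsetSum _ fun k _ => (hg1 i j k).const_mul _
  have hI₁ : IntegrableOn I₁ Ω := hI₁'.add (hint 1 one_ne_zero hc1)
  have hI₂ : IntegrableOn I₂ Ω := Integrable.add
    (integrable_finsetSum _ fun i _ => integrable_finsetSum _ fun j _ =>
      integrable_finsetSum _ fun k _ => (hg2 k).const_mul _) (hint 2 two_ne_zero hc2)
  have hI₃ : IntegrableOn (fun x => c₃ x * φ x ^ 3) Ω := hint 3 three_ne_zero hc3
  have hI₄ : IntegrableOn (fun x => c₄ x * φ x ^ 4) Ω := hint 4 four_ne_zero continuousOn_const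
  have hvar : ∀ e : ℝ, 0 ≤ e * (∫ x in Ω, I₁ x) + e ^ 2 * (∫ x in Ω, I₂ x) +
      e ^ 3 * (∫ x in Ω, c₃ x * φ x ^ 3) + e ^ 4 * (∫ x in Ω, c₄ x * φ x ^ 4) := by
    intro e
    have hent : ∀ i j, (fun x => ((e * φ x) • E) i j) = fun x => (e * E i j) * φ x := by
      intro i j; funext x; simp only [Matrix.smul_apply, smul_eq_mul]; ring
    have hP : ∀ i j, IsC1Test Ω (fun x => ((e * φ x) • E) i j) := fun i j => by
      rw [hent]; exact hC.const_mul _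
    have := (variation_integral_nonneg ht hQ hmin hcont (P := fun x => (e * φ x) • E) hP
      (fun x => S0_smul _ hE)).2
    have j₂ : Integrable (fun x => e * I₁ x + e ^ 2 * I₂ x) (volume.restrict Ω) :=
      (hI₁.const_mul e).add (hI₂.const_mul _)
    have j₃ : Integrable (fun x => e * I₁ x + e ^ 2 * I₂ x + e ^ 3 * (c₃ x * φ x ^ 3))
      (volume.restrict Ω) := j₂.add (hI₃.const_mul _)
    rw [← integral_const_mul, ← integral_const_mul, ← integral_const_mul, ← integral_const_mul,
      ← integral_add (hI₁.const_mul e) (hI₂.const_mul _),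
      ← integral_add j₂ (hI₃.const_mul _), ← integral_add j₃ (hI₄.const_mul _)]
    refine this.trans_eq (integral_congr_ae (Eventually.of_forall fun x => ?_))
    simp only [variation]
    rw [bulk_add_smul]
    simp only [hent, pd_const_mul _ (hd x)]
    have e1 : ∑ i, ∑ j, ∑ k, (G i j k x * (e * E i j * pd k φ x) +
        1 / 2 * (e * E i j * pd k φ x) ^ 2) =
        e * (∑ i, ∑ j, ∑ k, E i j * (G i j k x * pd k φ x)) +
        e ^ 2 * (∑ i, ∑ j, ∑ k, (1 / 2) * E i j ^ 2 * pd k φ x ^ 2) := by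
      simp only [Finset.mul_sum, ← Finset.sum_add_distrib]
      refine Finset.sum_congr rfl fun i _ => Finset.sum_congr rfl fun j _ =>
        Finset.sum_congr rfl fun k _ => ?_
      ring
    rw [e1]
    simp only [I₁, I₂, c₂, c₃, c₄]
    ring
  have h0 := eq_zero_of_quartic_nonneg hvar
  have e2 : ∫ x in Ω, I₁ x = (∫ x in Ω, ∑ i, ∑ j, ∑ k, E i j * (G i j k x * pd k φ x)) +
      ∫ x in Ω, bulkDeriv t (Q x) E * φ x := by
    have hb : IntegrableOn (fun x => bulkDeriv t (Q x) E * φ x) Ω := by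
      simpa using hint 1 one_ne_zero hc1
    rw [← integral_add hI₁' hb]
    simp only [I₁, pow_one]
  have e3 : ∀ i j, ∫ x in Ω, Q x i j * ∑ k, pd k (pd k φ) x =
      -∑ k, ∫ x in Ω, G i j k x * pd k φ x := by
    intro i j
    simp only [Finset.mul_sum]
    rw [integral_finsetSum _ fun k _ => ((hφ.pd k).pd k).integrable_mul (hQ.memW12 i j).memLp,
      ← Finset.sum_neg_distrib]
    exact Finset.sum_congr rfl fun k _ => (hQ.memW12 i j).weak k _ (hφ.pd k)
  have e4 : ∫ x in Ω, ∑ i, ∑ j, ∑ k, E i j * (G i j k x * pd k φ x) =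
      -∑ i, ∑ j, E i j * ∫ x in Ω, Q x i j * ∑ k, pd k (pd k φ) x := by
    rw [integral_finsetSum _ fun i _ => integrable_finsetSum _ fun j _ =>
      integrable_finsetSum _ fun k _ => (hg1 i j k).const_mul _, ← Finset.sum_neg_distrib]
    refine Finset.sum_congr rfl fun i _ => ?_
    rw [integral_finsetSum _ fun j _ =>
      integrable_finsetSum _ fun k _ => (hg1 i j k).const_mul _, ← Finset.sum_neg_distrib]
    refine Finset.sum_congr rfl fun j _ => ?_
    rw [integral_finsetSum _ fun k _ => (hg1 i j k).const_mul _, e3]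
    simp only [integral_const_mul, ← Finset.mul_sum]
    ring
  rw [e2, e4] at h0
  linarith

/-! ### Interior regularity of minimizers -/

theorem contDiffOn_mul_apply {n : WithTop ℕ∞} {Ω : Set E3} {A B : E3 → Mat3}
    (hA : ∀ i j, ContDiffOn ℝ n (fun x => A x i j) Ω)
    (hB : ∀ i j, ContDiffOn ℝ n (fun x => B x i j) Ω) (i j : Fin 3) :
    ContDiffOn ℝ n (fun x => (A x * B x) i j) Ω := by
  simp only [Matrix.mul_apply]
  exact ContDiffOn.sum fun k _ => (hA i k).mul (hB k j)

theorem contDiffOn_trace {n : WithTop ℕ∞} {Ω : Set E3} {A : E3 → Mat3}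
    (hA : ∀ i j, ContDiffOn ℝ n (fun x => A x i j) Ω) :
    ContDiffOn ℝ n (fun x => (A x).trace) Ω :=
  ContDiffOn.sum fun k _ => hA k k

theorem contDiffOn_bulkDeriv {n : WithTop ℕ∞} {Ω : Set E3} {Q : E3 → Mat3}
    (hQ : ∀ i j, ContDiffOn ℝ n (fun x => Q x i j) Ω) (t : ℝ) (E : Mat3) :
    ContDiffOn ℝ n (fun x => bulkDeriv t (Q x) E) Ω := by
  have h1 := contDiffOn_trace (contDiffOn_mul_apply hQ (B := fun _ => E) fun _ _ => contDiffOn_const)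
  have hsq := contDiffOn_mul_apply hQ hQ
  have h2 := contDiffOn_trace (contDiffOn_mul_apply hsq (B := fun _ => E) fun _ _ => contDiffOn_const)
  have h3 := contDiffOn_trace hsq
  unfold bulkDeriv
  simp only [pow_two]
  exact (h1.neg.sub (contDiffOn_const.mul h2)).add ((contDiffOn_const.mul h3).mul h1)

/-- The orthogonal projection to `S₀` of the matrix unit `e_ij`. -/
noncomputable def projUnit (i j : Fin 3) : Mat3 :=
  (1 / 2 : ℝ) • (Matrix.single i j 1 + Matrix.single j i 1) -
    (if i = j then (1 / 3 : ℝ) else 0) • (1 : Mat3)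

theorem projUnit_mem_S0 (i j : Fin 3) : projUnit i j ∈ S0 := by
  constructor
  · unfold projUnit Matrix.IsSymm
    rw [Matrix.transpose_sub, Matrix.transpose_smul, Matrix.transpose_smul, Matrix.transpose_add,
      Matrix.transpose_single, Matrix.transpose_single, Matrix.transpose_one, add_comm]
  · unfold projUnit
    rw [Matrix.trace_sub, Matrix.trace_smul, Matrix.trace_smul, Matrix.trace_add, Matrix.trace_one]
    by_cases h : i = j
    · subst h
      rw [Matrix.trace_single_eq_same]
      norm_num
    · rw [Matrix.trace_single_eq_of_ne _ _ _ h, Matrix.trace_single_eq_of_ne _ _ _ (Ne.symm h)]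
      simp [h]

/-- Pairing an element of S₀ with the projection of e_ij is the same as pairing it with e_ij. This
separates the Euler-Lagrange system into scalar equations, one for each entry. -/
theorem sum_projUnit_mul {A : Mat3} (hA : A ∈ S0) (i j : Fin 3) :
    ∑ a, ∑ b, projUnit i j a b * A a b = A i j := by
  have hs := hA.1.apply
  have ht : A 0 0 + A 1 1 + A 2 2 = 0 := by
    have := hA.2
    rwa [Matrix.trace, Fin.sum_univ_three] at this
  have h10 := hs 1 0
  have h20 := hs 2 0
  have h21 := hs 2 1
  fin_cases i <;> fin_cases j <;>
    simp [projUnit, Fin.sum_univ_three, Matrix.single_apply, Matrix.one_apply] <;> linarith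

theorem IsUniaxialOn.mem_S0 {Q : E3 → Mat3} {Ω : Set E3} (h : IsUniaxialOn Q Ω) {x : E3}
    (hx : x ∈ Ω) : Q x ∈ S0 := by
  obtain ⟨s, n, hsn⟩ := h
  rw [(hsn x hx).2]
  exact uniaxial_mem_S0 _ (hsn x hx).1

theorem weak_poisson_entry {t R : ℝ} (ht : 0 < t) {Q : E3 → Mat3}
    {G : Fin 3 → Fin 3 → Fin 3 → E3 → ℝ} (hQ : IsAdmissible R Q G)
    (hmin : ∀ P H, IsAdmissible R P H → energy t R Q G ≤ energy t R P H)
    (hcont : ContinuousOn Q (ball 0 R)) (hS : ∀ x ∈ ball 0 R, Q x ∈ S0) (i j : Fin 3) {φ : E3 → ℝ}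
    (hφ : IsTest (ball 0 R) φ) :
    ∫ x in ball 0 R, Q x i j * ∑ k, pd k (pd k φ) x =
      ∫ x in ball 0 R, bulkDeriv t (Q x) (projUnit i j) * φ x := by
  rw [← euler_lagrange ht hQ hmin hcont (projUnit_mem_S0 i j) hφ]
  have hint : ∀ a b, Integrable (fun x => Q x a b * ∑ k, pd k (pd k φ) x)
      (volume.restrict (ball 0 R)) := by
    intro a b
    simp only [Finset.mul_sum]
    exact integrable_finsetSum _ fun k _ => ((hφ.pd k).pd k).integrable_mul (hQ.memW12 a b).memLp
  have e : ∫ x in ball 0 R, Q x i j * ∑ k, pd k (pd k φ) x =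
      ∫ x in ball 0 R, ∑ a, ∑ b, projUnit i j a b * (Q x a b * ∑ k, pd k (pd k φ) x) := by
    refine setIntegral_congr_fun measurableSet_ball fun x hx => ?_
    simp only [← mul_assoc, ← Finset.sum_mul]
    rw [sum_projUnit_mul (hS x hx)]
  rw [e]
  refine (integral_finsetSum _ fun a _ => integrable_finsetSum _ fun b _ =>
    (hint a b).const_mul _).trans (Finset.sum_congr rfl fun a _ => ?_)
  refine (integral_finsetSum _ fun b _ => (hint a b).const_mul _).trans ?_
  exact Finset.sum_congr rfl fun b _ => integral_const_mul _ _

/-- Interior regularity for the Poisson equation on a ball. -/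
theorem contDiffOn_ball_of_weak_poisson {u F : E3 → ℝ} {R : ℝ} (hu : ContinuousOn u (ball 0 R))
    {n : ℕ} (hF : ContDiffOn ℝ n F (ball 0 R))
    (hw : ∀ φ, IsTest (ball 0 R) φ →
      ∫ x in ball 0 R, u x * ∑ k, pd k (pd k φ) x = ∫ x in ball 0 R, F x * φ x) :
    ContDiffOn ℝ (n + 1) u (ball 0 R) := by
  intro x hx
  have hxR : ‖x‖ < R := by simpa using hx
  obtain ⟨ρ, hρ1, hρ2⟩ := exists_between hxR
  have hρ0 : 0 < ρ := (norm_nonneg x).trans_lt hρ1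
  -- Multiplication by χ gives u and F compact support. Since χ = 1 on the smaller ball, the weak
  -- equation is unchanged for test functions supported there.
  set χ : ContDiffBump (0 : E3) := ⟨ρ, (ρ + R) / 2, hρ0, by linarith⟩
  have hχs : tsupport χ ⊆ ball 0 R := by
    rw [χ.tsupport_eq]
    exact closedBall_subset_ball (by change (ρ + R) / 2 < R; linarith)
  have hχ1 : ∀ y ∈ ball (0 : E3) ρ, χ y = 1 := fun y hy =>
    χ.one_of_mem_closedBall (ball_subset_closedBall hy)
  have hsub : ball (0 : E3) ρ ⊆ ball 0 R := ball_subset_ball hρ2.le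
  have key := contDiffOn_of_weak_poisson (u := fun y => u y * χ y) (F := fun y => F y * χ y)
    (n := n) (ρ := ρ)
    (continuous_mul_of_tsupport_subset isOpen_ball hu χ.continuous hχs)
    (χ.hasCompactSupport.mul_left)
    (contDiff_mul_of_tsupport_subset isOpen_ball hF χ.contDiff hχs)
    (χ.hasCompactSupport.mul_left) ?_
  · refine ((key.congr fun y hy => ?_).contDiffAt (isOpen_ball.mem_nhds ?_)).contDiffWithinAt
    · rw [hχ1 y hy, mul_one]
    · simpa using hρ1
  · intro φ hφ
    have hφR : IsTest (ball 0 R) φ := ⟨hφ.1, hφ.2.1, hφ.2.2.trans hsub⟩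
    have hφ0 : ∀ y ∉ ball (0 : E3) ρ, φ y = 0 := fun y hy =>
      image_eq_zero_of_notMem_tsupport fun h => hy (hφ.2.2 h)
    have hφ2 : ∀ k, ∀ y ∉ ball (0 : E3) ρ, pd k (pd k φ) y = 0 := fun k y hy =>
      image_eq_zero_of_notMem_tsupport fun h => hy (((hφ.pd k).pd k).2.2 h)
    have h1 : ∫ y, u y * χ y * ∑ k, pd k (pd k φ) y =
        ∫ y in ball 0 R, u y * ∑ k, pd k (pd k φ) y := by
      rw [setIntegral_eq_integral_of_forall_compl_eq_zero]
      · congr 1 with y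
        by_cases hy : y ∈ ball (0 : E3) ρ
        · rw [hχ1 y hy, mul_one]
        · simp [hφ2 _ y hy]
      · intro y hy
        simp [hφ2 _ y fun h => hy (hsub h)]
    have h2 : ∫ y, F y * χ y * φ y = ∫ y in ball 0 R, F y * φ y := by
      rw [setIntegral_eq_integral_of_forall_compl_eq_zero]
      · congr 1 with y
        by_cases hy : y ∈ ball (0 : E3) ρ
        · rw [hχ1 y hy, mul_one]
        · simp [hφ0 y hy]
      · intro y hy
        simp [hφ0 y fun h => hy (hsub h)]
    rw [h1, h2, hw φ hφR]

/-- A `C²` weak solution of the Poisson equation is a classical solution. -/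
theorem laplacian_eq_of_weak_poisson {u F : E3 → ℝ} {Ω : Set E3} (hΩ : IsOpen Ω)
    (hu : ContDiffOn ℝ 2 u Ω) (hF : ContinuousOn F Ω)
    (hw : ∀ φ, IsTest Ω φ → ∫ x in Ω, u x * ∑ k, pd k (pd k φ) x = ∫ x in Ω, F x * φ x) :
    Set.EqOn (fun x => ∑ k, pd k (pd k u) x) F Ω := by
  have hu1 : ContDiffOn ℝ 1 u Ω := hu.of_le (by norm_num)
  have hp : ∀ k, ContDiffOn ℝ 1 (pd k u) Ω := fun k => contDiffOn_pd hΩ hu (by norm_num) k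
  have hpp : ∀ k, ContinuousOn (pd k (pd k u)) Ω := fun k =>
    contDiffOn_zero.1 (contDiffOn_pd hΩ (hp k) (by norm_num) k)
  have hL : ContinuousOn (fun x => ∑ k, pd k (pd k u) x) Ω := continuousOn_finsetSum _ fun k _ => hpp k
  refine Measure.eqOn_open_of_ae_eq (μ := volume) ?_ hΩ hL hF
  have hae := hΩ.ae_eq_zero_of_integral_contDiff_smul_eq_zero (μ := volume)
    ((hL.sub hF).locallyIntegrableOn hΩ.measurableSet) ?_
  · rw [EventuallyEq, ae_restrict_iff' hΩ.measurableSet]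
    filter_upwards [hae] with x hx hxΩ
    have := hx hxΩ
    simp only [Pi.sub_apply] at this
    linarith
  · intro φ h1 h2 h3
    have hφ : IsTest Ω φ := ⟨h1, h2, h3⟩
    have e1 : ∫ x, φ x • ((fun x => ∑ k, pd k (pd k u) x) - F) x =
        ∫ x in Ω, ((∑ k, pd k (pd k u) x) * φ x - F x * φ x) := by
      rw [setIntegral_eq_integral_of_forall_compl_eq_zero]
      · congr 1 with x
        simp only [Pi.sub_apply, smul_eq_mul]
        ring
      · intro x hx
        simp [image_eq_zero_of_notMem_tsupport fun h => hx (h3 h)]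
    have hi : ∀ {f : E3 → ℝ}, ContinuousOn f Ω → IntegrableOn (fun x => f x * φ x) Ω := fun hf =>
      (integrable_mul_of_tsupport_subset hΩ hf h1.continuous h2 h3).integrableOn
    have hi2 : ∀ {f ψ : E3 → ℝ}, ContinuousOn f Ω → IsTest Ω ψ →
        IntegrableOn (fun x => f x * ψ x) Ω := fun hf hψ =>
      (integrable_mul_of_tsupport_subset hΩ hf hψ.1.continuous hψ.2.1 hψ.2.2).integrableOn
    rw [e1, integral_sub (hi hL) (hi hF), ← hw φ hφ, sub_eq_zero]
    simp only [Finset.mul_sum, Finset.sum_mul]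
    rw [integral_finsetSum _ fun k _ => hi (hpp k),
      integral_finsetSum _ fun k _ => hi2 hu.continuousOn ((hφ.pd k).pd k)]
    refine Finset.sum_congr rfl fun k _ => ?_
    rw [setIntegral_mul_pd hΩ hu1 (hφ.pd k).isC1Test k, setIntegral_mul_pd hΩ (hp k) hφ.isC1Test k,
      neg_neg]

theorem bulkDeriv_zero (t : ℝ) (E : Mat3) : bulkDeriv t 0 E = 0 := by
  simp [bulkDeriv]

/-- Bootstrap: the right-hand side is polynomial in Q, so it has the regularity of Q, and each
Poisson step gains one derivative. The polynomial has no constant term; hence Q(0) = 0 gives ΔQ(0) =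
0, the tracelessness of the Hessians used in the flux. -/
theorem minimizer_regularity {t R : ℝ} (ht : 0 < t) (hR : 0 < R) {Q : E3 → Mat3}
    {G : Fin 3 → Fin 3 → Fin 3 → E3 → ℝ} (hQ : IsAdmissible R Q G)
    (hmin : ∀ P H, IsAdmissible R P H → energy t R Q G ≤ energy t R P H)
    (hcont : ContinuousOn Q (ball 0 R)) (hS : ∀ x ∈ ball 0 R, Q x ∈ S0) (hzero : Q 0 = 0) :
    (∀ i j, ContDiffOn ℝ 2 (fun x => Q x i j) (ball 0 R)) ∧
    ∀ i j, ∑ k, pd k (pd k fun x => Q x i j) 0 = 0 := by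
  have hc0 : ∀ i j, ContinuousOn (fun x => Q x i j) (ball 0 R) := fun i j =>
    (continuous_apply_apply i j).comp_continuousOn hcont
  have h1 : ∀ i j, ContDiffOn ℝ 1 (fun x => Q x i j) (ball 0 R) := by
    intro i j
    have hF := contDiffOn_bulkDeriv (n := 0) (fun a b => contDiffOn_zero.2 (hc0 a b)) t
      (projUnit i j)
    have := contDiffOn_ball_of_weak_poisson (n := 0) (hc0 i j) hF
      (fun φ hφ => weak_poisson_entry ht hQ hmin hcont hS i j hφ)
    simpa using this
  have hF1 : ∀ i j, ContDiffOn ℝ 1 (fun x => bulkDeriv t (Q x) (projUnit i j)) (ball 0 R) :=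
    fun i j => contDiffOn_bulkDeriv h1 t _
  have h2 : ∀ i j, ContDiffOn ℝ 2 (fun x => Q x i j) (ball 0 R) := by
    intro i j
    have := contDiffOn_ball_of_weak_poisson (n := 1) (hc0 i j) (by simpa using hF1 i j)
      (fun φ hφ => weak_poisson_entry ht hQ hmin hcont hS i j hφ)
    norm_num at this
    exact this
  refine ⟨h2, fun i j => ?_⟩
  have := laplacian_eq_of_weak_poisson isOpen_ball (h2 i j) (hF1 i j).continuousOn
    (fun φ hφ => weak_poisson_entry ht hQ hmin hcont hS i j hφ) (mem_ball_self hR)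
  simp only [hzero, bulkDeriv_zero] at this
  exact this

/-! ### The sign of a uniaxial minimizer -/

theorem pd_sum {ι : Type*} (s : Finset ι) {f : ι → E3 → ℝ} {x : E3}
    (hf : ∀ i ∈ s, DifferentiableAt ℝ (f i) x) (k : Fin 3) :
    pd k (fun y => ∑ i ∈ s, f i y) x = ∑ i ∈ s, pd k (f i) x := by
  simp only [pd]
  rw [fderiv_fun_sum hf]
  simp

/-- Cauchy–Schwarz: a derivative of |f|² is twice the inner product of f with its derivative. -/
theorem pd_sum_sq_le {f : Fin 3 → Fin 3 → E3 → ℝ} {x : E3}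
    (hf : ∀ i j, DifferentiableAt ℝ (f i j) x) (k : Fin 3) :
    pd k (fun y => ∑ i, ∑ j, f i j y ^ 2) x ^ 2 ≤
      4 * (∑ i, ∑ j, f i j x ^ 2) * ∑ i, ∑ j, pd k (f i j) x ^ 2 := by
  have h1 : ∀ i j, DifferentiableAt ℝ (fun y => f i j y ^ 2) x := fun i j => (hf i j).pow 2
  have h2 : ∀ i j, pd k (fun y => f i j y ^ 2) x = 2 * (f i j x * pd k (f i j) x) := by
    intro i j
    have := pd_comp (g := fun s => s ^ 2) (f := f i j) (x := x) (by fun_prop) (hf i j) k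
    rw [this]
    simp
    ring
  rw [pd_sum _ (fun i _ => by exact DifferentiableAt.fun_sum fun j _ => h1 i j)]
  have h3 : ∀ i, pd k (fun y => ∑ j, f i j y ^ 2) x = ∑ j, 2 * (f i j x * pd k (f i j) x) := by
    intro i
    rw [pd_sum _ (fun j _ => h1 i j)]
    exact Finset.sum_congr rfl fun j _ => h2 i j
  simp only [h3, ← Finset.mul_sum]
  have hcs := Finset.sum_mul_sq_le_sq_mul_sq (Finset.univ : Finset (Fin 3 × Fin 3))
    (fun p => f p.1 p.2 x) (fun p => pd k (f p.1 p.2) x)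
  simp only [Fintype.sum_prod_type] at hcs
  rw [mul_pow]
  linarith

/-- The quotient `a b / (a² + ε)`. -/
noncomputable def ratioFn (ε : ℝ) (a b : E3 → ℝ) (x : E3) : ℝ := a x * b x * (a x ^ 2 + ε)⁻¹

/-- Here a stands for |Q|² and b for |ψ|². The point is a bound uniform in ε: the gradient of the
cutoff multiplies Q, so only a|∇c|² must be controlled, and the hypotheses on `pd k a` and `pd k b`
absorb the division by a small a. -/
theorem ratioFn_pd_sq_le {ε : ℝ} (hε : 0 < ε) {a b : E3 → ℝ} {x : E3} (ha : DifferentiableAt ℝ a x)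
    (hb : DifferentiableAt ℝ b x) (ha0 : 0 < a x) (hb0 : 0 ≤ b x) (hc : ratioFn ε a b x ≤ 1 / 2)
    {k : Fin 3} {A B : ℝ} (hB0 : 0 ≤ B)
    (hA : pd k a x ^ 2 ≤ 4 * a x * A) (hB : pd k b x ^ 2 ≤ 4 * b x * B) :
    pd k (ratioFn ε a b) x ^ 2 * a x ≤ 15 * A + 6 * B := by
  have hw : 0 < a x ^ 2 + ε := by positivity
  have hd : DifferentiableAt ℝ (fun y => (a y ^ 2 + ε)⁻¹) x :=
    ((ha.pow 2).add_const ε).inv hw.ne'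
  have hg : HasDerivAt (fun s : ℝ => (s ^ 2 + ε)⁻¹) (-(2 * a x) / (a x ^ 2 + ε) ^ 2) (a x) := by
    have := ((hasDerivAt_pow 2 (a x)).add_const ε).inv hw.ne'
    refine this.congr_deriv ?_
    simp
  have h1 : pd k (fun y => (a y ^ 2 + ε)⁻¹) x = -(2 * a x) / (a x ^ 2 + ε) ^ 2 * pd k a x := by
    rw [pd_comp (g := fun s => (s ^ 2 + ε)⁻¹) hg.differentiableAt ha k, hg.deriv]
  have hab : DifferentiableAt ℝ (fun y => a y * b y) x := ha.mul hb
  have h2 : pd k (ratioFn ε a b) x = a x * b x * (-(2 * a x) / (a x ^ 2 + ε) ^ 2 * pd k a x) +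
      (a x * pd k b x + pd k a x * b x) * (a x ^ 2 + ε)⁻¹ := by
    unfold ratioFn
    rw [pd_mul hab hd, pd_mul ha hb, h1]
  rw [h2]
  set c := ratioFn ε a b x with hcdef
  have hc0 : 0 ≤ c := by simp only [hcdef, ratioFn]; positivity
  unfold ratioFn at hcdef
  set α := a x
  set β := b x
  set p := pd k a x
  set q := pd k b x
  set w := α ^ 2 + ε
  clear_value c α β p q
  have hαw : α ^ 2 / w ≤ 1 := by rw [div_le_one hw]; simp only [w]; linarith
  have hαw0 : 0 ≤ α ^ 2 / w := by positivity
  -- The quotient rule, rewritten through c. The squares of the three terms, times α, are at most A,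
  -- 2B and 4A, and (x + y + z)² ≤ 3(x² + y² + z²) yields 15A + 6B.
  set T₁ := c * p / α
  set T₂ := α * q / w
  set T₃ := -(2 * c * (α ^ 2 / w) * p / α)
  have e : α * β * (-(2 * α) / w ^ 2 * p) + (α * q + p * β) * w⁻¹ = T₁ + T₂ + T₃ := by
    simp only [T₁, T₂, T₃, hcdef]
    field_simp
    ring
  rw [e]
  have hc2 : c ^ 2 ≤ 1 / 4 := by nlinarith
  have hp : p ^ 2 / α ≤ 4 * A := by rw [div_le_iff₀ ha0]; linarith
  have hp0 : 0 ≤ p ^ 2 / α := by positivity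
  have b1 : T₁ ^ 2 * α ≤ A := by
    have : T₁ ^ 2 * α = c ^ 2 * (p ^ 2 / α) := by simp only [T₁]; field_simp
    rw [this]
    calc c ^ 2 * (p ^ 2 / α) ≤ 1 / 4 * (4 * A) := by gcongr
      _ = A := by ring
  have b3 : T₃ ^ 2 * α ≤ 4 * A := by
    have : T₃ ^ 2 * α = 4 * c ^ 2 * (α ^ 2 / w) ^ 2 * (p ^ 2 / α) := by
      simp only [T₃]; field_simp; ring
    rw [this]
    calc 4 * c ^ 2 * (α ^ 2 / w) ^ 2 * (p ^ 2 / α) ≤ 4 * (1 / 4) * 1 ^ 2 * (4 * A) := by gcongr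
      _ = 4 * A := by ring
  have b2 : T₂ ^ 2 * α ≤ 2 * B := by
    have : T₂ ^ 2 * α = α ^ 3 / w ^ 2 * q ^ 2 := by simp only [T₂]; field_simp
    rw [this]
    calc α ^ 3 / w ^ 2 * q ^ 2 ≤ α ^ 3 / w ^ 2 * (4 * β * B) := by gcongr
      _ = 4 * c * (α ^ 2 / w) * B := by rw [hcdef]; field_simp
      _ ≤ 4 * (1 / 2) * 1 * B := by gcongr
      _ = 2 * B := by ring
  have hsq : (T₁ + T₂ + T₃) ^ 2 ≤ 3 * (T₁ ^ 2 + T₂ ^ 2 + T₃ ^ 2) := by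
    nlinarith [sq_nonneg (T₁ - T₂), sq_nonneg (T₂ - T₃), sq_nonneg (T₁ - T₃)]
  calc (T₁ + T₂ + T₃) ^ 2 * α ≤ 3 * (T₁ ^ 2 + T₂ ^ 2 + T₃ ^ 2) * α := by gcongr
    _ = 3 * (T₁ ^ 2 * α + T₂ ^ 2 * α + T₃ ^ 2 * α) := by ring
    _ ≤ 15 * A + 6 * B := by linarith

/-- The upper threshold 1/2 lies below 3/4, the lower bound for the limiting flip ratio where tr Q³
< 0. Thus the cutoff is eventually 1 at almost every such point. -/
theorem exists_step : ∃ (τ : ℝ → ℝ) (C : ℝ), ContDiff ℝ ∞ τ ∧ (∀ s ≤ 1 / 4, τ s = 0) ∧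
    (∀ s, 1 / 2 ≤ s → τ s = 1) ∧ (∀ s, 0 ≤ τ s ∧ τ s ≤ 1) ∧ 0 ≤ C ∧ ∀ s ≤ 1 / 2, |deriv τ s| ≤ C := by
  set τ : ℝ → ℝ := fun s => Real.smoothTransition (4 * s - 1)
  have hτ : ContDiff ℝ ∞ τ := by
    have : ContDiff ℝ ∞ fun s : ℝ => 4 * s - 1 := by fun_prop
    exact Real.smoothTransition.contDiff.comp this
  have hc : Continuous (deriv τ) := hτ.continuous_deriv (by norm_num)
  obtain ⟨C, hC⟩ := (isCompact_Icc (a := (0 : ℝ)) (b := 1)).exists_bound_of_continuousOn hc.continuousOn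
  have h0 : ∀ s ≤ (1 / 4 : ℝ), τ s = 0 := fun s hs =>
    Real.smoothTransition.zero_of_nonpos (by linarith)
  refine ⟨τ, C, hτ, h0, fun s hs => Real.smoothTransition.one_of_one_le (by linarith),
    fun s => ⟨Real.smoothTransition.nonneg _, Real.smoothTransition.le_one _⟩,
    (norm_nonneg _).trans (hC 0 (by simp)), fun s hs => ?_⟩
  by_cases hs0 : 0 ≤ s
  · exact hC s ⟨hs0, by linarith⟩
  · have : τ =ᶠ[𝓝 s] fun _ => 0 := by
      filter_upwards [eventually_lt_nhds (show s < 1 / 4 by linarith)] with y hy using h0 y hy.le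
    rw [this.deriv_eq]
    simp only [deriv_const', abs_zero]
    exact (norm_nonneg _).trans (hC 0 (by simp))

theorem uniaxial_trace_relation {Q : E3 → Mat3} {Ω : Set E3} (h : IsUniaxialOn Q Ω) {x : E3}
    (hx : x ∈ Ω) : 6 * ((Q x) ^ 3).trace ^ 2 = normSq (Q x) ^ 3 := by
  have hS := h.mem_S0 hx
  obtain ⟨s, n, hsn⟩ := h
  obtain ⟨hn, hQ⟩ := hsn x hx
  rw [← trace_sq_eq_normSq hS, hQ, trace_uniaxial_cube _ hn, trace_uniaxial_sq _ hn]
  ring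

theorem trace_uniaxial_mul (s r : ℝ) {n m : E3} (hn : ‖n‖ = 1) (hm : ‖m‖ = 1) :
    (uniaxial s n * uniaxial r m).trace =
      s * r * ((n 0 * m 0 + n 1 * m 1 + n 2 * m 2) ^ 2 - 1 / 3) := by
  have h1 := norm_sq_eq_sum n
  have h2 := norm_sq_eq_sum m
  rw [hn] at h1
  rw [hm] at h2
  simp [uniaxial, Matrix.trace, Matrix.mul_apply, Fin.sum_univ_three, Matrix.vecMulVec_apply]
  linear_combination (s * r / 3) * h1 + (s * r / 3) * h2

/-- A uniaxial tensor with `s < 0` is far from the boundary datum. -/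
theorem normSq_sub_boundaryDatum_ge {Q : E3 → Mat3} {Ω : Set E3} (h : IsUniaxialOn Q Ω) {x : E3}
    (hx : x ∈ Ω) (hx0 : x ≠ 0) (hneg : ((Q x) ^ 3).trace < 0) :
    3 / 4 * normSq (Q x) ≤ normSq (Q x - boundaryDatum x) := by
  have hS := h.mem_S0 hx
  have hB := boundaryDatum_mem_S0 hx0
  have hS' : Q x - boundaryDatum x ∈ S0 := by
    have := S0_add hS (S0_smul (-1) hB)
    rwa [neg_one_smul, ← sub_eq_add_neg] at this
  rw [← trace_sq_eq_normSq hS, ← trace_sq_eq_normSq hS', sub_eq_add_neg, ← neg_one_smul ℝ,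
    trace_add_smul_sq]
  obtain ⟨s, n, hsn⟩ := h
  obtain ⟨hn, hQ⟩ := hsn x hx
  clear hsn
  generalize s x = s at hQ
  generalize n x = n at hQ hn
  have hν : ‖‖x‖⁻¹ • x‖ = 1 := by
    rw [norm_smul, norm_inv, norm_norm, inv_mul_cancel₀ (norm_ne_zero_iff.2 hx0)]
  rw [hQ, trace_uniaxial_cube _ hn] at hneg
  have hs : s < 0 := by
    by_contra hcon
    have hs0 := not_lt.1 hcon
    have : 0 ≤ s ^ 3 := by positivity
    linarith
  unfold boundaryDatum
  rw [hQ, trace_uniaxial_mul _ _ hn hν, trace_uniaxial_sq _ hn, trace_uniaxial_sq _ hν]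
  set d := (n 0 * (‖x‖⁻¹ • x) 0 + n 1 * (‖x‖⁻¹ • x) 1 + n 2 * (‖x‖⁻¹ • x) 2)
  set r := √(3 / 2 : ℝ)
  have hr : r ^ 2 = 3 / 2 := Real.sq_sqrt (by norm_num)
  have hr0 : 0 ≤ r := Real.sqrt_nonneg _
  have h1 : 0 ≤ -s * r * d ^ 2 := by
    have : 0 ≤ -s := by linarith
    positivity
  -- Because r² = 3/2, the difference of the two sides is exactly (sr/3 + 1)² - 2srd², and s < 0.
  nlinarith [sq_nonneg (s / 3 * r + 1)]

/-- When tr A³ ≤ 0 and |μ| ≤ 1, scaling by μ does not increase the cubic and quartic terms. Only the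
quadratic term can grow, by at most half of |A|². -/
theorem bulk_smul_le {t : ℝ} (ht : 0 < t) {A : Mat3} (hA : A ∈ S0) (hneg : (A ^ 3).trace ≤ 0)
    {μ : ℝ} (h0 : -1 ≤ μ) (h1 : μ ≤ 1) : bulk t (μ • A) - bulk t A ≤ 1 / 2 * normSq A := by
  have hh := hPlus_pos ht
  rw [← trace_sq_eq_normSq hA]
  have ha : 0 ≤ (A ^ 2).trace := by rw [trace_sq_eq_normSq hA]; exact normSq_nonneg A
  unfold bulk
  simp only [smul_pow, Matrix.trace_smul, smul_eq_mul]
  set a := (A ^ 2).trace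
  set b := (A ^ 3).trace
  have hK : 0 ≤ √6 * hPlus t / t := by positivity
  have hL : 0 ≤ hPlus t ^ 2 / (2 * t) := by positivity
  set K := √6 * hPlus t / t
  set L := hPlus t ^ 2 / (2 * t)
  have m2 : μ ^ 2 ≤ 1 := by nlinarith
  have m3 : μ ^ 3 ≤ 1 := by nlinarith [sq_nonneg μ]
  have e1 : 0 ≤ K * ((1 - μ ^ 3) * (-b)) := mul_nonneg hK (mul_nonneg (by linarith) (by linarith))
  have e2 : 0 ≤ L * ((1 - μ ^ 2) * (1 + μ ^ 2) * a ^ 2) :=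
    mul_nonneg hL (mul_nonneg (mul_nonneg (by linarith) (by positivity)) (sq_nonneg _))
  nlinarith [mul_nonneg (sq_nonneg μ) ha]

/-- Only the cubic term is odd, so the full flip changes the bulk energy by a multiple of tr A³.
This is the gain when that trace is negative. -/
theorem bulk_neg_sub (t : ℝ) (A : Mat3) :
    bulk t (A + (-2 : ℝ) • A) - bulk t A = 2 * (√6 * hPlus t / t) * (A ^ 3).trace := by
  have : A + (-2 : ℝ) • A = (-1 : ℝ) • A := by
    rw [← one_smul ℝ A, smul_smul, ← add_smul]; norm_num
  rw [this]
  unfold bulk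
  simp only [smul_pow, Matrix.trace_smul, smul_eq_mul]
  ring

theorem tendsto_integral_sq_of_eLpNorm {Ω : Set E3} {f : ℕ → E3 → ℝ}
    (hf : ∀ m, MemLp (f m) 2 (volume.restrict Ω))
    (h : Tendsto (fun m => eLpNorm (f m) 2 (volume.restrict Ω)) atTop (𝓝 0)) :
    Tendsto (fun m => ∫ x in Ω, f m x ^ 2) atTop (𝓝 0) := by
  have h1 : ∀ m, (eLpNorm (f m) 2 (volume.restrict Ω)).toReal ^ 2 = ∫ x in Ω, f m x ^ 2 := by
    intro m
    have hnn : 0 ≤ ∫ x in Ω, f m x ^ 2 := integral_nonneg fun x => sq_nonneg _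
    rw [(hf m).eLpNorm_eq_integral_rpow_norm (by norm_num) (by norm_num)]
    simp only [ENNReal.toReal_ofNat, Real.rpow_ofNat, Real.norm_eq_abs, sq_abs]
    rw [ENNReal.toReal_ofReal (by positivity), ← Real.rpow_mul_natCast hnn]
    norm_num
  have h2 := (((ENNReal.tendsto_toReal (by simp)).comp h).pow 2)
  simp only [ENNReal.toReal_zero, ne_eq, OfNat.ofNat_ne_zero, not_false_eq_true, zero_pow] at h2
  exact h2.congr h1

/-- Test functions converging in `W^{1,2}` and almost everywhere to a function in `W^{1,2}_0`. -/
theorem MemW12Zero.exists_seq {Ω : Set E3} {u : E3 → ℝ} {g : Fin 3 → E3 → ℝ}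
    (h : MemW12Zero Ω u g) : ∃ φ : ℕ → E3 → ℝ, (∀ m, IsTest Ω (φ m)) ∧
      (∀ᵐ x ∂(volume.restrict Ω), Tendsto (fun m => φ m x) atTop (𝓝 (u x))) ∧
      ∀ k, Tendsto (fun m => ∫ x in Ω, (g k x - pd k (φ m) x) ^ 2) atTop (𝓝 0) := by
  obtain ⟨φ, hφ, h0, h1⟩ := h.approx
  have hm : TendstoInMeasure (volume.restrict Ω) φ atTop u := by
    refine tendstoInMeasure_of_tendsto_eLpNorm (p := 2) (by norm_num)
      (fun m => (hφ m).1.continuous.aestronglyMeasurable) h.memLp.aestronglyMeasurable ?_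
    refine h0.congr fun m => ?_
    rw [eLpNorm_sub_comm]
    rfl
  obtain ⟨ns, hns, hae⟩ := hm.exists_seq_tendsto_ae
  refine ⟨fun m => φ (ns m), fun m => hφ _, hae, fun k => ?_⟩
  have := tendsto_integral_sq_of_eLpNorm (fun m => (h.memLp_grad k).sub
    (memLp_of_continuous_compact ((hφ m).pd k).1.continuous ((hφ m).pd k).2.1 2)) (h1 k)
  exact this.comp hns.tendsto_atTop

/-! ### The cutoff flip on the set where tr Q³ < 0 -/

/-- The set where the uniaxial tensor `Q` has negative scalar order parameter. -/
def negSet (Q : E3 → Mat3) (Ω : Set E3) : Set E3 := {x ∈ Ω | ((Q x) ^ 3).trace < 0}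

theorem isOpen_negSet {Q : E3 → Mat3} {Ω : Set E3} (hΩ : IsOpen Ω) (hQ : ContinuousOn Q Ω) :
    IsOpen (negSet Q Ω) := by
  have : ContinuousOn (fun x => ((Q x) ^ 3).trace) Ω :=
    (show Continuous fun A : Mat3 => (A ^ 3).trace by fun_prop).comp_continuousOn hQ
  exact this.isOpen_inter_preimage hΩ isOpen_Iio

/-- The ratio which controls the cutoff of the flip of `Q` on `negSet Q Ω`. -/
noncomputable def flipRatio (ε : ℝ) (Q : E3 → Mat3) (ψ : Fin 3 → Fin 3 → E3 → ℝ) : E3 → ℝ :=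
  ratioFn ε (fun x => normSq (Q x)) (fun x => ∑ i, ∑ j, ψ i j x ^ 2)

/-- The cutoff function of the flip. -/
noncomputable def flipCutoff (τ : ℝ → ℝ) (ε : ℝ) (Q : E3 → Mat3) (ψ : Fin 3 → Fin 3 → E3 → ℝ) (Ω : Set E3) :
    E3 → ℝ :=
  (negSet Q Ω).indicator fun x => τ (flipRatio ε Q ψ x)

section

variable {Ω : Set E3} {Q : E3 → Mat3} {ψ : Fin 3 → Fin 3 → E3 → ℝ} {ε : ℝ} {τ : ℝ → ℝ}

theorem contDiffOn_flipRatio (hε : 0 < ε)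
    (hQ1 : ∀ i j, ContDiffOn ℝ 1 (fun x => Q x i j) Ω) (hψ : ∀ i j, IsTest Ω (ψ i j)) :
    ContDiffOn ℝ 1 (flipRatio ε Q ψ) Ω := by
  have h1 : ContDiffOn ℝ 1 (fun x => normSq (Q x)) Ω :=
    ContDiffOn.sum fun i _ => ContDiffOn.sum fun j _ => (hQ1 i j).pow 2
  have h2 : ContDiffOn ℝ 1 (fun x => ∑ i, ∑ j, ψ i j x ^ 2) Ω :=
    ContDiffOn.sum fun i _ => ContDiffOn.sum fun j _ => ((hψ i j).isC1Test.contDiff.contDiffOn).pow 2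
  exact (h1.mul h2).mul (((h1.pow 2).add contDiffOn_const).inv fun x _ => by positivity)

theorem flipCutoff_eventuallyEq_of_mem (hΩ : IsOpen Ω) (hQ : ContinuousOn Q Ω) {x : E3}
    (hx : x ∈ negSet Q Ω) :
    flipCutoff τ ε Q ψ Ω =ᶠ[𝓝 x] fun y => τ (flipRatio ε Q ψ y) := by
  filter_upwards [(isOpen_negSet hΩ hQ).mem_nhds hx] with y hy
  exact Set.indicator_of_mem hy _

/-- No jump occurs across the boundary of the negative set. At a point with tr Q³ = 0 the uniaxial
identity gives Q = 0, so the ratio vanishes there and stays below 1/4 nearby; at a point with tr Q³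
> 0 the negative set is avoided locally. -/
theorem flipCutoff_eventuallyEq_of_notMem (hΩ : IsOpen Ω) (hε : 0 < ε) (hQ : ContinuousOn Q Ω)
    (hQ1 : ∀ i j, ContDiffOn ℝ 1 (fun x => Q x i j) Ω) (hψ : ∀ i j, IsTest Ω (ψ i j))
    (hrel : ∀ x ∈ Ω, 6 * ((Q x) ^ 3).trace ^ 2 = normSq (Q x) ^ 3)
    (hτ : ∀ s ≤ 1 / 4, τ s = 0) {x : E3} (hx : x ∈ Ω) (hxU : x ∉ negSet Q Ω) :
    flipCutoff τ ε Q ψ Ω =ᶠ[𝓝 x] fun _ => 0 := by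
  have hb0 : 0 ≤ ((Q x) ^ 3).trace := not_lt.1 fun h => hxU ⟨hx, h⟩
  rcases hb0.eq_or_lt with h0 | hpos
  · have ha : normSq (Q x) = 0 := by
      have := hrel x hx
      rw [← h0] at this
      simpa using this.symm
    have hc : flipRatio ε Q ψ x = 0 := by simp [flipRatio, ratioFn, ha]
    have hcont : ContinuousAt (flipRatio ε Q ψ) x :=
      (contDiffOn_flipRatio hε hQ1 hψ).continuousOn.continuousAt (hΩ.mem_nhds hx)
    have := hcont.tendsto.eventually_lt_const (u := 1 / 4) (by rw [hc]; norm_num)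
    filter_upwards [this] with y hy
    exact Set.indicator_apply_eq_zero.2 fun _ => hτ _ hy.le
  · have hcont : ContinuousAt (fun x => ((Q x) ^ 3).trace) x :=
      ((show Continuous fun A : Mat3 => (A ^ 3).trace by fun_prop).comp_continuousOn hQ).continuousAt
        (hΩ.mem_nhds hx)
    filter_upwards [hcont.tendsto.eventually_const_lt hpos] with y hy
    exact Set.indicator_of_notMem (fun h => absurd h.2 (not_lt.2 (le_of_lt hy))) _

/-- The ratio vanishes where all entries of ψ do, so the cutoff is supported in their compact
supports. Hence the flip does not change the boundary values. -/
theorem isC1Test_flipCutoff (hΩ : IsOpen Ω) (hε : 0 < ε) (hQ : ContinuousOn Q Ω)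
    (hQ1 : ∀ i j, ContDiffOn ℝ 1 (fun x => Q x i j) Ω) (hψ : ∀ i j, IsTest Ω (ψ i j))
    (hrel : ∀ x ∈ Ω, 6 * ((Q x) ^ 3).trace ^ 2 = normSq (Q x) ^ 3)
    (hτ : ∀ s ≤ 1 / 4, τ s = 0) (hτc : ContDiff ℝ ∞ τ) : IsC1Test Ω (flipCutoff τ ε Q ψ Ω) := by
  set K := ⋃ i, ⋃ j, tsupport (ψ i j)
  have hK : IsCompact K := isCompact_iUnion fun i => isCompact_iUnion fun j => (hψ i j).2.1.isCompact
  have hKs : K ⊆ Ω := Set.iUnion_subset fun i => Set.iUnion_subset fun j => (hψ i j).2.2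
  have hs : tsupport (flipCutoff τ ε Q ψ Ω) ⊆ K := by
    refine closure_minimal (fun x hx => ?_) hK.isClosed
    by_contra hxK
    apply hx
    have h0 : ∀ i j, ψ i j x = 0 := fun i j =>
      image_eq_zero_of_notMem_tsupport fun h => hxK (Set.mem_iUnion₂.2 ⟨i, j, h⟩)
    have : flipRatio ε Q ψ x = 0 := by simp [flipRatio, ratioFn, h0]
    refine Set.indicator_apply_eq_zero.2 fun _ => ?_
    rw [this]
    exact hτ 0 (by norm_num)
  refine ⟨contDiff_iff_contDiffAt.2 fun x => ?_, hK.of_isClosed_subset (isClosed_tsupport _) hs,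
    hs.trans hKs⟩
  by_cases hx : x ∈ Ω
  · by_cases hxU : x ∈ negSet Q Ω
    · refine ContDiffAt.congr_of_eventuallyEq ?_ (flipCutoff_eventuallyEq_of_mem hΩ hQ hxU)
      exact ((hτc.of_le (by exact_mod_cast le_top)).contDiffAt).comp x
        ((contDiffOn_flipRatio hε hQ1 hψ).contDiffAt (hΩ.mem_nhds hx))
    · exact contDiffAt_const.congr_of_eventuallyEq
        (flipCutoff_eventuallyEq_of_notMem hΩ hε hQ hQ1 hψ hrel hτ hx hxU)
  · refine (contDiffAt_const (c := (0 : ℝ))).congr_of_eventuallyEq ?_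
    exact notMem_tsupport_iff_eventuallyEq.1 fun h => hx (hKs (hs h))

theorem sum_rotate (f : Fin 3 → Fin 3 → Fin 3 → ℝ) :
    ∑ i, ∑ j, ∑ k, f i j k = ∑ k, ∑ i, ∑ j, f i j k := by
  simp only [Fin.sum_univ_three]; ring

/-- The pointwise estimate for the energy change under the flip. -/
theorem variation_flip_le {t : ℝ} (ht : 0 < t) (hΩ : IsOpen Ω) (hε : 0 < ε) (hQ : ContinuousOn Q Ω)
    (hQ1 : ∀ i j, ContDiffOn ℝ 1 (fun x => Q x i j) Ω) (hψ : ∀ i j, IsTest Ω (ψ i j))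
    (hS : ∀ x ∈ Ω, Q x ∈ S0)
    (hrel : ∀ x ∈ Ω, 6 * ((Q x) ^ 3).trace ^ 2 = normSq (Q x) ^ 3)
    (hτ : ∀ s ≤ 1 / 4, τ s = 0) (hτ1 : ∀ s, 1 / 2 ≤ s → τ s = 1) (hτb : ∀ s, 0 ≤ τ s ∧ τ s ≤ 1)
    (hτc : ContDiff ℝ ∞ τ) {C : ℝ} (hτd : ∀ s ≤ 1 / 2, |deriv τ s| ≤ C)
    {G D : Fin 3 → Fin 3 → Fin 3 → E3 → ℝ} {x : E3} (hx : x ∈ Ω)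
    (hG : ∀ i j k, G i j k x = pd k (fun y => Q y i j) x) :
    variation t Q G (fun y => (-2 * flipCutoff τ ε Q ψ Ω y) • Q y) x ≤
      {y ∈ negSet Q Ω | flipRatio ε Q ψ y ≤ 1 / 2}.indicator (fun y =>
        (1 + 60 * C ^ 2) * (∑ i, ∑ j, ∑ k, G i j k y ^ 2) +
          48 * C ^ 2 * (∑ i, ∑ j, ∑ k, D i j k y ^ 2) + 1 / 2 * normSq (Q y)) x +
      48 * C ^ 2 * (∑ i, ∑ j, ∑ k, (D i j k x - pd k (ψ i j) x) ^ 2) +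
      {y ∈ negSet Q Ω | 1 / 2 < flipRatio ε Q ψ y}.indicator (fun y =>
        2 * (√6 * hPlus t / t) * ((Q y) ^ 3).trace) x := by
  set θ := flipCutoff τ ε Q ψ Ω
  have hrest : 0 ≤ 48 * C ^ 2 * (∑ i, ∑ j, ∑ k, (D i j k x - pd k (ψ i j) x) ^ 2) := by positivity
  have hent : ∀ i j, (fun y => ((-2 * θ y) • Q y) i j) = fun y => -2 * θ y * Q y i j := by
    intro i j; funext y; simp
  have hQd : ∀ i j, DifferentiableAt ℝ (fun y => Q y i j) x := fun i j =>
    ((hQ1 i j).contDiffAt (hΩ.mem_nhds hx)).differentiableAt (by norm_num)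
  by_cases hxU : x ∈ negSet Q Ω
  · have hev := flipCutoff_eventuallyEq_of_mem (τ := τ) (ε := ε) (ψ := ψ) hΩ hQ hxU
    have hcd : ContDiffAt ℝ 1 (flipRatio ε Q ψ) x :=
      (contDiffOn_flipRatio hε hQ1 hψ).contDiffAt (hΩ.mem_nhds hx)
    -- The transition zone carries the whole cost. Its constants are 60 = 4 · 15 and 48 = 4 · 6 · 2,
    -- the last factor 2 coming from replacing ∇ψ by its L² limit D plus the error.
    by_cases hc : flipRatio ε Q ψ x ≤ 1 / 2
    · have hm1 : x ∈ {y ∈ negSet Q Ω | flipRatio ε Q ψ y ≤ 1 / 2} := ⟨hxU, hc⟩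
      have hm2 : x ∉ {y ∈ negSet Q Ω | 1 / 2 < flipRatio ε Q ψ y} := fun h => absurd h.2 (not_lt.2 hc)
      rw [Set.indicator_of_mem hm1, Set.indicator_of_notMem hm2, add_zero]
      have hθx : θ x = τ (flipRatio ε Q ψ x) := hev.eq_of_nhds
      have hθd : DifferentiableAt ℝ θ x :=
        (((hτc.differentiable (by norm_num)) _).comp x
          (hcd.differentiableAt (by norm_num))).congr_of_eventuallyEq hev
      have hpθ : ∀ k, pd k θ x = deriv τ (flipRatio ε Q ψ x) * pd k (flipRatio ε Q ψ) x := by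
        intro k
        have : pd k θ x = pd k (fun y => τ (flipRatio ε Q ψ y)) x := by
          simp only [pd]; rw [hev.fderiv_eq]
        rw [this, pd_comp ((hτc.differentiable (by norm_num)) _)
          (hcd.differentiableAt (by norm_num))]
      have hpp : ∀ i j k, pd k (fun y => -2 * θ y * Q y i j) x =
          -2 * θ x * G i j k x - 2 * pd k θ x * Q x i j := by
        intro i j k
        rw [pd_mul (hθd.const_mul (-2)) (hQd i j), pd_const_mul _ hθd, hG]
        ring
      have ha0 : 0 < normSq (Q x) := by
        refine (normSq_nonneg _).lt_of_ne fun h => ?_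
        have h1 := hrel x hx
        rw [← h] at h1
        have h2 := hxU.2
        have : ((Q x) ^ 3).trace = 0 := by simpa using h1
        linarith
      have hψd : ∀ i j, DifferentiableAt ℝ (ψ i j) x := fun i j =>
        (hψ i j).1.differentiable (by norm_num) x
      have hcb : ∀ k, pd k θ x ^ 2 * normSq (Q x) ≤ C ^ 2 *
          (15 * (∑ i, ∑ j, G i j k x ^ 2) + 6 * ∑ i, ∑ j, pd k (ψ i j) x ^ 2) := by
        intro k
        have hda : DifferentiableAt ℝ (fun y => normSq (Q y)) x :=
          DifferentiableAt.fun_sum fun i _ => DifferentiableAt.fun_sum fun j _ => (hQd i j).pow 2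
        have hdb : DifferentiableAt ℝ (fun x => ∑ i, ∑ j, ψ i j x ^ 2) x :=
          DifferentiableAt.fun_sum fun i _ => DifferentiableAt.fun_sum fun j _ => (hψd i j).pow 2
        have hb0 : 0 ≤ ∑ i, ∑ j, ψ i j x ^ 2 :=
          Finset.sum_nonneg fun _ _ => Finset.sum_nonneg fun _ _ => sq_nonneg _
        have hB0 : 0 ≤ ∑ i, ∑ j, pd k (ψ i j) x ^ 2 :=
          Finset.sum_nonneg fun _ _ => Finset.sum_nonneg fun _ _ => sq_nonneg _
        have hA := pd_sum_sq_le (f := fun i j y => Q y i j) hQd k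
        have hB := pd_sum_sq_le (f := ψ) hψd k
        simp only [← hG] at hA
        have := ratioFn_pd_sq_le hε hda hdb ha0 hb0 hc (k := k) hB0 hA hB
        have hd2 : deriv τ (flipRatio ε Q ψ x) ^ 2 ≤ C ^ 2 := by
          rw [← sq_abs]
          gcongr
          exact hτd _ hc
        have h0 : 0 ≤ pd k (flipRatio ε Q ψ) x ^ 2 * normSq (Q x) := by
          have := normSq_nonneg (Q x); positivity
        rw [hpθ, mul_pow, mul_assoc]
        calc deriv τ (flipRatio ε Q ψ x) ^ 2 * (pd k (flipRatio ε Q ψ) x ^ 2 * normSq (Q x))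
            ≤ C ^ 2 * (pd k (flipRatio ε Q ψ) x ^ 2 * normSq (Q x)) := by gcongr
          _ ≤ _ := by gcongr; exact this
      have hθb := hτb (flipRatio ε Q ψ x)
      rw [← hθx] at hθb
      -- The new gradient is (1 - 2θ)∇Q - 2Q∇θ with |1 - 2θ| ≤ 1. Its half square is at most |∇Q|² +
      -- 4|Q|²|∇θ|².
      have hgrad : (∑ i, ∑ j, ∑ k, (G i j k x * pd k (fun y => ((-2 * θ y) • Q y) i j) x +
          (1 / 2) * pd k (fun y => ((-2 * θ y) • Q y) i j) x ^ 2)) ≤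
          (∑ i, ∑ j, ∑ k, G i j k x ^ 2) + 4 * ∑ k, pd k θ x ^ 2 * normSq (Q x) := by
        have e : (∑ i, ∑ j, ∑ k, G i j k x ^ 2) + 4 * ∑ k, pd k θ x ^ 2 * normSq (Q x) =
            ∑ i, ∑ j, ∑ k, (G i j k x ^ 2 + 4 * (pd k θ x ^ 2 * Q x i j ^ 2)) := by
          simp only [normSq, Fin.sum_univ_three]
          ring
        rw [e]
        refine Finset.sum_le_sum fun i _ => Finset.sum_le_sum fun j _ =>
          Finset.sum_le_sum fun k _ => ?_
        rw [hent, hpp]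
        have h1 : (1 - 2 * θ x) ^ 2 ≤ 1 := by nlinarith [hθb.1, hθb.2]
        have h2 : (1 - 2 * θ x) ^ 2 * G i j k x ^ 2 ≤ 1 * G i j k x ^ 2 := by gcongr
        nlinarith [sq_nonneg ((1 - 2 * θ x) * G i j k x + 2 * pd k θ x * Q x i j),
          sq_nonneg (G i j k x)]
      have hbulk : bulk t (Q x + (-2 * θ x) • Q x) - bulk t (Q x) ≤ 1 / 2 * normSq (Q x) := by
        have : Q x + (-2 * θ x) • Q x = (1 - 2 * θ x) • Q x := by
          rw [sub_smul, one_smul, sub_eq_add_neg, ← neg_smul]; ring_nf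
        rw [this]
        exact bulk_smul_le ht (hS x hx) hxU.2.le (by linarith [hθb.2]) (by linarith [hθb.1])
      have hsum : ∑ k, pd k θ x ^ 2 * normSq (Q x) ≤ C ^ 2 *
          (15 * (∑ i, ∑ j, ∑ k, G i j k x ^ 2) + 6 * ∑ i, ∑ j, ∑ k, pd k (ψ i j) x ^ 2) := by
        refine (Finset.sum_le_sum fun k _ => hcb k).trans_eq ?_
        rw [sum_rotate, sum_rotate fun i j k => pd k (ψ i j) x ^ 2, ← Finset.mul_sum,
          Finset.sum_add_distrib, ← Finset.mul_sum, ← Finset.mul_sum]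
      have hψD : ∑ i, ∑ j, ∑ k, pd k (ψ i j) x ^ 2 ≤ 2 * (∑ i, ∑ j, ∑ k, D i j k x ^ 2) +
          2 * ∑ i, ∑ j, ∑ k, (D i j k x - pd k (ψ i j) x) ^ 2 := by
        simp only [Finset.mul_sum, ← Finset.sum_add_distrib]
        refine Finset.sum_le_sum fun i _ => Finset.sum_le_sum fun j _ =>
          Finset.sum_le_sum fun k _ => ?_
        nlinarith [sq_nonneg (2 * D i j k x - pd k (ψ i j) x)]
      have hψD' := mul_le_mul_of_nonneg_left hψD (sq_nonneg C)
      unfold variation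
      linarith
    · have hc' : 1 / 2 < flipRatio ε Q ψ x := not_le.1 hc
      have hm1 : x ∉ {y ∈ negSet Q Ω | flipRatio ε Q ψ y ≤ 1 / 2} := fun h => hc h.2
      have hm2 : x ∈ {y ∈ negSet Q Ω | 1 / 2 < flipRatio ε Q ψ y} := ⟨hxU, hc'⟩
      rw [Set.indicator_of_notMem hm1, Set.indicator_of_mem hm2, zero_add]
      -- Beyond the threshold the cutoff is locally 1 and the variation is exactly Q ↦ -Q: the
      -- gradient energy is unchanged and only the cubic term contributes.
      have hone : θ =ᶠ[𝓝 x] fun _ => 1 := by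
        filter_upwards [hev, hcd.continuousAt.tendsto.eventually_const_lt hc'] with y h1 h2
        exact h1.trans (hτ1 _ h2.le)
      have hpp : ∀ i j k, pd k (fun y => ((-2 * θ y) • Q y) i j) x = -2 * G i j k x := by
        intro i j k
        have : (fun y => ((-2 * θ y) • Q y) i j) =ᶠ[𝓝 x] fun y => -2 * Q y i j := by
          rw [hent]
          filter_upwards [hone] with y hy
          rw [hy]; ring
        have h2 : pd k (fun y => ((-2 * θ y) • Q y) i j) x = pd k (fun y => -2 * Q y i j) x := by
          simp only [pd]; rw [this.fderiv_eq]
        rw [h2, pd_const_mul _ (hQd i j), hG]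
      have hθ1 : θ x = 1 := hone.eq_of_nhds
      unfold variation
      simp only [hpp]
      rw [hθ1, mul_one, bulk_neg_sub]
      have : ∀ i j k, G i j k x * (-2 * G i j k x) + 1 / 2 * (-2 * G i j k x) ^ 2 = 0 := by
        intro i j k; ring
      simp only [this, Finset.sum_const_zero, zero_add]
      linarith
  · have hm1 : x ∉ {y ∈ negSet Q Ω | flipRatio ε Q ψ y ≤ 1 / 2} := fun h => hxU h.1
    have hm2 : x ∉ {y ∈ negSet Q Ω | 1 / 2 < flipRatio ε Q ψ y} := fun h => hxU h.1
    rw [Set.indicator_of_notMem hm1, Set.indicator_of_notMem hm2, zero_add, add_zero]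
    have hz := flipCutoff_eventuallyEq_of_notMem (τ := τ) hΩ hε hQ hQ1 hψ hrel hτ hx hxU
    have hpp : ∀ i j k, pd k (fun y => ((-2 * θ y) • Q y) i j) x = 0 := by
      intro i j k
      have : (fun y => ((-2 * θ y) • Q y) i j) =ᶠ[𝓝 x] fun _ => 0 := by
        rw [hent]
        filter_upwards [hz] with y hy
        simp only [θ, hy]; ring
      simp only [pd]; rw [this.fderiv_eq]; simp
    have hθ0 : θ x = 0 := hz.eq_of_nhds
    unfold variation
    simp only [hpp]
    rw [hθ0]
    simpa using hrest

end

theorem tendsto_flipRatio {ε : ℕ → ℝ} (hε : Tendsto ε atTop (𝓝 0)) {Q : E3 → Mat3}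
    {ψ : ℕ → Fin 3 → Fin 3 → E3 → ℝ} {u : Fin 3 → Fin 3 → ℝ} {x : E3} (hx : normSq (Q x) ≠ 0)
    (hψ : ∀ i j, Tendsto (fun m => ψ m i j x) atTop (𝓝 (u i j))) :
    Tendsto (fun m => flipRatio (ε m) Q (ψ m) x) atTop
      (𝓝 ((∑ i, ∑ j, u i j ^ 2) / normSq (Q x))) := by
  have h1 : Tendsto (fun m => ∑ i, ∑ j, ψ m i j x ^ 2) atTop (𝓝 (∑ i, ∑ j, u i j ^ 2)) :=
    tendsto_finsetSum _ fun i _ => tendsto_finsetSum _ fun j _ => (hψ i j).pow 2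
  have h2 : Tendsto (fun m => (normSq (Q x) ^ 2 + ε m)⁻¹) atTop (𝓝 ((normSq (Q x) ^ 2 + 0)⁻¹)) :=
    (tendsto_const_nhds.add hε).inv₀ (by simpa using hx)
  have e : (∑ i, ∑ j, u i j ^ 2) / normSq (Q x) =
      normSq (Q x) * (∑ i, ∑ j, u i j ^ 2) * (normSq (Q x) ^ 2 + 0)⁻¹ := by
    rw [add_zero]
    field_simp
  rw [e]
  exact (h1.const_mul (normSq (Q x))).mul h2

/-- A uniaxial global minimizer has a nonnegative scalar order parameter. -/
theorem trace_cube_nonneg_of_minimizer {t R : ℝ} (ht : 0 < t) {Q : E3 → Mat3}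
    {G : Fin 3 → Fin 3 → Fin 3 → E3 → ℝ} (hQ : IsAdmissible R Q G)
    (hmin : ∀ P H, IsAdmissible R P H → energy t R Q G ≤ energy t R P H)
    (hcont : ContinuousOn Q (ball 0 R)) (huni : IsUniaxialOn Q (ball 0 R))
    (hQ1 : ∀ i j, ContDiffOn ℝ 1 (fun x => Q x i j) (ball 0 R)) {x₀ : E3} (hx₀ : x₀ ∈ ball 0 R) :
    0 ≤ ((Q x₀) ^ 3).trace := by
  by_contra hneg
  have hneg' := not_le.1 hneg
  set Ω := ball (0 : E3) R
  have hΩ : IsOpen Ω := isOpen_ball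
  have hS : ∀ x ∈ Ω, Q x ∈ S0 := fun x hx => huni.mem_S0 hx
  have hrel : ∀ x ∈ Ω, 6 * ((Q x) ^ 3).trace ^ 2 = normSq (Q x) ^ 3 := fun x hx =>
    uniaxial_trace_relation huni hx
  obtain ⟨τ, C, hτc, hτ0, hτ1, hτb, hC0, hτd⟩ := exists_step
  choose D hD using hQ.boundary
  choose φ hφt hφae hφD using fun i j => (hD i j).exists_seq
  set ψ : ℕ → Fin 3 → Fin 3 → E3 → ℝ := fun m i j => φ i j m
  have hψ : ∀ m i j, IsTest Ω (ψ m i j) := fun m i j => hφt i j m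
  set ε : ℕ → ℝ := fun m => ((m : ℝ) + 1)⁻¹
  have hε : ∀ m, 0 < ε m := fun m => by positivity
  set T : ℕ → Set E3 := fun m => {y ∈ negSet Q Ω | flipRatio (ε m) Q (ψ m) y ≤ 1 / 2}
  set T' : ℕ → Set E3 := fun m => {y ∈ negSet Q Ω | 1 / 2 < flipRatio (ε m) Q (ψ m) y}
  have hUo : IsOpen (negSet Q Ω) := isOpen_negSet hΩ hcont
  have hUs : negSet Q Ω ⊆ Ω := fun x hx => hx.1
  have hT'o : ∀ m, IsOpen (T' m) := fun m =>
    ((contDiffOn_flipRatio (hε m) hQ1 (hψ m)).continuousOn.mono hUs).isOpen_inter_preimage hUo isOpen_Ioi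
  have hTm : ∀ m, MeasurableSet (T m) := by
    intro m
    have : T m = negSet Q Ω \ T' m := by
      ext y
      simp only [T, T', Set.mem_ofPred_eq, Set.mem_sdiff, not_and, not_lt]
      tauto
    rw [this]
    exact hUo.measurableSet.diff (hT'o m).measurableSet
  have hx₀U : x₀ ∈ negSet Q Ω := ⟨hx₀, hneg'⟩
  have hbc : ContinuousAt (fun x => ((Q x) ^ 3).trace) x₀ :=
    ((show Continuous fun A : Mat3 => (A ^ 3).trace by fun_prop).comp_continuousOn
      hcont).continuousAt (hΩ.mem_nhds hx₀)
  set κ := -((Q x₀) ^ 3).trace / 2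
  have hκ : 0 < κ := by simp only [κ]; linarith
  -- On this fixed ball the flip gains at least Kκ per unit volume, independently of m.
  obtain ⟨r, hr, hrV⟩ : ∃ r > 0, ball x₀ r ⊆ {x ∈ negSet Q Ω | ((Q x) ^ 3).trace ≤ -κ} := by
    have h1 : ∀ᶠ x in 𝓝 x₀, ((Q x) ^ 3).trace < -κ :=
      hbc.tendsto.eventually_lt_const (by simp only [κ]; linarith)
    have h2 : ∀ᶠ x in 𝓝 x₀, x ∈ negSet Q Ω := hUo.mem_nhds hx₀U
    obtain ⟨r, hr, h⟩ := Metric.eventually_nhds_iff_ball.1 (h1.and h2)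
    exact ⟨r, hr, fun x hx => ⟨(h x hx).2, (h x hx).1.le⟩⟩
  set V := ball x₀ r
  have hVΩ : V ⊆ Ω := fun x hx => hUs (hrV hx).1
  set K := 2 * (√6 * hPlus t / t)
  have hK : 0 < K := by have := hPlus_pos ht; positivity
  set g : E3 → ℝ := fun y => (1 + 60 * C ^ 2) * (∑ i, ∑ j, ∑ k, G i j k y ^ 2) +
          48 * C ^ 2 * (∑ i, ∑ j, ∑ k, D i j k y ^ 2) + 1 / 2 * normSq (Q y)
  have hg0 : ∀ y, 0 ≤ g y := fun y => by
    have := normSq_nonneg (Q y)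
    simp only [g]
    positivity
  have hgi : IntegrableOn g Ω := by
    refine ((integrable_sum_sq fun i j k => (hQ.memW12 i j).memLp_grad k).const_mul _).add
      ((integrable_sum_sq fun i j k => (hD i j).memLp_grad k).const_mul _) |>.add ?_
    exact (integrable_finsetSum _ fun i _ => integrable_finsetSum _ fun j _ =>
      (hQ.memW12 i j).memLp.integrable_sq).const_mul _
  set err : ℕ → E3 → ℝ := fun m x =>
    48 * C ^ 2 * (∑ i, ∑ j, ∑ k, (D i j k x - pd k (ψ m i j) x) ^ 2)
  have herr1 : ∀ m i j k, IntegrableOn (fun x => (D i j k x - pd k (ψ m i j) x) ^ 2) Ω :=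
    fun m i j k => (((hD i j).memLp_grad k).sub (memLp_of_continuous_compact
      ((hψ m i j).pd k).1.continuous ((hψ m i j).pd k).2.1 2)).integrable_sq
  have herri : ∀ m, IntegrableOn (err m) Ω := fun m =>
    (integrable_finsetSum _ fun i _ => integrable_finsetSum _ fun j _ =>
      integrable_finsetSum _ fun k _ => herr1 m i j k).const_mul _
  have herr : Tendsto (fun m => ∫ x in Ω, err m x) atTop (𝓝 0) := by
    have h1 : ∀ m, ∫ x in Ω, err m x = 48 * C ^ 2 *
        ∑ i, ∑ j, ∑ k, ∫ x in Ω, (D i j k x - pd k (ψ m i j) x) ^ 2 := by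
      intro m
      simp only [err]
      rw [integral_const_mul]
      congr 1
      rw [integral_finsetSum _ fun i _ => integrable_finsetSum _ fun j _ =>
        integrable_finsetSum _ fun k _ => herr1 m i j k]
      refine Finset.sum_congr rfl fun i _ => ?_
      rw [integral_finsetSum _ fun j _ => integrable_finsetSum _ fun k _ => herr1 m i j k]
      refine Finset.sum_congr rfl fun j _ => ?_
      rw [integral_finsetSum _ fun k _ => herr1 m i j k]
    simp only [h1]
    have h2 : Tendsto (fun m => ∑ i, ∑ j, ∑ k, ∫ x in Ω, (D i j k x - pd k (ψ m i j) x) ^ 2) atTop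
        (𝓝 (∑ i : Fin 3, ∑ j : Fin 3, ∑ k : Fin 3, (0 : ℝ))) :=
      tendsto_finsetSum _ fun i _ => tendsto_finsetSum _ fun j _ =>
        tendsto_finsetSum _ fun k _ => hφD i j k
    simpa using h2.const_mul (48 * C ^ 2)
  have hGae : ∀ᵐ x ∂(volume.restrict Ω), ∀ i j k, G i j k x = pd k (fun y => Q y i j) x := by
    simp only [ae_all_iff]
    exact fun i j k => (hQ.memW12 i j).ae_eq_pd hΩ (hQ1 i j) k
  -- At almost every point of the negative set the ratio tends to |Q - datum|²/|Q|² ≥ 3/4, so the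
  -- point eventually leaves the transition zone `T m`.
  have hconv : ∀ᵐ x ∂(volume.restrict Ω), ∀ᶠ m in atTop, x ∉ T m := by
    have h1 : ∀ᵐ x ∂(volume.restrict Ω), ∀ i j,
        Tendsto (fun m => ψ m i j x) atTop (𝓝 (Q x i j - boundaryDatum x i j)) := by
      simp only [ae_all_iff]
      exact fun i j => hφae i j
    filter_upwards [h1, ae_ne_zero Ω, ae_restrict_mem hΩ.measurableSet] with x hx hx0 hxΩ
    by_cases hxU : x ∈ negSet Q Ω
    · have hge := normSq_sub_boundaryDatum_ge huni hxΩ hx0 hxU.2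
      have ha0 : 0 < normSq (Q x) := by
        refine (normSq_nonneg _).lt_of_ne fun h => ?_
        have h1 := hrel x hxΩ
        rw [← h] at h1
        have h2 := hxU.2
        have : ((Q x) ^ 3).trace = 0 := by simpa using h1
        linarith
      have hlim := tendsto_flipRatio (ε := ε) tendsto_one_div_succ ha0.ne' hx
      have hgt : 1 / 2 < (∑ i, ∑ j, (Q x i j - boundaryDatum x i j) ^ 2) / normSq (Q x) := by
        rw [lt_div_iff₀ ha0]
        have : normSq (Q x - boundaryDatum x) =
          ∑ i, ∑ j, (Q x i j - boundaryDatum x i j) ^ 2 := rfl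
        linarith
      filter_upwards [hlim.eventually_const_lt hgt] with m hm hmT
      exact absurd hmT.2 (not_le.2 hm)
    · exact Eventually.of_forall fun m hm => hxU hm.1
  -- The extra constant compensates for the points of V still in the transition zone, where the gain
  -- is not available. The gain can then be subtracted on all of V.
  set g' : E3 → ℝ := fun y => g y + K * κ
  have hg'i : IntegrableOn g' Ω := hgi.add (integrableOn_const measure_ball_lt_top.ne)
  have hTi : ∀ m, IntegrableOn ((T m).indicator g') Ω := fun m => hg'i.indicator (hTm m)
  have hTlim : Tendsto (fun m => ∫ x in Ω, (T m).indicator g' x) atTop (𝓝 0) := by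
    have := tendsto_integral_of_dominated_convergence (μ := volume.restrict Ω)
      (F := fun m => (T m).indicator g') (f := fun _ => (0 : ℝ)) (fun x => ‖g' x‖)
      (fun m => (hTi m).aestronglyMeasurable) hg'i.norm
      (fun m => Eventually.of_forall fun x => norm_indicator_le_norm_self _ _) ?_
    · simpa using this
    · filter_upwards [hconv] with x hx
      refine tendsto_const_nhds.congr' ?_
      filter_upwards [hx] with m hm
      exact (Set.indicator_of_notMem hm _).symm
  have hVi : IntegrableOn (V.indicator fun _ => K * κ) Ω :=
    (integrableOn_const measure_ball_lt_top.ne).indicator measurableSet_ball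
  have hbound : ∀ m, 0 ≤ (∫ x in Ω, (T m).indicator g' x) + (∫ x in Ω, err m x) -
      ∫ x in Ω, V.indicator (fun _ => K * κ) x := by
    intro m
    set θ := flipCutoff τ (ε m) Q (ψ m) Ω
    have hθ : IsC1Test Ω θ := isC1Test_flipCutoff hΩ (hε m) hcont hQ1 (hψ m) hrel hτ0 hτc
    have hθ2 : IsC1Test Ω (fun y => -2 * θ y) := hθ.const_mul (-2)
    have hP : ∀ i j, IsC1Test Ω (fun y => ((-2 * θ y) • Q y) i j) := by
      intro i j
      have e : (fun y => ((-2 * θ y) • Q y) i j) = fun y => Q y i j * (-2 * θ y) := by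
        funext y; simp only [Matrix.smul_apply, smul_eq_mul]; ring
      rw [e]
      exact ⟨contDiff_mul_of_tsupport_subset hΩ (hQ1 i j) hθ2.contDiff hθ2.subset,
        hθ2.compact.mul_left, (tsupport_mul_subset_right).trans hθ2.subset⟩
    have hPS : ∀ x, (-2 * θ x) • Q x ∈ S0 := by
      intro x
      by_cases hx : x ∈ Ω
      · exact S0_smul _ (hS x hx)
      · have : θ x = 0 := image_eq_zero_of_notMem_tsupport fun h => hx (hθ.subset h)
        rw [this, mul_zero, zero_smul]
        exact ⟨Matrix.isSymm_zero, Matrix.trace_zero _ _⟩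
    obtain ⟨hvi, hv⟩ := variation_integral_nonneg ht hQ hmin hcont hP hPS
    refine hv.trans ?_
    have j1 : Integrable (fun x => (T m).indicator g' x + err m x) (volume.restrict Ω) :=
      (hTi m).add (herri m)
    rw [← integral_add (hTi m) (herri m), ← integral_sub j1 hVi]
    refine integral_mono_ae hvi (j1.sub hVi) ?_
    filter_upwards [hGae, ae_restrict_mem hΩ.measurableSet] with x hxG hx
    have hmain := variation_flip_le (D := D) ht hΩ (hε m) hcont hQ1 (hψ m) hS hrel hτ0 hτ1 hτb hτc
      hτd hx hxG
    refine hmain.trans ?_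
    suffices (T m).indicator g x + (T' m).indicator (fun y => K * ((Q y) ^ 3).trace) x ≤
        (T m).indicator g' x - V.indicator (fun _ => K * κ) x by
      have e : (T m).indicator g x + err m x +
        (T' m).indicator (fun y => K * ((Q y) ^ 3).trace) x ≤
        (T m).indicator g' x + err m x - V.indicator (fun _ => K * κ) x := by linarith
      exact e
    have hKκ : 0 < K * κ := by positivity
    by_cases hxT : x ∈ T m
    · have hxT' : x ∉ T' m := fun h => absurd h.2 (not_lt.2 hxT.2)
      rw [Set.indicator_of_mem hxT, Set.indicator_of_mem hxT, Set.indicator_of_notMem hxT']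
      have : V.indicator (fun _ => K * κ) x ≤ K * κ :=
        Set.indicator_le_self' (fun _ _ => hKκ.le) x
      simp only [g']
      linarith
    · rw [Set.indicator_of_notMem hxT, Set.indicator_of_notMem hxT]
      by_cases hxV : x ∈ V
      · have hx1 := hrV hxV
        have hxT' : x ∈ T' m := ⟨hx1.1, not_le.1 fun h => hxT ⟨hx1.1, h⟩⟩
        rw [Set.indicator_of_mem hxT', Set.indicator_of_mem hxV]
        have := mul_le_mul_of_nonneg_left hx1.2 hK.le
        linarith
      · rw [Set.indicator_of_notMem hxV]
        have : (T' m).indicator (fun y => K * ((Q y) ^ 3).trace) x ≤ 0 :=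
          Set.indicator_nonpos (fun y hy =>
            mul_nonpos_of_nonneg_of_nonpos hK.le hy.1.2.le) x
        linarith
  -- In the limit the transition cost and the approximation error vanish, leaving 0 ≤ -|V|Kκ, a
  -- contradiction.
  have hfinal := ge_of_tendsto' ((hTlim.add herr).sub_const
    (∫ x in Ω, V.indicator (fun _ => K * κ) x)) hbound
  have hVint : ∫ x in Ω, V.indicator (fun _ => K * κ) x = volume.real V * (K * κ) := by
    rw [setIntegral_indicator measurableSet_ball, Set.inter_eq_self_of_subset_right hVΩ,
      setIntegral_const, smul_eq_mul]
  have hVpos : 0 < volume.real V := by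
    refine ENNReal.toReal_pos ?_ measure_ball_lt_top.ne
    exact (measure_ball_pos volume x₀ hr).ne'
  rw [hVint] at hfinal
  have : 0 < volume.real V * (K * κ) := by positivity
  linarith

/-! ### Fourth moments of the unit sphere -/

/-- The moments of the weight `exp (-s²)`. -/
noncomputable def gaussMoment (n : ℕ) : ℝ := ∫ s : ℝ, s ^ n * Real.exp (-s ^ 2)

theorem integrable_pow_mul_exp (n : ℕ) : Integrable fun s : ℝ => s ^ n * Real.exp (-s ^ 2) := by
  have := integrable_rpow_mul_exp_neg_mul_sq (b := 1) one_pos (s := n)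
    (by have : (0 : ℝ) ≤ n := by positivity
        linarith)
  simpa using this

theorem gaussMoment_succ (n : ℕ) : (n + 1) * gaussMoment n = 2 * gaussMoment (n + 2) := by
  have hd : ∀ s : ℝ, HasDerivAt (fun s : ℝ => s ^ (n + 1) * Real.exp (-s ^ 2))
      ((n + 1) * (s ^ n * Real.exp (-s ^ 2)) - 2 * (s ^ (n + 2) * Real.exp (-s ^ 2))) s := by
    intro s
    have h1 : HasDerivAt (fun s : ℝ => Real.exp (-s ^ 2)) (Real.exp (-s ^ 2) * (-(2 * s))) s := by
      have := ((hasDerivAt_pow 2 s).neg).exp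
      simpa using this
    refine ((hasDerivAt_pow (n + 1) s).mul h1).congr_deriv ?_
    push_cast
    ring
  have h1 := (integrable_pow_mul_exp n).const_mul ((n : ℝ) + 1)
  have h2 := (integrable_pow_mul_exp (n + 2)).const_mul 2
  have := integral_eq_zero_of_hasDerivAt_of_integrable hd (h1.sub h2) (integrable_pow_mul_exp (n + 1))
  rw [integral_sub h1 h2, integral_const_mul, integral_const_mul] at this
  unfold gaussMoment
  linarith

theorem gaussMoment_odd {n : ℕ} (hn : Odd n) : gaussMoment n = 0 := by
  have h : gaussMoment n = -gaussMoment n := by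
    unfold gaussMoment
    rw [← integral_neg, ← integral_neg_eq_self]
    congr 1 with s
    rw [hn.neg_pow, neg_sq]
    ring
  linarith

theorem gaussMoment_zero_pos : 0 < gaussMoment 0 := by
  refine (integral_pos_iff_support_of_nonneg (fun s => ?_) (integrable_pow_mul_exp 0)).2 ?_
  · simp only [Pi.zero_apply, pow_zero, one_mul]; positivity
  · have : Function.support (fun s : ℝ => s ^ 0 * Real.exp (-s ^ 2)) = Set.univ := by
      ext s; simp [Real.exp_ne_zero]
    rw [this]
    simp

theorem integral_prod_pow_mul_exp (a : Fin 3 → ℕ) :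
    Integrable (fun x : E3 => ∏ i, (x i ^ a i * Real.exp (-x i ^ 2))) ∧
    ∫ x : E3, ∏ i, (x i ^ a i * Real.exp (-x i ^ 2)) = ∏ i, gaussMoment (a i) := by
  have hmp := EuclideanSpace.volume_preserving_symm_measurableEquiv_toLp (Fin 3)
  have hi : Integrable (fun y : Fin 3 → ℝ => ∏ i, (y i ^ a i * Real.exp (-y i ^ 2))) :=
    Integrable.fintype_prod (f := fun i s => s ^ a i * Real.exp (-s ^ 2))
      (fun i => integrable_pow_mul_exp (a i))
  constructor
  · exact (hmp.integrable_comp_emb (MeasurableEquiv.measurableEmbedding _)).2 hi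
  · have h1 := hmp.integral_comp (MeasurableEquiv.measurableEmbedding _)
      (fun y : Fin 3 → ℝ => ∏ i, (y i ^ a i * Real.exp (-y i ^ 2)))
    have h2 := integral_fintype_prod_volume_eq_prod (fun i (s : ℝ) => s ^ a i * Real.exp (-s ^ 2))
    exact h1.trans h2

/-- Integration of a homogeneous quartic function with a Gaussian weight in polar coordinates. -/
theorem integral_quartic_mul_exp {p : E3 → ℝ} (hp : ∀ (r : ℝ) x, p (r • x) = r ^ 4 * p x) :
    ∫ x : E3, p x * Real.exp (-‖x‖ ^ 2) =
      (∫ v : sphere (0 : E3) 1, p v ∂(volume : Measure E3).toSphere) *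
        ∫ r : Set.Ioi (0 : ℝ), (r : ℝ) ^ 4 * Real.exp (-(r : ℝ) ^ 2)
          ∂(Measure.volumeIoiPow (Module.finrank ℝ E3 - 1)) := by
  have hmp := (volume : Measure E3).measurePreserving_homeomorphUnitSphereProd
  calc ∫ x : E3, p x * Real.exp (-‖x‖ ^ 2)
      = ∫ x : ({(0)}ᶜ : Set E3), p x * Real.exp (-‖(x : E3)‖ ^ 2)
          ∂((volume : Measure E3).comap (↑)) := by
        rw [integral_subtype_comap (measurableSet_singleton _).compl
          fun x : E3 => p x * Real.exp (-‖x‖ ^ 2), restrict_compl_singleton]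
    _ = ∫ z : sphere (0 : E3) 1 × Set.Ioi (0 : ℝ), p z.1 * ((z.2 : ℝ) ^ 4 * Real.exp (-(z.2 : ℝ) ^ 2))
          ∂((volume : Measure E3).toSphere.prod (Measure.volumeIoiPow (Module.finrank ℝ E3 - 1))) := by
        rw [← hmp.integral_comp (Homeomorph.measurableEmbedding _)]
        congr 1 with x
        have hx : (x : E3) ≠ 0 := x.2
        have hn : ‖(x : E3)‖ ≠ 0 := norm_ne_zero_iff.2 hx
        have e : p x = ‖(x : E3)‖ ^ 4 * p (‖(x : E3)‖⁻¹ • (x : E3)) := by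
          rw [← hp, smul_smul, mul_inv_cancel₀ hn, one_smul]
        rw [e]
        simp only [homeomorphUnitSphereProd_apply_fst_coe, homeomorphUnitSphereProd_apply_snd_coe]
        ring
    _ = _ := integral_prod_mul (fun v : sphere (0 : E3) 1 => p v)
        (fun r : Set.Ioi (0 : ℝ) => (r : ℝ) ^ 4 * Real.exp (-(r : ℝ) ^ 2))

/-- The Gaussian weight factorizes over the coordinates. Odd one-dimensional moments vanish, and the
moments of order 2 and 4 are 1/2 and 3/4 of the zeroth, which gives the sum over the three pairings
of the indices. -/
theorem integral_coord_mul_exp (k l m n : Fin 3) :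
    Integrable (fun x : E3 => x k * x l * x m * x n * Real.exp (-‖x‖ ^ 2)) ∧
    ∫ x : E3, x k * x l * x m * x n * Real.exp (-‖x‖ ^ 2) = gaussMoment 0 ^ 3 / 4 *
      ((if k = l then 1 else 0) * (if m = n then 1 else 0)
        + (if k = m then 1 else 0) * (if l = n then 1 else 0)
        + (if k = n then 1 else 0) * (if l = m then 1 else 0)) := by
  have hc : ∀ (x : E3) (k : Fin 3), ∏ i, x i ^ (if k = i then 1 else 0) = x k := fun x k => by
    simp
  have e : (fun x : E3 => x k * x l * x m * x n * Real.exp (-‖x‖ ^ 2)) =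
      fun x : E3 => ∏ i, (x i ^ ((if k = i then 1 else 0) + (if l = i then 1 else 0)
        + (if m = i then 1 else 0) + (if n = i then 1 else 0)) * Real.exp (-x i ^ 2)) := by
    ext x
    simp only [Finset.prod_mul_distrib, pow_add, hc]
    rw [← Real.exp_sum, norm_sq_eq_sum, Fin.sum_univ_three]
    congr 2
    ring
  obtain ⟨h1, h2⟩ := integral_prod_pow_mul_exp fun i => (if k = i then 1 else 0) +
    (if l = i then 1 else 0) + (if m = i then 1 else 0) + (if n = i then 1 else 0)
  rw [e]
  refine ⟨h1, h2.trans ?_⟩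
  have g1 : gaussMoment 1 = 0 := gaussMoment_odd (by decide)
  have g3 : gaussMoment 3 = 0 := gaussMoment_odd (by decide)
  have g2 : gaussMoment 2 = gaussMoment 0 / 2 := by
    have := gaussMoment_succ 0
    norm_num at this
    linarith
  have g4 : gaussMoment 4 = 3 / 4 * gaussMoment 0 := by
    have := gaussMoment_succ 2
    norm_num at this
    linarith
  rw [Fin.prod_univ_three]
  fin_cases k <;> fin_cases l <;> fin_cases m <;> fin_cases n <;>
    simp [g1, g2, g3, g4] <;> ring

/-- For a symmetric traceless matrix `A`, `2|Av|² - 5(v·Av)²` has mean zero over the sphere. -/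
theorem integral_sphere_symm_traceless {A : Fin 3 → Fin 3 → ℝ} (hA : ∀ k l, A k l = A l k)
    (htr : ∑ k, A k k = 0) :
    ∫ v : sphere (0 : E3) 1, (2 * ∑ k, (∑ l, A k l * (v : E3) l) ^ 2
      - 5 * (∑ k, ∑ l, A k l * ((v : E3) k * (v : E3) l)) ^ 2)
        ∂(volume : Measure E3).toSphere = 0 := by
  have h0 := gaussMoment_zero_pos
  -- The radial factor is nonzero: otherwise the Gaussian integral of the fourth power of the first
  -- coordinate would vanish. The sphere average can therefore be read off from the Gaussian
  -- integral.
  have hc : ∫ r : Set.Ioi (0 : ℝ), (r : ℝ) ^ 4 * Real.exp (-(r : ℝ) ^ 2)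
      ∂(Measure.volumeIoiPow (Module.finrank ℝ E3 - 1)) ≠ 0 := by
    intro hc
    have h1 := integral_quartic_mul_exp (p := fun x => x 0 * x 0 * x 0 * x 0) (fun r x => by
      simp only [PiLp.smul_apply, smul_eq_mul]; ring)
    rw [hc, mul_zero, (integral_coord_mul_exp 0 0 0 0).2] at h1
    norm_num at h1
    exact h0.ne' h1
  -- The factor ‖x‖², equal to 1 on the sphere, makes both terms homogeneous of degree four.
  set p : E3 → ℝ := fun x => 2 * (∑ k, (∑ l, A k l * x l) ^ 2) * ‖x‖ ^ 2
    - 5 * (∑ k, ∑ l, A k l * (x k * x l)) ^ 2 with hp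
  have h1 := integral_quartic_mul_exp (p := p) (fun r x => by
    simp only [hp, PiLp.smul_apply, smul_eq_mul, Fin.sum_univ_three, norm_sq_eq_sum]; ring)
  set C : Fin 3 → Fin 3 → Fin 3 → Fin 3 → ℝ := fun k l m n =>
    2 * (if k = l then 1 else 0) * (∑ j, A j m * A j n) - 5 * (A k l * A m n) with hC
  have h2 : ∀ x : E3, p x * Real.exp (-‖x‖ ^ 2) = ∑ k, ∑ l, ∑ m, ∑ n,
      C k l m n * (x k * x l * x m * x n * Real.exp (-‖x‖ ^ 2)) := by
    intro x
    simp only [← mul_assoc, ← Finset.sum_mul]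
    congr 1
    simp only [hp, hC, norm_sq_eq_sum, Fin.sum_univ_three, Fin.isValue]
    simp
    ring
  have h3 : ∫ x : E3, p x * Real.exp (-‖x‖ ^ 2) = ∑ k, ∑ l, ∑ m, ∑ n,
      C k l m n * ∫ x : E3, x k * x l * x m * x n * Real.exp (-‖x‖ ^ 2) := by
    have hI : ∀ k l m n, Integrable
        (fun x : E3 => C k l m n * (x k * x l * x m * x n * Real.exp (-‖x‖ ^ 2))) :=
      fun k l m n => (integral_coord_mul_exp k l m n).1.const_mul _
    simp only [h2]
    rw [integral_finsetSum _ fun k _ => integrable_finsetSum _ fun l _ => integrable_finsetSum _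
      fun m _ => integrable_finsetSum _ fun n _ => hI k l m n]
    refine Finset.sum_congr rfl fun k _ => ?_
    rw [integral_finsetSum _ fun l _ => integrable_finsetSum _
      fun m _ => integrable_finsetSum _ fun n _ => hI k l m n]
    refine Finset.sum_congr rfl fun l _ => ?_
    rw [integral_finsetSum _ fun m _ => integrable_finsetSum _ fun n _ => hI k l m n]
    refine Finset.sum_congr rfl fun m _ => ?_
    rw [integral_finsetSum _ fun n _ => hI k l m n]
    exact Finset.sum_congr rfl fun n _ => integral_const_mul _ _
  have h4 : ∫ x : E3, p x * Real.exp (-‖x‖ ^ 2) = 0 := by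
    rw [h3]
    simp only [(integral_coord_mul_exp _ _ _ _).2, hC, Fin.sum_univ_three]
    rw [Fin.sum_univ_three] at htr
    have e : A 2 2 = -A 0 0 - A 1 1 := by linarith
    simp [hA 1 0, hA 2 0, hA 2 1, e]
    ring
  rw [h4] at h1
  have h5 := (mul_eq_zero.1 h1.symm).resolve_right hc
  rw [← h5]
  congr 1 with v
  have hv : ‖(v : E3)‖ = 1 := by simp
  simp only [hp, hv]
  ring

theorem toSphere_real_univ :
    ((volume : Measure E3).toSphere).real Set.univ = 4 * Real.pi := by
  rw [Measure.toSphere_real_apply_univ]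
  rw [measureReal_def, EuclideanSpace.volume_ball_fin_three]
  simp
  have : (0 : ℝ) ≤ Real.pi * 4 / 3 := by positivity
  rw [ENNReal.toReal_ofReal this]
  ring

/-! ### Second-order expansion at the origin -/

theorem fderiv_apply_eq_sum_pd (f : E3 → ℝ) (x v : E3) :
    fderiv ℝ f x v = ∑ k, pd k f x * v k := by
  have hv : v = ∑ k, v k • EuclideanSpace.single k (1 : ℝ) := by
    ext j
    simp [Fin.sum_univ_three]
    fin_cases j <;> simp
  conv_lhs => rw [hv]
  rw [map_sum]
  exact Finset.sum_congr rfl fun k _ => by rw [map_smul, smul_eq_mul, mul_comm, pd]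

theorem abs_pd_le_norm_fderiv (k : Fin 3) (f : E3 → ℝ) (x : E3) : |pd k f x| ≤ ‖fderiv ℝ f x‖ := by
  have := (fderiv ℝ f x).le_opNorm (EuclideanSpace.single k (1 : ℝ))
  simpa [pd] using this

theorem hasDerivAt_comp_smul {f : E3 → ℝ} {v : E3} {s : ℝ} (hf : DifferentiableAt ℝ f (s • v)) :
    HasDerivAt (fun s : ℝ => f (s • v)) (∑ k, pd k f (s • v) * v k) s := by
  have h1 : HasDerivAt (fun s : ℝ => s • v) v s := by
    simpa using (hasDerivAt_id s).smul_const v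
  have := hf.hasFDerivAt.comp_hasDerivAt s h1
  rwa [fderiv_apply_eq_sum_pd] at this

theorem tendsto_div_ray {f : E3 → ℝ} (hf : DifferentiableAt ℝ f 0) (h0 : f 0 = 0) (v : E3) :
    Tendsto (fun s : ℝ => f (s • v) / s) (𝓝[>] 0) (𝓝 (∑ k, pd k f 0 * v k)) := by
  have h1 : HasDerivAt (fun s : ℝ => f (s • v)) (∑ k, pd k f 0 * v k) 0 := by
    have := hasDerivAt_comp_smul (f := f) (v := v) (s := 0) (by simpa using hf)
    simpa using this
  have h2 := (hasDerivAt_iff_tendsto_slope_zero.1 h1).mono_left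
    (nhdsWithin_mono _ fun s (hs : 0 < s) => hs.ne')
  refine h2.congr fun s => ?_
  simp [h0, div_eq_inv_mul]

section

variable {f : E3 → ℝ} {R : ℝ}

theorem contDiffAt_zero_of_ball (hR : 0 < R) {n : WithTop ℕ∞} (hf : ContDiffOn ℝ n f (ball 0 R)) :
    ContDiffAt ℝ n f 0 :=
  hf.contDiffAt (isOpen_ball.mem_nhds (mem_ball_self hR))

theorem differentiableAt_pd_zero (hf : ContDiffAt ℝ 2 f 0) (k : Fin 3) :
    DifferentiableAt ℝ (pd k f) 0 :=
  ((hf.fderiv_right (m := 1) (by norm_num)).differentiableAt (by norm_num)).clm_apply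
    (differentiableAt_const _)

theorem pd_pd_comm (hf : ContDiffAt ℝ 2 f 0) (k l : Fin 3) :
    pd l (pd k f) 0 = pd k (pd l f) 0 := by
  have hd := (hf.fderiv_right (m := 1) (by norm_num)).differentiableAt (by norm_num)
  have h : ∀ k l : Fin 3, pd l (pd k f) 0 = fderiv ℝ (fderiv ℝ f) 0
      (EuclideanSpace.single l 1) (EuclideanSpace.single k 1) := by
    intro k l
    unfold pd
    rw [fderiv_clm_apply hd (differentiableAt_const _)]
    simp
  rw [h, h]
  exact hf.isSymmSndFDerivAt (by simp) _ _

/-- L'Hôpital's rule along the ray reduces the claim to the first-order expansion of the gradient,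
so C² regularity suffices. -/
theorem tendsto_div_sq_ray (hf : ContDiffAt ℝ 2 f 0) (h0 : f 0 = 0) (h1 : ∀ k, pd k f 0 = 0)
    (v : E3) :
    Tendsto (fun s : ℝ => f (s • v) / s ^ 2) (𝓝[>] 0)
      (𝓝 ((∑ k, ∑ l, pd l (pd k f) 0 * (v k * v l)) / 2)) := by
  have hray : Tendsto (fun s : ℝ => s • v) (𝓝[>] 0) (𝓝 0) := by
    have : Tendsto (fun s : ℝ => s • v) (𝓝 0) (𝓝 ((0 : ℝ) • v)) := by
      exact (continuous_id.smul continuous_const).tendsto 0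
    rw [zero_smul] at this
    exact this.mono_left nhdsWithin_le_nhds
  have hdiff : ∀ᶠ x in 𝓝 (0 : E3), DifferentiableAt ℝ f x :=
    (hf.eventually (by simp)).mono fun x hx => hx.differentiableAt (by norm_num)
  refine HasDerivAt.lhopital_zero_nhdsGT (f' := fun s => ∑ k, pd k f (s • v) * v k)
    (g' := fun s => 2 * s) ?_ ?_ ?_ ?_ ?_ ?_
  · exact (hray.eventually hdiff).mono fun s hs => hasDerivAt_comp_smul hs
  · exact Eventually.of_forall fun s => by simpa using hasDerivAt_pow 2 s
  · filter_upwards [self_mem_nhdsWithin] with s (hs : 0 < s)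
    positivity
  · have := hf.continuousAt.tendsto.comp hray
    rwa [h0] at this
  · have : Tendsto (fun s : ℝ => s ^ 2) (𝓝 0) (𝓝 (0 ^ 2)) := (continuous_pow 2).tendsto 0
    rw [zero_pow two_ne_zero] at this
    exact this.mono_left nhdsWithin_le_nhds
  · have h2 : ∀ k, Tendsto (fun s : ℝ => pd k f (s • v) / s * v k) (𝓝[>] 0)
        (𝓝 ((∑ l, pd l (pd k f) 0 * v l) * v k)) := fun k =>
      (tendsto_div_ray (differentiableAt_pd_zero hf k) (h1 k) v).mul_const _
    have h3 := (tendsto_finsetSum Finset.univ fun k _ => h2 k).div_const 2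
    refine Tendsto.congr' ?_ (h3.trans_eq ?_)
    · filter_upwards [self_mem_nhdsWithin] with s (hs : 0 < s)
      rw [Finset.sum_div, Finset.sum_div]
      refine Finset.sum_congr rfl fun k _ => ?_
      field_simp
    · congr 2
      refine Finset.sum_congr rfl fun k _ => ?_
      rw [Finset.sum_mul]
      exact Finset.sum_congr rfl fun l _ => by ring

/-- Uniform in the direction, unlike the limits along rays; this provides the domination on the
sphere. The bound on f follows from that on its derivative by the mean value inequality. -/
theorem exists_taylor_bound (hf : ContDiffAt ℝ 2 f 0) (h0 : f 0 = 0) (h1 : ∀ k, pd k f 0 = 0) :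
    ∃ M, ∃ ε > 0, ∀ x ∈ ball (0 : E3) ε, |f x| ≤ M * ‖x‖ ^ 2 ∧ ∀ k, |pd k f x| ≤ M * ‖x‖ := by
  have hd := (hf.fderiv_right (m := 1) (by norm_num)).differentiableAt (by norm_num)
  have hz : fderiv ℝ f 0 = 0 := by
    ext v
    simp [fderiv_apply_eq_sum_pd, h1]
  have hO := hd.isBigO_sub
  obtain ⟨M, hM⟩ := hO.bound
  have hdiff : ∀ᶠ x in 𝓝 (0 : E3), DifferentiableAt ℝ f x :=
    (hf.eventually (by simp)).mono fun x hx => hx.differentiableAt (by norm_num)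
  obtain ⟨ε, hε, hb⟩ := Metric.eventually_nhds_iff_ball.1 (hM.and hdiff)
  simp only [hz, sub_zero] at hb
  have hMn : ∀ x ∈ ball (0 : E3) ε, ‖fderiv ℝ f x‖ ≤ |M| * ‖x‖ := fun x hx =>
    (hb x hx).1.trans (mul_le_mul_of_nonneg_right (le_abs_self M) (norm_nonneg _))
  refine ⟨|M|, ε, hε, fun x hx => ⟨?_, fun k => (abs_pd_le_norm_fderiv k f x).trans (hMn x hx)⟩⟩
  have hsub : closedBall (0 : E3) ‖x‖ ⊆ ball 0 ε :=
    closedBall_subset_ball (by simpa using hx)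
  have := (convex_closedBall (0 : E3) ‖x‖).norm_image_sub_le_of_norm_fderiv_le (f := f) (𝕜 := ℝ)
    (C := |M| * ‖x‖) (fun y hy => (hb y (hsub hy)).2)
    (fun y hy => (hMn y (hsub hy)).trans
      (mul_le_mul_of_nonneg_left (by simpa using hy) (abs_nonneg M)))
    (mem_closedBall_self (norm_nonneg _)) (y := x) (by simp)
  rw [h0, sub_zero, sub_zero, Real.norm_eq_abs] at this
  linarith

end

/-! ### Vanishing of the gradient at the origin -/

theorem normSq_smul (s : ℝ) (A : Mat3) : normSq (s • A) = s ^ 2 * normSq A := by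
  simp only [normSq, Matrix.smul_apply, smul_eq_mul, mul_pow, Finset.mul_sum]

theorem continuous_trace_cube : Continuous fun A : Mat3 => (A ^ 3).trace :=
  (continuous_id.pow 3).matrix_trace

theorem continuous_normSq : Continuous normSq := by
  unfold normSq
  exact continuous_finsetSum _ fun i _ => continuous_finsetSum _ fun j _ =>
    ((continuous_apply j).comp (continuous_apply i)).pow 2

theorem eq_zero_of_normSq_eq_zero {A : Mat3} (h : normSq A = 0) (i j : Fin 3) : A i j = 0 := by
  unfold normSq at h
  have h1 := (Finset.sum_eq_zero_iff_of_nonneg fun i _ =>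
    Finset.sum_nonneg fun j _ => sq_nonneg (A i j)).1 h i (Finset.mem_univ i)
  have h2 := (Finset.sum_eq_zero_iff_of_nonneg fun j _ => sq_nonneg (A i j)).1 h1 j
    (Finset.mem_univ j)
  exact pow_eq_zero_iff two_ne_zero |>.1 h2

/-- A uniaxial field with nonnegative `tr Q³` has vanishing gradient at its zeros. -/
theorem pd_eq_zero_of_trace_cube_nonneg {Q : E3 → Mat3}
    (hQ : ∀ i j, DifferentiableAt ℝ (fun x => Q x i j) 0) (h0 : Q 0 = 0)
    (hrel : ∀ᶠ x in 𝓝 0, 6 * ((Q x) ^ 3).trace ^ 2 = normSq (Q x) ^ 3)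
    (hnn : ∀ᶠ x in 𝓝 0, 0 ≤ ((Q x) ^ 3).trace) (i j k : Fin 3) :
    pd k (fun x => Q x i j) 0 = 0 := by
  set L : E3 → Mat3 := fun v => Matrix.of fun i j => ∑ k, pd k (fun x => Q x i j) 0 * v k with hL
  have hray : ∀ v : E3, Tendsto (fun s : ℝ => s • v) (𝓝[>] 0) (𝓝 0) := fun v => by
    have : Tendsto (fun s : ℝ => s • v) (𝓝 0) (𝓝 ((0 : ℝ) • v)) :=
      (continuous_id.smul continuous_const).tendsto 0
    rw [zero_smul] at this
    exact this.mono_left nhdsWithin_le_nhds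
  have hlim : ∀ v, Tendsto (fun s : ℝ => s⁻¹ • Q (s • v)) (𝓝[>] 0) (𝓝 (L v)) := fun v => by
    refine tendsto_pi_nhds.2 fun i => tendsto_pi_nhds.2 fun j => ?_
    have := tendsto_div_ray (hQ i j) (by simp [h0]) v
    refine this.congr fun s => ?_
    simp [div_eq_inv_mul]
  have hcube : ∀ (s : ℝ) (A : Mat3), ((s • A) ^ 3).trace = s ^ 3 * (A ^ 3).trace := fun s A => by
    rw [smul_pow, Matrix.trace_smul, smul_eq_mul]
  have h1 : ∀ v, 0 ≤ ((L v) ^ 3).trace := fun v => by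
    refine ge_of_tendsto ((continuous_trace_cube.tendsto _).comp (hlim v)) ?_
    filter_upwards [(hray v).eventually hnn, self_mem_nhdsWithin] with s hs (h : 0 < s)
    simp only [Function.comp, hcube]
    positivity
  have h2 : ∀ v, 6 * ((L v) ^ 3).trace ^ 2 = normSq (L v) ^ 3 := fun v => by
    have e1 := (((continuous_trace_cube.tendsto _).comp (hlim v)).pow 2).const_mul 6
    have e2 := ((continuous_normSq.tendsto _).comp (hlim v)).pow 3
    refine tendsto_nhds_unique e1 (e2.congr' ?_)
    filter_upwards [(hray v).eventually hrel] with s hs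
    simp only [Function.comp, hcube, normSq_smul]
    rw [mul_pow (_ ^ 2), ← hs]
    ring
  -- The linear map L is odd, so v ↦ tr L(v)³ is odd as well as nonnegative. A sign change of the
  -- order parameter is the only obstruction, as Q = x₁(n ⊗ n - I/3) shows.
  have h3 : ∀ v, ((L v) ^ 3).trace = 0 := fun v => by
    have e : L (-v) = (-1 : ℝ) • L v := by
      ext i j
      simp [hL, Finset.sum_neg_distrib]
    have := h1 (-v)
    rw [e, hcube] at this
    linarith [h1 v]
  have h4 := h2 (EuclideanSpace.single k 1)
  rw [h3] at h4
  have h5 := eq_zero_of_normSq_eq_zero (pow_eq_zero_iff three_ne_zero |>.1 (by linarith :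
    normSq (L (EuclideanSpace.single k 1)) ^ 3 = 0)) i j
  simpa [hL] using h5

/-! ### The flux of `Φ` through small spheres -/

theorem pd_norm {x : E3} (hx : x ≠ 0) (k : Fin 3) : pd k (fun y => ‖y‖) x = x k / ‖x‖ := by
  have h1 : HasFDerivAt (fun y : E3 => ‖y‖ ^ 2) (2 • (innerSL ℝ) x) x :=
    (hasStrictFDerivAt_norm_sq x).hasFDerivAt
  have hn : ‖x‖ ≠ 0 := norm_ne_zero_iff.2 hx
  have h2 := h1.sqrt (pow_ne_zero 2 hn)
  simp only [Real.sqrt_sq (norm_nonneg _)] at h2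
  rw [pd, h2.fderiv]
  simp [EuclideanSpace.inner_single_right]
  field_simp

theorem contDiffOn_profile_norm {h : ℝ → ℝ} {n : WithTop ℕ∞} (hh : ContDiffOn ℝ n h (Set.Ioi 0)) :
    ContDiffOn ℝ n (fun x : E3 => h ‖x‖) {0}ᶜ :=
  hh.comp (contDiffOn_id.norm ℝ fun _ hx => hx) fun _ hx => norm_pos_iff.2 hx

section

variable {Q : E3 → Mat3} {h : ℝ → ℝ} {Ω : Set E3}

theorem contDiffOn_quotientField (hQ : ∀ i j, ContDiffOn ℝ 1 (fun x => Q x i j) Ω)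
    (hh : ContDiffOn ℝ 1 h (Set.Ioi 0)) (hpos : ∀ r, 0 < r → 0 < h r) (i j : Fin 3) :
    ContDiffOn ℝ 1 (fun x => quotientField Q h x i j) (Ω \ {0}) := by
  have h1 := (contDiffOn_profile_norm hh).mono (fun x (hx : x ∈ Ω \ {0}) => hx.2)
  exact ((hQ i j).mono Set.sdiff_subset).div h1 fun x hx => (hpos _ (norm_pos_iff.2 hx.2)).ne'

theorem pd_quotientField {x : E3} (hx : x ≠ 0) {i j : Fin 3}
    (hQ : DifferentiableAt ℝ (fun x => Q x i j) x)
    (hh : DifferentiableAt ℝ h ‖x‖) (hne : h ‖x‖ ≠ 0) (k : Fin 3) :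
    pd k (fun y => quotientField Q h y i j) x =
      pd k (fun y => Q y i j) x / h ‖x‖ - Q x i j * deriv h ‖x‖ / h ‖x‖ ^ 2 * (x k / ‖x‖) := by
  have hN : DifferentiableAt ℝ (fun y : E3 => ‖y‖) x := differentiableAt_id.norm ℝ hx
  have e1 : (fun y => quotientField Q h y i j) = fun y => Q y i j * (fun r => (h r)⁻¹) ‖y‖ := by
    ext y; simp [quotientField, div_eq_mul_inv]
  have hi : DifferentiableAt ℝ (fun r => (h r)⁻¹) ‖x‖ := hh.inv hne
  have hc : DifferentiableAt ℝ (fun y : E3 => (fun r => (h r)⁻¹) ‖y‖) x := hi.comp x hN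
  rw [e1, pd_mul hQ hc, pd_comp hi hN, pd_norm hx, deriv_fun_inv'' hh hne]
  field_simp
  ring

end

/-- The flux density of `Φ` on a small sphere, in rescaled variables. -/
noncomputable def fluxDensity
    (z : (Fin 3 → Fin 3 → Fin 3 → ℝ) × (Fin 3 → Fin 3 → ℝ) × ℝ × ℝ × ℝ × E3) : ℝ :=
  (1 / 2) * (∑ i, ∑ j, ∑ k, (z.1 i j k * z.2.2.1
      - z.2.1 i j * z.2.2.2.1 * z.2.2.1 ^ 2 * z.2.2.2.2.2 k) ^ 2)
    - (∑ i, ∑ j, (∑ k, (z.1 i j k * z.2.2.1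
      - z.2.1 i j * z.2.2.2.1 * z.2.2.1 ^ 2 * z.2.2.2.2.2 k) * z.2.2.2.2.2 k) ^ 2)
    + z.2.2.2.2.1 * (1 - ∑ i, ∑ j, (z.2.1 i j * z.2.2.1) ^ 2) ^ 2
    + 3 * (1 - ∑ i, ∑ j, (z.2.1 i j * z.2.2.1) ^ 2)

theorem continuous_fluxDensity : Continuous fluxDensity := by
  unfold fluxDensity
  fun_prop

/-- The arguments of `fluxDensity` at the point `δ v`. -/
noncomputable def fluxArg (t : ℝ) (h : ℝ → ℝ) (Q : E3 → Mat3) (δ : ℝ) (v : E3) :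
    (Fin 3 → Fin 3 → Fin 3 → ℝ) × (Fin 3 → Fin 3 → ℝ) × ℝ × ℝ × ℝ × E3 :=
  (fun i j k => pd k (fun x => Q x i j) (δ • v) / δ, fun i j => Q (δ • v) i j / δ ^ 2,
    (h δ / δ ^ 2)⁻¹, deriv h δ / δ, (1 + 3 * hPlus t / t) * (δ ^ 2 * h δ ^ 2) / 4, v)

/-- Each derivative of S scales like 1/δ. Multiplying by δ² therefore gives a polynomial in the
rescaled quantities Q/δ², ∇Q/δ, (h/δ²)⁻¹ and h'/δ, in v and in a vanishing potential coefficient;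
these all have limits. -/
theorem sq_mul_normalPhi {t : ℝ} {h : ℝ → ℝ} {Q : E3 → Mat3} {δ : ℝ} {v : E3} (hδ : 0 < δ)
    (hv : ‖v‖ = 1) (hQ : ∀ i j, DifferentiableAt ℝ (fun x => Q x i j) (δ • v))
    (hh : DifferentiableAt ℝ h δ) (hne : h δ ≠ 0) :
    δ ^ 2 * normalPhi t h (quotientField Q h) (δ • v) = fluxDensity (fluxArg t h Q δ v) := by
  have hn : ‖δ • v‖ = δ := by rw [norm_smul, hv, mul_one, Real.norm_eq_abs, abs_of_pos hδ]
  have hx : δ • v ≠ 0 := norm_ne_zero_iff.1 (by rw [hn]; exact hδ.ne')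
  have hv2 : ∑ p, v p * v p = 1 := by
    have := norm_sq_eq_sum v
    rw [hv] at this
    rw [Fin.sum_univ_three]
    linarith
  set X : Fin 3 → Fin 3 → Fin 3 → ℝ := fun i j k => pd k (fun x => Q x i j) (δ • v) / δ *
    (h δ / δ ^ 2)⁻¹ - Q (δ • v) i j / δ ^ 2 * (deriv h δ / δ) * (h δ / δ ^ 2)⁻¹ ^ 2 * v k with hX
  have hpd : ∀ i j k, pd k (fun y => quotientField Q h y i j) (δ • v) = X i j k / δ := by
    intro i j k
    rw [pd_quotientField hx (hQ i j) (by rwa [hn]) (by rwa [hn]), hn, hX]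
    simp only [PiLp.smul_apply, smul_eq_mul]
    field_simp
  have hS : normSq (quotientField Q h (δ • v)) =
      ∑ i, ∑ j, (Q (δ • v) i j / δ ^ 2 * (h δ / δ ^ 2)⁻¹) ^ 2 := by
    unfold normSq
    refine Finset.sum_congr rfl fun i _ => Finset.sum_congr rfl fun j _ => ?_
    simp only [quotientField, Matrix.of_apply, hn]
    field_simp
  set s := ∑ i, ∑ j, (Q (δ • v) i j / δ ^ 2 * (h δ / δ ^ 2)⁻¹) ^ 2 with hs
  have hp : ∀ p, δ ^ 2 * (Phi t h (quotientField Q h) p (δ • v) * ((δ • v) p / ‖δ • v‖)) =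
      ((1 / 2) * (∑ i, ∑ j, ∑ k, X i j k ^ 2) + (1 + 3 * hPlus t / t) * (δ ^ 2 * h δ ^ 2) / 4 *
        (1 - s) ^ 2 + 3 * (1 - s)) * (v p * v p)
        - ∑ i, ∑ j, (∑ k, X i j k * v k) * (X i j p * v p) := by
    intro p
    have e0 : ∀ q, (δ • v) q = δ * v q := fun q => rfl
    have e1 : ∑ i, ∑ j, ∑ k, (X i j k / δ) ^ 2 = (∑ i, ∑ j, ∑ k, X i j k ^ 2) / δ ^ 2 := by
      simp only [div_pow, Finset.sum_div]
    have e2 : ∑ i, ∑ j, (∑ k, X i j k / δ * (δ * v k) / δ) * (X i j p / δ) * v p =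
        (∑ i, ∑ j, (∑ k, X i j k * v k) * (X i j p * v p)) / δ ^ 2 := by
      simp only [Finset.sum_div]
      refine Finset.sum_congr rfl fun i _ => Finset.sum_congr rfl fun j _ => ?_
      have : ∑ k, X i j k / δ * (δ * v k) / δ = (∑ k, X i j k * v k) / δ := by
        rw [Finset.sum_div]
        refine Finset.sum_congr rfl fun k _ => ?_
        field_simp
      rw [this]
      field_simp
    have e3 : (∑ i, ∑ j, (∑ k, X i j k / δ * (δ * v k) / δ) * (X i j p / δ)) * v p =
        (∑ i, ∑ j, (∑ k, X i j k * v k) * (X i j p * v p)) / δ ^ 2 := by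
      rw [← e2]
      simp only [Finset.sum_mul]
    unfold Phi
    simp only [hpd, hS, hn, e0, e1]
    rw [mul_div_cancel_left₀ _ hδ.ne', add_mul, add_mul, sub_mul, e3]
    field_simp
    ring
  unfold normalPhi
  rw [Finset.mul_sum, Finset.sum_congr rfl fun p _ => hp p, Finset.sum_sub_distrib,
    ← Finset.mul_sum, hv2, mul_one]
  have e4 : ∑ p, ∑ i, ∑ j, (∑ k, X i j k * v k) * (X i j p * v p) =
      ∑ i, ∑ j, (∑ k, X i j k * v k) ^ 2 := by
    rw [Finset.sum_comm]
    refine Finset.sum_congr rfl fun i _ => ?_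
    rw [Finset.sum_comm]
    refine Finset.sum_congr rfl fun j _ => ?_
    rw [← Finset.mul_sum, sq]
  rw [e4]
  simp only [fluxDensity, fluxArg]
  rw [← hs]
  ring

section

variable {Q : E3 → Mat3} {h : ℝ → ℝ} {R : ℝ}

theorem continuous_fluxArg (hQ : ∀ i j, ContDiffOn ℝ 1 (fun x => Q x i j) (ball 0 R)) (t : ℝ)
    {δ : ℝ} (hδ : 0 < δ) (hδR : δ < R) :
    Continuous fun v : sphere (0 : E3) 1 => fluxArg t h Q δ v := by
  have hmem : ∀ v : sphere (0 : E3) 1, δ • (v : E3) ∈ ball (0 : E3) R := fun v => by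
    rw [mem_ball_zero_iff, norm_smul, norm_eq_of_mem_sphere, mul_one, Real.norm_eq_abs,
      abs_of_pos hδ]
    exact hδR
  have hs : Continuous fun v : sphere (0 : E3) 1 => δ • (v : E3) := by
    fun_prop
  unfold fluxArg
  refine Continuous.prodMk ?_ (Continuous.prodMk ?_ (by fun_prop))
  · refine continuous_pi fun i => continuous_pi fun j => continuous_pi fun k => ?_
    exact ((contDiffOn_pd isOpen_ball (hQ i j) (m := 0) (by norm_num) k).continuousOn.comp_continuous
      hs hmem).div_const _
  · refine continuous_pi fun i => continuous_pi fun j => ?_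
    exact ((hQ i j).continuousOn.comp_continuous hs hmem).div_const _

theorem sq_mul_normalPhi_sphere (hQ : ∀ i j, ContDiffOn ℝ 1 (fun x => Q x i j) (ball 0 R))
    (hh : ContDiffOn ℝ 1 h (Set.Ioi 0)) (hpos : ∀ r, 0 < r → 0 < h r) (t : ℝ)
    {δ : ℝ} (hδ : 0 < δ) (hδR : δ < R) (v : sphere (0 : E3) 1) :
    δ ^ 2 * normalPhi t h (quotientField Q h) (δ • (v : E3)) = fluxDensity (fluxArg t h Q δ v) := by
  have hmem : δ • (v : E3) ∈ ball (0 : E3) R := by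
    rw [mem_ball_zero_iff, norm_smul, norm_eq_of_mem_sphere, mul_one, Real.norm_eq_abs,
      abs_of_pos hδ]
    exact hδR
  exact sq_mul_normalPhi hδ (norm_eq_of_mem_sphere v)
    (fun i j => ((hQ i j).contDiffAt (isOpen_ball.mem_nhds hmem)).differentiableAt (by norm_num))
    ((hh.contDiffAt (isOpen_Ioi.mem_nhds hδ)).differentiableAt (by norm_num)) (hpos δ hδ).ne'

theorem integrable_normalPhi (hQ : ∀ i j, ContDiffOn ℝ 1 (fun x => Q x i j) (ball 0 R))
    (hh : ContDiffOn ℝ 1 h (Set.Ioi 0)) (hpos : ∀ r, 0 < r → 0 < h r) (t : ℝ)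
    {δ : ℝ} (hδ : 0 < δ) (hδR : δ < R) :
    Integrable (fun v : sphere (0 : E3) 1 => normalPhi t h (quotientField Q h) (δ • (v : E3)))
      (volume : Measure E3).toSphere := by
  have hc : Continuous fun v : sphere (0 : E3) 1 => fluxDensity (fluxArg t h Q δ v) :=
    continuous_fluxDensity.comp (continuous_fluxArg hQ t hδ hδR)
  have hi : Integrable (fun v : sphere (0 : E3) 1 => fluxDensity (fluxArg t h Q δ v))
      (volume : Measure E3).toSphere := hc.integrable_of_hasCompactSupport
        (HasCompactSupport.of_compactSpace _)
  refine (hi.const_mul (δ ^ 2)⁻¹).congr (ae_of_all _ fun v => ?_)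
  have := sq_mul_normalPhi_sphere hQ hh hpos t hδ hδR v
  simp only [← this]
  field_simp

/-- The limit of the arguments of `fluxDensity` at `δ v` as `δ → 0`, where `H` is the Hessian
of `Q` at the origin. -/
noncomputable def fluxArgLimit (H : Fin 3 → Fin 3 → Fin 3 → Fin 3 → ℝ) (c : ℝ) (v : E3) :
    (Fin 3 → Fin 3 → Fin 3 → ℝ) × (Fin 3 → Fin 3 → ℝ) × ℝ × ℝ × ℝ × E3 :=
  (fun i j k => ∑ l, H i j k l * v l, fun i j => (∑ k, ∑ l, H i j k l * (v k * v l)) / 2,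
    c⁻¹, 2 * c, 0, v)

/-- With a = Hv and w = v·Hv, the limiting gradient is (a - wv)/c. It is orthogonal to v, so the
radial term drops out and |a - wv|² = |a|² - w². The total is (|a|² - w²)/(2c²) + 3 - 3w²/(4c²),
summed over the entries. -/
theorem fluxDensity_fluxArgLimit (H : Fin 3 → Fin 3 → Fin 3 → Fin 3 → ℝ) {c : ℝ} (hc : c ≠ 0)
    {v : E3} (hv : ‖v‖ = 1) :
    fluxDensity (fluxArgLimit H c v) = 3 + ∑ i, ∑ j, (1 / (4 * c ^ 2)) *
      (2 * ∑ k, (∑ l, H i j k l * v l) ^ 2 - 5 * (∑ k, ∑ l, H i j k l * (v k * v l)) ^ 2) := by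
  have hv2 : ∑ p, v p * v p = 1 := by
    have := norm_sq_eq_sum v
    rw [hv] at this
    rw [Fin.sum_univ_three]
    linarith
  set w : Fin 3 → Fin 3 → ℝ := fun i j => ∑ k, ∑ l, H i j k l * (v k * v l) with hw
  set a : Fin 3 → Fin 3 → Fin 3 → ℝ := fun i j k => ∑ l, H i j k l * v l with ha
  change _ = 3 + ∑ i, ∑ j, (1 / (4 * c ^ 2)) * (2 * ∑ k, a i j k ^ 2 - 5 * w i j ^ 2)
  have haw : ∀ i j, ∑ k, a i j k * v k = w i j := fun i j => by
    simp only [ha, hw, Finset.sum_mul]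
    exact Finset.sum_congr rfl fun k _ => Finset.sum_congr rfl fun l _ => by ring
  have hX : ∀ i j k, a i j k * c⁻¹ - w i j / 2 * (2 * c) * c⁻¹ ^ 2 * v k =
      (a i j k - w i j * v k) / c := fun i j k => by
    field_simp
  have h1 : ∀ i j, ∑ k, ((a i j k - w i j * v k) / c) ^ 2 =
      (∑ k, a i j k ^ 2 - w i j ^ 2) / c ^ 2 := fun i j => by
    have : ∀ k, ((a i j k - w i j * v k) / c) ^ 2 = (a i j k ^ 2 - 2 * w i j * (a i j k * v k)
      + w i j ^ 2 * (v k * v k)) / c ^ 2 := fun k => by field_simp; ring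
    simp only [this]
    rw [← Finset.sum_div, Finset.sum_add_distrib, Finset.sum_sub_distrib, ← Finset.mul_sum,
      ← Finset.mul_sum, haw, hv2]
    ring
  have h2 : ∀ i j, ∑ k, (a i j k - w i j * v k) / c * v k = 0 := fun i j => by
    have : ∀ k, (a i j k - w i j * v k) / c * v k = (a i j k * v k - w i j * (v k * v k)) / c :=
      fun k => by ring
    simp only [this]
    rw [← Finset.sum_div, Finset.sum_sub_distrib, ← Finset.mul_sum, haw, hv2]
    ring
  have h3 : ∀ i j, (w i j / 2 * c⁻¹) ^ 2 = w i j ^ 2 / (4 * c ^ 2) := fun i j => by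
    field_simp; norm_num
  have e : fluxDensity (fluxArgLimit H c v) = 1 / 2 * (∑ i, ∑ j, ∑ k,
      (a i j k * c⁻¹ - w i j / 2 * (2 * c) * c⁻¹ ^ 2 * v k) ^ 2)
      - (∑ i, ∑ j, (∑ k, (a i j k * c⁻¹ - w i j / 2 * (2 * c) * c⁻¹ ^ 2 * v k) * v k) ^ 2)
      + 0 * (1 - ∑ i, ∑ j, (w i j / 2 * c⁻¹) ^ 2) ^ 2
      + 3 * (1 - ∑ i, ∑ j, (w i j / 2 * c⁻¹) ^ 2) := rfl
  rw [e]
  simp only [hX, h1, h2, h3, zero_mul, add_zero, mul_sub, mul_one, Finset.mul_sum]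
  simp only [← Finset.mul_sum]
  have h4 : (∑ i : Fin 3, ∑ j : Fin 3, (0 : ℝ) ^ 2) = 0 := by simp
  rw [h4, sub_zero, add_sub_left_comm]
  congr 1
  simp only [Finset.mul_sum, ← Finset.sum_sub_distrib]
  refine Finset.sum_congr rfl fun i _ => Finset.sum_congr rfl fun j _ => ?_
  simp only [← Finset.mul_sum]
  field_simp
  ring

theorem tendsto_fluxArg (hR : 0 < R) (hQ : ∀ i j, ContDiffOn ℝ 2 (fun x => Q x i j) (ball 0 R))
    (h0 : Q 0 = 0) (h1 : ∀ i j k, pd k (fun x => Q x i j) 0 = 0) (t : ℝ) {c : ℝ} (hc : 0 < c)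
    (hc1 : Tendsto (fun r => h r / r ^ 2) (𝓝[>] 0) (𝓝 c))
    (hc2 : Tendsto (fun r => deriv h r / r) (𝓝[>] 0) (𝓝 (2 * c)))
    (hb : ∀ r, 0 ≤ r → 0 ≤ h r ∧ h r ≤ 1) (v : E3) :
    Tendsto (fun δ => fluxArg t h Q δ v) (𝓝[>] 0) (𝓝 (fluxArgLimit
      (fun i j k l => pd l (pd k fun x => Q x i j) 0) c v)) := by
  have hQ0 : ∀ i j, ContDiffAt ℝ 2 (fun x => Q x i j) 0 := fun i j =>
    contDiffAt_zero_of_ball hR (hQ i j)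
  have hd2 : Tendsto (fun δ : ℝ => δ ^ 2) (𝓝[>] 0) (𝓝 0) := by
    have : Tendsto (fun s : ℝ => s ^ 2) (𝓝 0) (𝓝 (0 ^ 2)) := (continuous_pow 2).tendsto 0
    rw [zero_pow two_ne_zero] at this
    exact this.mono_left nhdsWithin_le_nhds
  have hk : Tendsto (fun δ => (1 + 3 * hPlus t / t) * (δ ^ 2 * h δ ^ 2) / 4) (𝓝[>] 0) (𝓝 0) := by
    have : Tendsto (fun δ => δ ^ 2 * h δ ^ 2) (𝓝[>] 0) (𝓝 0) := by
      refine squeeze_zero' (Eventually.of_forall fun δ => by positivity) ?_ hd2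
      filter_upwards [self_mem_nhdsWithin] with δ (hδ : 0 < δ)
      have := hb δ hδ.le
      exact mul_le_of_le_one_right (by positivity) (pow_le_one₀ this.1 this.2)
    simpa using (this.const_mul (1 + 3 * hPlus t / t)).div_const 4
  refine Tendsto.prodMk_nhds ?_ (Tendsto.prodMk_nhds ?_ (Tendsto.prodMk_nhds (hc1.inv₀ hc.ne')
    (Tendsto.prodMk_nhds hc2 (Tendsto.prodMk_nhds hk tendsto_const_nhds))))
  · exact tendsto_pi_nhds.2 fun i => tendsto_pi_nhds.2 fun j => tendsto_pi_nhds.2 fun k =>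
      tendsto_div_ray (differentiableAt_pd_zero (hQ0 i j) k) (h1 i j k) v
  · exact tendsto_pi_nhds.2 fun i => tendsto_pi_nhds.2 fun j =>
      tendsto_div_sq_ray (hQ0 i j) (by simp [h0]) (h1 i j) v

theorem exists_bound_fluxArg (hR : 0 < R)
    (hQ : ∀ i j, ContDiffOn ℝ 2 (fun x => Q x i j) (ball 0 R))
    (h0 : Q 0 = 0) (h1 : ∀ i j k, pd k (fun x => Q x i j) 0 = 0) (t : ℝ) {c : ℝ} (hc : 0 < c)
    (hc1 : Tendsto (fun r => h r / r ^ 2) (𝓝[>] 0) (𝓝 c))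
    (hc2 : Tendsto (fun r => deriv h r / r) (𝓝[>] 0) (𝓝 (2 * c)))
    (hb : ∀ r, 0 ≤ r → 0 ≤ h r ∧ h r ≤ 1) :
    ∃ M, ∀ᶠ δ in 𝓝[>] 0, ∀ v : sphere (0 : E3) 1, ‖fluxArg t h Q δ v‖ ≤ M := by
  have hQ0 : ∀ i j, ContDiffAt ℝ 2 (fun x => Q x i j) 0 := fun i j =>
    contDiffAt_zero_of_ball hR (hQ i j)
  -- The scalar components do not depend on the direction, so convergence at the single vector 0
  -- bounds them for all v at once.
  have hT := tendsto_fluxArg hR hQ h0 h1 t hc hc1 hc2 hb 0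
  have hT2 := ((continuous_snd.comp continuous_snd).tendsto _).comp hT
  obtain ⟨N, hN⟩ := hT2.norm.isBoundedUnder_le
  rw [eventually_map] at hN
  choose M ε hε hM using fun i j => exists_taylor_bound (hQ0 i j) (by simp [h0]) (h1 i j)
  set K := ∑ i, ∑ j, |M i j| with hK
  have hMK : ∀ i j, M i j ≤ K := fun i j => (le_abs_self _).trans <|
    (Finset.single_le_sum (f := fun j => |M i j|) (fun _ _ => abs_nonneg _)
      (Finset.mem_univ j)).trans <| Finset.single_le_sum (f := fun i => ∑ j, |M i j|)
        (fun _ _ => Finset.sum_nonneg fun _ _ => abs_nonneg _) (Finset.mem_univ i)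
  have hK0 : 0 ≤ K := Finset.sum_nonneg fun _ _ => Finset.sum_nonneg fun _ _ => abs_nonneg _
  have hsm : ∀ᶠ δ in 𝓝[>] (0 : ℝ), ∀ i j, δ < ε i j :=
    eventually_all.2 fun i => eventually_all.2 fun j => nhdsWithin_le_nhds (Iio_mem_nhds (hε i j))
  refine ⟨max K (N + 1), ?_⟩
  filter_upwards [hN, hsm, self_mem_nhdsWithin] with δ hδN hδ (hpos : 0 < δ) v
  have hn : ‖δ • (v : E3)‖ = δ := by
    rw [norm_smul, norm_eq_of_mem_sphere, mul_one, Real.norm_eq_abs, abs_of_pos hpos]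
  have hmem : ∀ i j, δ • (v : E3) ∈ ball (0 : E3) (ε i j) := fun i j => by
    rw [mem_ball_zero_iff, hn]; exact hδ i j
  have hN' : ‖((h δ / δ ^ 2)⁻¹, deriv h δ / δ,
      (1 + 3 * hPlus t / t) * (δ ^ 2 * h δ ^ 2) / 4, (0 : E3))‖ ≤ N := hδN
  simp only [Prod.norm_def, sup_le_iff] at hN'
  obtain ⟨hα, hβ, hκ, -⟩ := hN'
  have hN0 : 0 ≤ N := (norm_nonneg _).trans hα
  have hv : ‖(v : E3)‖ = 1 := norm_eq_of_mem_sphere v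
  simp only [fluxArg, Prod.norm_def, sup_le_iff]
  have hNm : N ≤ max K (N + 1) := (by linarith : N ≤ N + 1).trans (le_max_right _ _)
  refine ⟨?_, ?_, hα.trans hNm, hβ.trans hNm, hκ.trans hNm, ?_⟩
  · refine le_trans ?_ (le_max_left _ _)
    refine (pi_norm_le_iff_of_nonneg hK0).2 fun i => (pi_norm_le_iff_of_nonneg hK0).2 fun j =>
      (pi_norm_le_iff_of_nonneg hK0).2 fun k => ?_
    have := (hM i j _ (hmem i j)).2 k
    rw [hn] at this
    rw [Real.norm_eq_abs, abs_div, abs_of_pos hpos, div_le_iff₀ hpos]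
    exact this.trans (mul_le_mul_of_nonneg_right (hMK i j) hpos.le)
  · refine le_trans ?_ (le_max_left _ _)
    refine (pi_norm_le_iff_of_nonneg hK0).2 fun i => (pi_norm_le_iff_of_nonneg hK0).2 fun j => ?_
    have := (hM i j _ (hmem i j)).1
    rw [hn] at this
    have hp2 : 0 < δ ^ 2 := by positivity
    rw [Real.norm_eq_abs, abs_div, abs_of_pos hp2, div_le_iff₀ hp2]
    exact this.trans (mul_le_mul_of_nonneg_right (hMK i j) hp2.le)
  · rw [hv]; exact le_trans (by linarith) (le_max_right _ _)

theorem tendsto_sphereIntegral_normalPhi (hR : 0 < R)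
    (hQ : ∀ i j, ContDiffOn ℝ 2 (fun x => Q x i j) (ball 0 R))
    (h0 : Q 0 = 0) (h1 : ∀ i j k, pd k (fun x => Q x i j) 0 = 0)
    (hlap : ∀ i j, ∑ k, pd k (pd k fun x => Q x i j) 0 = 0) (t : ℝ)
    (hh : ContDiffOn ℝ 1 h (Set.Ioi 0)) (hpos : ∀ r, 0 < r → 0 < h r) {c : ℝ} (hc : 0 < c)
    (hc1 : Tendsto (fun r => h r / r ^ 2) (𝓝[>] 0) (𝓝 c))
    (hc2 : Tendsto (fun r => deriv h r / r) (𝓝[>] 0) (𝓝 (2 * c)))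
    (hb : ∀ r, 0 ≤ r → 0 ≤ h r ∧ h r ≤ 1) :
    Tendsto (fun δ => sphereIntegral δ (normalPhi t h (quotientField Q h))) (𝓝[>] 0)
      (𝓝 (12 * Real.pi)) := by
  have hQ1 : ∀ i j, ContDiffOn ℝ 1 (fun x => Q x i j) (ball 0 R) := fun i j =>
    (hQ i j).of_le (by norm_num)
  set H : Fin 3 → Fin 3 → Fin 3 → Fin 3 → ℝ := fun i j k l => pd l (pd k fun x => Q x i j) 0
  have hRe : ∀ᶠ δ in 𝓝[>] (0 : ℝ), δ < R := nhdsWithin_le_nhds (Iio_mem_nhds hR)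
  obtain ⟨M, hM⟩ := exists_bound_fluxArg hR hQ h0 h1 t hc hc1 hc2 hb
  -- All rescaled arguments lie in one compact ball for small δ, so the continuous density is
  -- bounded there; this constant is the dominating function.
  obtain ⟨K, hK⟩ := (isCompact_closedBall (0 : (Fin 3 → Fin 3 → Fin 3 → ℝ) × (Fin 3 → Fin 3 → ℝ) ×
    ℝ × ℝ × ℝ × E3) M).exists_bound_of_continuousOn continuous_fluxDensity.continuousOn
  have hlim : Tendsto (fun δ => ∫ v : sphere (0 : E3) 1, fluxDensity (fluxArg t h Q δ v)
      ∂(volume : Measure E3).toSphere) (𝓝[>] 0)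
      (𝓝 (∫ v : sphere (0 : E3) 1, fluxDensity (fluxArgLimit H c v)
        ∂(volume : Measure E3).toSphere)) := by
    refine tendsto_integral_filter_of_dominated_convergence (fun _ => K) ?_ ?_
      (integrable_const K) (ae_of_all _ fun v => ?_)
    · filter_upwards [hRe, self_mem_nhdsWithin] with δ hδR (hδ : 0 < δ)
      exact (continuous_fluxDensity.comp (continuous_fluxArg hQ1 t hδ hδR)).aestronglyMeasurable
    · filter_upwards [hM] with δ hδ
      exact ae_of_all _ fun v => hK _ (mem_closedBall_zero_iff.2 (hδ v))
    · exact (continuous_fluxDensity.tendsto _).comp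
        (tendsto_fluxArg hR hQ h0 h1 t hc hc1 hc2 hb v)
  have hval : ∫ v : sphere (0 : E3) 1, fluxDensity (fluxArgLimit H c v)
      ∂(volume : Measure E3).toSphere = 12 * Real.pi := by
    have hI : ∀ i j, Integrable (fun v : sphere (0 : E3) 1 => (1 / (4 * c ^ 2)) *
        (2 * ∑ k, (∑ l, H i j k l * (v : E3) l) ^ 2
          - 5 * (∑ k, ∑ l, H i j k l * ((v : E3) k * (v : E3) l)) ^ 2))
        (volume : Measure E3).toSphere := fun i j =>
      Continuous.integrable_of_hasCompactSupport (by fun_prop) (HasCompactSupport.of_compactSpace _)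
    simp only [fun v : sphere (0 : E3) 1 =>
      fluxDensity_fluxArgLimit H hc.ne' (norm_eq_of_mem_sphere v)]
    rw [integral_add (integrable_const _) (integrable_finsetSum _ fun i _ =>
      integrable_finsetSum _ fun j _ => hI i j), integral_finsetSum _ fun i _ =>
      integrable_finsetSum _ fun j _ => hI i j]
    have hz : ∀ i, ∫ v : sphere (0 : E3) 1, ∑ j, (1 / (4 * c ^ 2)) *
        (2 * ∑ k, (∑ l, H i j k l * (v : E3) l) ^ 2
          - 5 * (∑ k, ∑ l, H i j k l * ((v : E3) k * (v : E3) l)) ^ 2)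
        ∂(volume : Measure E3).toSphere = 0 := fun i => by
      rw [integral_finsetSum _ fun j _ => hI i j]
      refine Finset.sum_eq_zero fun j _ => ?_
      -- Each Hessian is symmetric by C² regularity and traceless because the entry has vanishing
      -- Laplacian at 0.
      rw [integral_const_mul, integral_sphere_symm_traceless (fun k l =>
        pd_pd_comm (contDiffAt_zero_of_ball hR (hQ i j)) k l) (hlap i j), mul_zero]
    rw [Finset.sum_eq_zero fun i _ => hz i, integral_const, toSphere_real_univ, smul_eq_mul]
    ring
  rw [hval] at hlim
  refine hlim.congr' ?_
  filter_upwards [hRe, self_mem_nhdsWithin] with δ hδR (hδ : 0 < δ)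
  rw [sphereIntegral, ← integral_const_mul]
  exact integral_congr_ae (ae_of_all _ fun v =>
    (sq_mul_normalPhi_sphere hQ1 hh hpos t hδ hδR v).symm)

end

end LandauDeGennes

/-! ### The main theorem -/

theorem mainTheorem9 (t R : ℝ) (ht : 0 < t) (hR : 0 < R)
    (Q : LandauDeGennes.E3 → LandauDeGennes.Mat3) (h : ℝ → ℝ)
    (hmin : LandauDeGennes.IsGlobalMinimizer t R Q)
    (hcont : ContinuousOn Q (ball 0 R))
    (huni : LandauDeGennes.IsUniaxialOn Q (ball 0 R))
    (hzero : Q 0 = 0)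
    (hh : LandauDeGennes.IsHedgehogProfile t h) :
    (∀ i j, ContDiffOn ℝ 1 (fun x => LandauDeGennes.quotientField Q h x i j)
      (ball 0 R \ {0})) ∧
    (∀ δ, 0 < δ → δ < R → Integrable
      (fun v : sphere (0 : LandauDeGennes.E3) 1 =>
        LandauDeGennes.normalPhi t h (LandauDeGennes.quotientField Q h)
          (δ • (v : LandauDeGennes.E3)))
      (volume : Measure LandauDeGennes.E3).toSphere) ∧
    Tendsto
      (fun δ => LandauDeGennes.sphereIntegral δ
        (LandauDeGennes.normalPhi t h (LandauDeGennes.quotientField Q h)))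
      (𝓝[>] 0) (𝓝 (12 * Real.pi)) := by
  obtain ⟨G, hQ, hG⟩ := hmin
  obtain ⟨hQ2, hlap⟩ := LandauDeGennes.minimizer_regularity ht hR hQ hG hcont
    (fun x hx => huni.mem_S0 hx) hzero
  have hQ1 : ∀ i j, ContDiffOn ℝ 1 (fun x => Q x i j) (ball 0 R) := fun i j =>
    (hQ2 i j).of_le (by norm_num)
  have hball : ball (0 : LandauDeGennes.E3) R ∈ 𝓝 0 := isOpen_ball.mem_nhds (mem_ball_self hR)
  have hgrad := LandauDeGennes.pd_eq_zero_of_trace_cube_nonneg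
    (fun i j => (LandauDeGennes.contDiffAt_zero_of_ball hR (hQ1 i j)).differentiableAt
      (by norm_num)) hzero
    (Filter.mem_of_superset hball fun x hx => LandauDeGennes.uniaxial_trace_relation huni hx)
    (Filter.mem_of_superset hball fun x hx =>
      LandauDeGennes.trace_cube_nonneg_of_minimizer ht hQ hG hcont huni hQ1 hx)
  have hpos : ∀ r, 0 < r → 0 < h r := fun r hr => hh.pos ht hr
  have hC1 := hh.contDiffOn_one
  obtain ⟨c, hc, hc1, hc2⟩ := LandauDeGennes.IsHedgehogProfile.exists_asymptotics ht hh
  exact ⟨LandauDeGennes.contDiffOn_quotientField hQ1 hC1 hpos,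
    fun δ hδ hδR => LandauDeGennes.integrable_normalPhi hQ1 hC1 hpos t hδ hδR,
    LandauDeGennes.tendsto_sphereIntegral_normalPhi hR hQ2 hzero hgrad hlap t hC1 hpos hc hc1 hc2
      hh.bounds⟩
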